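/- Let $d\ge 1$ and write $\langle z\rangle=\sqrt{1+|z|^2}$. For ${\bf m}=(m_1,\dots,m_J)\in\mathbb R^J$ and ${\bf d}=(d_1,\dots,d_J)$, a family $u=(u^\varepsilon)$ of complex-valued functions on $\mathbb R^{d_1}\times\dots\times\mathbb R^{d_J}$ belongs to $S[{\bf m};{\bf d}]$ on $0<\varepsilon\le\varepsilon_0$, if every $u^\varepsilon$ is $C^\infty$ and $\sup_{0<\varepsilon\le\varepsilon_0}\sup_z\big|\prod_j\langle z_j\rangle^{-m_j}\,\partial_z^\alpha u^\varepsilon(z)\big|<\infty$ for every multiindex $\alpha$. An entry $+\infty$ in ${\bf m}$ stands for the union over all real values of that entry. For a differentiable vector-valued $G$, $G_q$ and $G_p$ denote the transposed Jacobians, $(G_q)_{jk}=\partial_{q_j}G_k$, $(G_p)_{jk}=\partial_{p_j}G_k$; $\dagger$ denotes the transpose, and $a\cdot b=\sum_k a_kb_k$ also for complex vectors. Let $\kappa=(X^\kappa,\Xi^\kappa)$ be a canonical transformation of class $\mathcal B$ of $\mathbb R^d\times\mathbb R^d$, i.e. a diffeomorphism whose Jacobian matrix $$F^\kappa=\begin{pmatrix}(X^\kappa_q)^\dagger&(X^\kappa_p)^\dagger\\(\Xi^\kappa_q)^\dagger&(\Xi^\kappa_p)^\dagger\end{pmatrix}$$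 is symplectic at every point and has all its entries in $S[0;2d]$. Let $S^\kappa$ be an associated action, i.e. a real function with $S^\kappa_q=-p+X^\kappa_q\Xi^\kappa$ and $S^\kappa_p=X^\kappa_p\Xi^\kappa$. Let $\Theta^x,\Theta^y$ be complex symmetric $d\times d$ matrices with positive definite real part, and put \begin{align*} \Phi^\kappa(x,y,q,p)={}&S^\kappa(q,p)-p\cdot(y-q)+\Xi^\kappa(q,p)\cdot(x-X^\kappa(q,p))+\tfrac i2(y-q)\cdot\Theta^y(y-q)\\ &+\tfrac i2(x-X^\kappa(q,p))\cdot\Theta^x(x-X^\kappa(q,p)),\\ \mathcal Z(q,p)={}&\begin{pmatrix}i(\Theta^y)^{-1}&\mathrm{id}\end{pmatrix}F^\kappa(q,p)^\dagger\begin{pmatrix}-i\Theta^x\\ \mathrm{id}\end{pmatrix}. \end{align*} For $W=(W_1,\dots,W_d)$ depending differentiably on $(q,p)$ let $$\operatorname{div}W=\sum_{j,k}\big((\Theta^y)^{-1}\big)_{jk}\partial_{q_k}W_j-i\sum_j\partial_{p_j}W_j .$$ For $u\in S[(+\infty,m^p);(3d,d)]$, a function of $(x,y,q)\in\mathbb R^{3d}$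 and $p\in\mathbb R^d$, for a Schwartz function $\varphi$ and an integer $n\ge 0$ with $n>m^p+d$, define $$[\mathcal I^\varepsilon(\kappa;u)\varphi](x)=\frac1{(2\pi\varepsilon)^{3d/2}}\int_{\mathbb R^{3d}}e^{\frac i\varepsilon\Phi^\kappa(x,y,q,p)}(L_y^\dagger)^n[u^\varepsilon(x,y,q,p)\varphi(y)]\,dq\,dp\,dy ,$$ where $L_y^\dagger$ is the transpose, with respect to $\int fg\,dy$, of $$L_y=\frac{1}{1+|\nabla_y\Phi^\kappa|^2}\big[1-i\varepsilon\,\nabla_y\overline{\Phi^\kappa}\cdot\nabla_y\big].$$ For $u,v\in S[+\infty;4d]$ on $0<\varepsilon\le\varepsilon_0$ write $u\sim v$ if these integrals converge absolutely and $\mathcal I^\varepsilon(\kappa;u)\varphi=\mathcal I^\varepsilon(\kappa;v)\varphi$ for all Schwartz functions $\varphi$, all $0<\varepsilon\le\varepsilon_0$, and all admissible choices of $n$ on either side. **Lemma.** Let $0<\varepsilon_0\le1$, $m^x,m^q,m^p\in\mathbb R$, let $u=u^\varepsilon(x,q,p)$ belong to $S[(m^x,m^q,m^p);(d,d,d)]$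 on $0<\varepsilon\le\varepsilon_0$, and let $1\le j\le d$. Then $\mathcal Z(q,p)$ is invertible for all $(q,p)$, and $$\big(x_j-X^\kappa_j(q,p)\big)\,u\;\sim\;\varepsilon v,\qquad v(x,q,p)=-\operatorname{div}\big(e_j^\dagger\,\mathcal Z^{-1}(q,p)\,u(x,q,p)\big),$$ where $v\in S[(m^x,m^q,m^p);(d,d,d)]$ on $0<\varepsilon\le\varepsilon_0$ and the divergence is taken in $(q,p)$ for fixed $x$. -/

import Mathlib

open scoped ContDiff SchwartzMap Matrix

noncomputable section

namespace HermanKluk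

/-- The Euclidean space `ℝ^d`. -/
abbrev Vec (d : ℕ) : Type := EuclideanSpace ℝ (Fin d)

/-! ### Symbol classes -/

/-- The Japanese bracket `⟨z⟩ = √(1 + |z|²)`. -/
def bracket {d : ℕ} (z : Vec d) : ℝ := Real.sqrt (1 + ‖z‖ ^ 2)

/-- `u = (u^ε)` is a symbol with weight `w` on `0 < ε ≤ ε₀`: each `u^ε` is smooth, and every
derivative (of every order `k`, including `k = 0`) is bounded by a constant times `w`, uniformly in
`z` and in `ε ∈ ]0, ε₀]`. The symbol classes are obtained by choosing for `w` a product of powers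
of brackets. -/
def IsSymbol {V W : Type*} [NormedAddCommGroup V] [NormedSpace ℝ V]
    [NormedAddCommGroup W] [NormedSpace ℝ W] (ε₀ : ℝ) (w : V → ℝ) (u : ℝ → V → W) : Prop :=
  (∀ ε : ℝ, 0 < ε → ε ≤ ε₀ → ContDiff ℝ ∞ (u ε)) ∧
  ∀ k : ℕ, ∃ C : ℝ, ∀ ε : ℝ, 0 < ε → ε ≤ ε₀ → ∀ z : V,
    ‖iteratedFDeriv ℝ k (u ε) z‖ ≤ C * w z

/-- The class `S[(m^x, m^q, m^p); (d, d, d)]` of symbols `u^ε(x, q, p)`. -/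
def IsSymbolXQP {d : ℕ} (ε₀ mx mq mp : ℝ) (u : ℝ → Vec d × Vec d × Vec d → ℂ) : Prop :=
  IsSymbol ε₀ (fun z => bracket z.1 ^ mx * bracket z.2.1 ^ mq * bracket z.2.2 ^ mp) u

/-- The class `S[(m, m^p); (3d, d)]` of symbols `u^ε(x, y, q, p)`, with blocks `(x, y, q)`
and `p`. -/
def IsSymbol3 {d : ℕ} (ε₀ m mp : ℝ) (u : ℝ → Vec d × Vec d × Vec d × Vec d → ℂ) : Prop :=
  IsSymbol ε₀ (fun z => Real.sqrt (1 + (‖z.1‖ ^ 2 + ‖z.2.1‖ ^ 2 + ‖z.2.2.1‖ ^ 2)) ^ m *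
    bracket z.2.2.2 ^ mp) u

/-- The class `S[+∞; 4d]` of symbols `u^ε(x, y, q, p)`. -/
def IsSymbolInfty {d : ℕ} (ε₀ : ℝ) (u : ℝ → Vec d × Vec d × Vec d × Vec d → ℂ) : Prop :=
  ∃ m : ℝ, IsSymbol ε₀ (fun z => Real.sqrt
    (1 + (‖z.1‖ ^ 2 + ‖z.2.1‖ ^ 2 + ‖z.2.2.1‖ ^ 2 + ‖z.2.2.2‖ ^ 2)) ^ m) u

/-! ### Canonical transformations and actions -/

/-- The partial derivative `∂_{q_j} f` at `(q, p)`. -/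
def partialQ {d : ℕ} {W : Type*} [NormedAddCommGroup W] [NormedSpace ℝ W] (j : Fin d)
    (f : Vec d × Vec d → W) (z : Vec d × Vec d) : W :=
  fderiv ℝ f z (EuclideanSpace.single j 1, 0)

/-- The partial derivative `∂_{p_j} f` at `(q, p)`. -/
def partialP {d : ℕ} {W : Type*} [NormedAddCommGroup W] [NormedSpace ℝ W] (j : Fin d)
    (f : Vec d × Vec d → W) (z : Vec d × Vec d) : W :=
  fderiv ℝ f z (0, EuclideanSpace.single j 1)

/-- `G_q`, the transpose of the Jacobian of `G` with respect to `q`: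
`(G_q)_{jk} = ∂_{q_j} G_k`. -/
def transJacQ {d : ℕ} (G : Vec d × Vec d → Vec d) (z : Vec d × Vec d) :
    Matrix (Fin d) (Fin d) ℝ :=
  Matrix.of fun j k => partialQ j (fun w => G w k) z

/-- `G_p`, the transpose of the Jacobian of `G` with respect to `p`:
`(G_p)_{jk} = ∂_{p_j} G_k`. -/
def transJacP {d : ℕ} (G : Vec d × Vec d → Vec d) (z : Vec d × Vec d) :
    Matrix (Fin d) (Fin d) ℝ :=
  Matrix.of fun j k => partialP j (fun w => G w k) z

/-- The Jacobian matrix `F^κ` of `κ = (X, Ξ)`, with blocks `X_q† X_p†` and `Ξ_q† Ξ_p†`. -/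
def jacobian {d : ℕ} (κ : Vec d × Vec d → Vec d × Vec d) (z : Vec d × Vec d) :
    Matrix (Fin d ⊕ Fin d) (Fin d ⊕ Fin d) ℝ :=
  Matrix.fromBlocks
    (transJacQ (fun w => (κ w).1) z)ᵀ (transJacP (fun w => (κ w).1) z)ᵀ
    (transJacQ (fun w => (κ w).2) z)ᵀ (transJacP (fun w => (κ w).2) z)ᵀ

/-- A canonical transformation of `T*ℝ^d`: a diffeomorphism with symplectic Jacobian. -/
structure IsCanonical {d : ℕ} (κ : Vec d × Vec d → Vec d × Vec d) : Prop where
  contDiff : ContDiff ℝ ∞ κ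
  exists_inverse : ∃ κ' : Vec d × Vec d → Vec d × Vec d,
    ContDiff ℝ ∞ κ' ∧ Function.LeftInverse κ' κ ∧ Function.RightInverse κ' κ
  symplectic : ∀ z, jacobian κ z ∈ Matrix.symplecticGroup (Fin d) ℝ

/-- A canonical transformation of class `𝓑`: the entries of `F^κ` belong to `S[0; 2d]`. -/
structure IsClassB {d : ℕ} (κ : Vec d × Vec d → Vec d × Vec d) : Prop
    extends IsCanonical κ where
  jacobian_symbol : ∀ i k, IsSymbol 1 (fun _ => 1) (fun _ z => jacobian κ z i k)

/-- `S` is an action associated to `κ = (X, Ξ)`: `S_q = -p + X_q Ξ` and `S_p = X_p Ξ`. -/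
structure IsAction {d : ℕ} (κ : Vec d × Vec d → Vec d × Vec d) (S : Vec d × Vec d → ℝ) :
    Prop where
  differentiable : Differentiable ℝ S
  partialQ_eq : ∀ (z : Vec d × Vec d) (j : Fin d), partialQ j S z =
    -z.2 j + ∑ k, transJacQ (fun w => (κ w).1) z j k * (κ z).2 k
  partialP_eq : ∀ (z : Vec d × Vec d) (j : Fin d), partialP j S z =
    ∑ k, transJacP (fun w => (κ w).1) z j k * (κ z).2 k

/-- The matrices allowed for `Θ^x` and `Θ^y`: complex symmetric with positive definite real
part. -/
structure IsAdmissible {d : ℕ} (Θ : Matrix (Fin d) (Fin d) ℂ) : Prop where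
  symm : Θ.IsSymm
  posDef_re : (Θ.map Complex.re).PosDef

/-! ### The Fourier integral operator -/

/-- A real vector seen as a complex one. -/
def toC {d : ℕ} (a : Vec d) : Fin d → ℂ := fun k => (a k : ℂ)

/-- The complex phase `Φ^κ(x, y, q, p; Θ^x, Θ^y)`. The dot product is bilinear. -/
def phase {d : ℕ} (κ : Vec d × Vec d → Vec d × Vec d) (S : Vec d × Vec d → ℝ)
    (Θx Θy : Matrix (Fin d) (Fin d) ℂ) (x y q p : Vec d) : ℂ :=
  (S (q, p) : ℂ) - toC p ⬝ᵥ toC (y - q) + toC (κ (q, p)).2 ⬝ᵥ toC (x - (κ (q, p)).1)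
    + Complex.I / 2 * (toC (y - q) ⬝ᵥ (Θy *ᵥ toC (y - q)))
    + Complex.I / 2 * (toC (x - (κ (q, p)).1) ⬝ᵥ (Θx *ᵥ toC (x - (κ (q, p)).1)))

/-- The partial derivative `∂_{y_k} f` at `y`. -/
def partialY {d : ℕ} (k : Fin d) (f : Vec d → ℂ) (y : Vec d) : ℂ :=
  fderiv ℝ f y (EuclideanSpace.single k 1)

/-- The differential operator
`L f = (1 + |∇φ|²)⁻¹ (f - iε (∇ conj φ) · ∇f)` associated to the phase `φ` on `ℝ^d`. -/
def opL {d : ℕ} (ε : ℝ) (φ : Vec d → ℂ) (f : Vec d → ℂ) : Vec d → ℂ := fun y =>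
  (1 + ∑ k, (‖partialY k φ y‖ : ℂ) ^ 2)⁻¹ *
    (f y - Complex.I * ε *
      ∑ k, partialY k (fun y' => (starRingEnd ℂ) (φ y')) y * partialY k f y)

/-- The transpose `L†` of `L` for the bilinear pairing `∫ f g`:
`L† f = f / (1 + |∇φ|²) + iε ∑_k ∂_k ((∂_k conj φ) f / (1 + |∇φ|²))`. -/
def opLT {d : ℕ} (ε : ℝ) (φ : Vec d → ℂ) (f : Vec d → ℂ) : Vec d → ℂ := fun y =>
  (1 + ∑ k, (‖partialY k φ y‖ : ℂ) ^ 2)⁻¹ * f y +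
    Complex.I * ε * ∑ k, partialY k (fun y' =>
      (1 + ∑ l, (‖partialY l φ y'‖ : ℂ) ^ 2)⁻¹ *
        partialY k (fun y'' => (starRingEnd ℂ) (φ y'')) y' * f y') y

/-- The integrand `e^{iΦ/ε} (L_y†)^n [u(x, y, q, p) φ(y)]`, as a function of `(q, p, y)`. -/
def fioIntegrand {d : ℕ} (κ : Vec d × Vec d → Vec d × Vec d) (S : Vec d × Vec d → ℝ)
    (Θx Θy : Matrix (Fin d) (Fin d) ℂ) (n : ℕ) (ε : ℝ)
    (u : ℝ → Vec d × Vec d × Vec d × Vec d → ℂ) (φ : 𝓢(Vec d, ℂ)) (x : Vec d)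
    (w : Vec d × Vec d × Vec d) : ℂ :=
  Complex.exp (Complex.I / ε * phase κ S Θx Θy x w.2.2 w.1 w.2.1) *
    (opLT ε (fun y => phase κ S Θx Θy x y w.1 w.2.1))^[n]
      (fun y => u ε (x, y, w.1, w.2.1) * φ y) w.2.2

/-- `[𝓘^ε(κ; u; Θ^x, Θ^y) φ](x)`, computed with the `n`-th power of `L_y†`. -/
def fio {d : ℕ} (κ : Vec d × Vec d → Vec d × Vec d) (S : Vec d × Vec d → ℝ)
    (Θx Θy : Matrix (Fin d) (Fin d) ℂ) (n : ℕ) (ε : ℝ)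
    (u : ℝ → Vec d × Vec d × Vec d × Vec d → ℂ) (φ : 𝓢(Vec d, ℂ)) (x : Vec d) : ℂ :=
  (((2 * Real.pi * ε) ^ (3 * (d : ℝ) / 2) : ℝ) : ℂ)⁻¹ *
    ∫ w : Vec d × Vec d × Vec d, fioIntegrand κ S Θx Θy n ε u φ x w

/-- The powers `n` that may be used to define the operator with symbol `u`: `n > m^p + d` for
some `m^p` such that `u ∈ S[(+∞, m^p); (3d, d)]`. -/
def AdmissiblePower {d : ℕ} (ε₀ : ℝ) (u : ℝ → Vec d × Vec d × Vec d × Vec d → ℂ) (n : ℕ) :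
    Prop :=
  ∃ m mp : ℝ, IsSymbol3 ε₀ m mp u ∧ mp + d < n

/-- Equivalence `u ∼ v` with respect to `κ` of two symbols in `S[+∞; 4d]` (on `0 < ε ≤ ε₀`):
the operators with symbols `u` and `v` agree on the Schwartz space. The operators are given by
absolutely convergent integrals, and they agree for all powers `n`, `n'` admissible in the
definition of the first and of the second operator, respectively. -/
structure Equivalent {d : ℕ} (κ : Vec d × Vec d → Vec d × Vec d) (S : Vec d × Vec d → ℝ)
    (Θx Θy : Matrix (Fin d) (Fin d) ℂ) (ε₀ : ℝ)
    (u v : ℝ → Vec d × Vec d × Vec d × Vec d → ℂ) : Prop where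
  symbol_left : IsSymbolInfty ε₀ u
  symbol_right : IsSymbolInfty ε₀ v
  integrable_left : ∀ n, AdmissiblePower ε₀ u n → ∀ ε : ℝ, 0 < ε → ε ≤ ε₀ →
    ∀ (φ : 𝓢(Vec d, ℂ)) (x : Vec d),
      MeasureTheory.Integrable (fioIntegrand κ S Θx Θy n ε u φ x)
  integrable_right : ∀ n, AdmissiblePower ε₀ v n → ∀ ε : ℝ, 0 < ε → ε ≤ ε₀ →
    ∀ (φ : 𝓢(Vec d, ℂ)) (x : Vec d),
      MeasureTheory.Integrable (fioIntegrand κ S Θx Θy n ε v φ x)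
  fio_eq : ∀ n n', AdmissiblePower ε₀ u n → AdmissiblePower ε₀ v n' →
    ∀ ε : ℝ, 0 < ε → ε ≤ ε₀ → ∀ (φ : 𝓢(Vec d, ℂ)) (x : Vec d),
      fio κ S Θx Θy n ε u φ x = fio κ S Θx Θy n' ε v φ x

/-! ### The matrix `𝒵` and the divergence -/

/-- The partial derivative `∂_{z_j} = ∑_k ((Θ^y)⁻¹)_{jk} ∂_{q_k} - i ∂_{p_j}`. -/
def partialZ {d : ℕ} (Θy : Matrix (Fin d) (Fin d) ℂ) (j : Fin d)
    (f : Vec d × Vec d → ℂ) (z : Vec d × Vec d) : ℂ :=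
  (∑ k, Θy⁻¹ j k * partialQ k f z) - Complex.I * partialP j f z

/-- `div G = ∑_{j,k} ((Θ^y)⁻¹)_{jk} ∂_{q_k} G_j - i ∑_j ∂_{p_j} G_j`. -/
def divZ {d : ℕ} (Θy : Matrix (Fin d) (Fin d) ℂ)
    (G : Vec d × Vec d → Fin d → ℂ) (z : Vec d × Vec d) : ℂ :=
  ∑ j, partialZ Θy j (fun w => G w j) z

/-- The matrix `𝒵(q, p) = (i(Θ^y)⁻¹  id) F^κ(q, p)† (-iΘ^x  id)†`. -/
def matZ {d : ℕ} (κ : Vec d × Vec d → Vec d × Vec d) (Θx Θy : Matrix (Fin d) (Fin d) ℂ)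
    (z : Vec d × Vec d) : Matrix (Fin d) (Fin d) ℂ :=
  (Matrix.fromCols (Complex.I • Θy⁻¹) 1 : Matrix (Fin d) (Fin d ⊕ Fin d) ℂ) *
    ((jacobian κ z).map Complex.ofReal)ᵀ *
    (Matrix.fromRows (-(Complex.I • Θx)) 1 : Matrix (Fin d ⊕ Fin d) (Fin d) ℂ)

/-- The vector `Z^κ = R X^κ + i R⁻¹ Ξ^κ`, where `R = (Θ^x)^{1/2}`. -/
def vecZ {d : ℕ} (κ : Vec d × Vec d → Vec d × Vec d) (R : Matrix (Fin d) (Fin d) ℂ)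
    (z : Vec d × Vec d) : Fin d → ℂ :=
  R *ᵥ toC (κ z).1 + Complex.I • (R⁻¹ *ᵥ toC (κ z).2)

/-- `v = -div(e_j† 𝒵⁻¹ u)`, the divergence being taken in `(q, p)` with `x` fixed. -/
def symbolV {d : ℕ} (κ : Vec d × Vec d → Vec d × Vec d) (Θx Θy : Matrix (Fin d) (Fin d) ℂ)
    (j : Fin d) (u : ℝ → Vec d × Vec d × Vec d → ℂ) : ℝ → Vec d × Vec d × Vec d → ℂ :=
  fun ε w => -divZ Θy (fun z k => (matZ κ Θx Θy z)⁻¹ j k * u ε (w.1, z)) w.2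

/-- A function of `(x, q, p)` seen as a function of `(x, y, q, p)`. -/
def liftY {d : ℕ} (u : ℝ → Vec d × Vec d × Vec d → ℂ) :
    ℝ → Vec d × Vec d × Vec d × Vec d → ℂ :=
  fun ε w => u ε (w.1, w.2.2)

theorem fderiv_vecZ {d : ℕ} {κ : Vec d × Vec d → Vec d × Vec d} (hκ : Differentiable ℝ κ)
    (R : Matrix (Fin d) (Fin d) ℂ) (z : Vec d × Vec d) (e : Vec d × Vec d) (k : Fin d) :
    fderiv ℝ (fun w => vecZ κ R w k) z e =
      ∑ l, R k l * ((fderiv ℝ (fun w => (κ w).1 l) z e : ℝ) : ℂ) +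
        Complex.I * ∑ l, R⁻¹ k l * ((fderiv ℝ (fun w => (κ w).2 l) z e : ℝ) : ℂ) := by
  have h1 : ∀ l, HasFDerivAt (fun w => (((κ w).1 l : ℝ) : ℂ))
      (Complex.ofRealCLM.comp (fderiv ℝ (fun w => (κ w).1 l) z)) z := fun l =>
    Complex.ofRealCLM.hasFDerivAt.comp z
      (DifferentiableAt.hasFDerivAt (by fun_prop))
  have h2 : ∀ l, HasFDerivAt (fun w => (((κ w).2 l : ℝ) : ℂ))
      (Complex.ofRealCLM.comp (fderiv ℝ (fun w => (κ w).2 l) z)) z := fun l =>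
    Complex.ofRealCLM.hasFDerivAt.comp z
      (DifferentiableAt.hasFDerivAt (by fun_prop))
  have h3 := (HasFDerivAt.fun_sum (u := Finset.univ)
      (fun l _ => (h1 l).const_mul (R k l))).add
    ((HasFDerivAt.fun_sum (u := Finset.univ)
      (fun l _ => (h2 l).const_mul (R⁻¹ k l))).const_mul Complex.I)
  have h4 : (fun w => vecZ κ R w k) = fun w => (∑ l, R k l * (((κ w).1 l : ℝ) : ℂ)) +
      Complex.I * ∑ l, R⁻¹ k l * (((κ w).2 l : ℝ) : ℂ) := by
    funext w
    simp [vecZ, toC, Matrix.mulVec, dotProduct]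
  rw [h4]
  erw [h3.fderiv]
  simp

/-- For the square root `R` of `Θ^x`, the matrix `𝒵` is `Z^κ_z (Θ^x)^{1/2}`, where
`(Z^κ_z)_{jk} = ∂_{z_j} Z^κ_k`. -/
theorem matZ_eq {d : ℕ} {κ : Vec d × Vec d → Vec d × Vec d} (hκ : Differentiable ℝ κ)
    (Θx Θy R : Matrix (Fin d) (Fin d) ℂ) (hR : R.IsSymm) (hR2 : R * R = Θx)
    (hdet : IsUnit R.det) (z : Vec d × Vec d) :
    matZ κ Θx Θy z = Matrix.of (fun j k => partialZ Θy j (fun w => vecZ κ R w k) z) * R := by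
  have key : Matrix.of (fun j k => partialZ Θy j (fun w => vecZ κ R w k) z) =
      Θy⁻¹ * ((transJacQ (fun w => (κ w).1) z).map Complex.ofReal * R +
        Complex.I • ((transJacQ (fun w => (κ w).2) z).map Complex.ofReal * R⁻¹)) -
      Complex.I • ((transJacP (fun w => (κ w).1) z).map Complex.ofReal * R +
        Complex.I • ((transJacP (fun w => (κ w).2) z).map Complex.ofReal * R⁻¹)) := by
    have hs : ∀ a b, R a b = R b a := fun a b => hR.apply b a
    have hs' : ∀ a b, R⁻¹ a b = R⁻¹ b a := fun a b =>
      (show (R⁻¹).IsSymm by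
        rw [Matrix.IsSymm, Matrix.transpose_nonsing_inv, hR.eq]).apply b a
    ext j k
    simp only [Matrix.of_apply, partialZ, partialQ, partialP, fderiv_vecZ hκ]
    simp only [Matrix.sub_apply, Matrix.mul_apply, Matrix.add_apply, Matrix.smul_apply,
      Matrix.map_apply, transJacQ, transJacP, Matrix.of_apply, partialQ, partialP, smul_eq_mul]
    simp only [hs k, hs' k, mul_comm (R _ k), mul_comm (R⁻¹ _ k)]
  have hinv : R⁻¹ * R = 1 := Matrix.nonsing_inv_mul R hdet
  rw [key, matZ, jacobian, Matrix.fromBlocks_map, Matrix.fromBlocks_transpose,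
    Matrix.fromCols_mul_fromBlocks, Matrix.fromCols_mul_fromRows]
  simp only [Matrix.transpose_map, Matrix.transpose_transpose, sub_mul, add_mul, mul_add,
    Matrix.mul_assoc, smul_mul_assoc, mul_smul_comm, hinv, hR2, smul_add, smul_smul,
    Complex.I_mul_I, Matrix.mul_one, Matrix.one_mul]
  have hII : ∀ M : Matrix (Fin d) (Fin d) ℂ, Complex.I • Complex.I • M = -M := fun M => by
    rw [smul_smul, Complex.I_mul_I, neg_one_smul]
  simp [hII]
  abel

end HermanKluk

end

/-! The heart is the identity `i ∂_z Φ = 𝒵 (x - X)` with `∂_z = (Θ^y)⁻¹ ∂_q - i ∂_p`. The equations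
for the action cancel all terms of `∂_q Φ` and `∂_p Φ` without a factor `y - q` or `x - X`. The
combination `∂_z` then cancels the multiples of `y - q`, and the rest is `𝒵 (x - X)`. Hence `(x_j -
X_j) e^{iΦ/ε} = ε ∑_k (𝒵⁻¹)_{jk} ∂_{z_k} e^{iΦ/ε}`, and integration by parts in `(q, p)` moves `∂_z`
onto `𝒵⁻¹ u`, which gives `-ε div`.

Two things have to be secured. The first is algebraic: `𝒵` is invertible and `𝒵⁻¹` has entries in
`S[0; 2d]`. If `𝒵 v = 0`, the Hermitian form defined by `J`, which a real symplectic matrix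
preserves, equates a nonnegative multiple of `i` with a nonpositive one, and positivity of `Re Θ^x`
forces `v = 0` (`isUnit_matZOf`). The Jacobians stay in a compact set of symplectic matrices, so
`det 𝒵` is bounded away from zero (`exists_det_matZ_bound`), and Cramer's rule yields the symbol
estimates.

The second is analytic: the triple integral without `L_y†` need not converge absolutely, and the
coefficients of `L_y†` depend on `(q, p)`. Therefore the integral over `y` is taken first
(`ampIntegral`). It converges by the decay of `φ`, and it does not change under `L_y†`, by
integration by parts in `y` alone (`ampIntegral_jointLT`). Each `L_y†` gains a power of `⟨p⟩⁻¹`,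
while the Gaussian in `y - q` converts decay in `y` into decay in `q`. So the inner integral is an
integrable function of `(q, p)` whatever the order of the amplitude (`integrable_ampIntegral`), and
the operator equals its integral for every admissible `n` (`fio_eq_integral_ampIntegral`). The
derivatives of the inner integral are again of this kind and thus integrable, so their integrals
vanish (`integral_ampIntegral_twist`). The formal computation above is then legitimate
(`integral_ampIntegral_sub_mul`). -/

open scoped ContDiff SchwartzMap Matrix

noncomputable section

namespace HermanKluk

/-! ### Calculus of symbols with a general weight. -/

section SymbolCalculus

variable {V V' W W' W'' : Type*} [NormedAddCommGroup V] [NormedSpace ℝ V]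
  [NormedAddCommGroup V'] [NormedSpace ℝ V']
  [NormedAddCommGroup W] [NormedSpace ℝ W] [NormedAddCommGroup W'] [NormedSpace ℝ W']
  [NormedAddCommGroup W''] [NormedSpace ℝ W'']
  {ε₀ : ℝ} {w w' : V → ℝ}

/-- The derivatives of order `k` of `u^ε` are bounded by a constant times `w`. -/
def DerivBound (ε₀ : ℝ) (w : V → ℝ) (u : ℝ → V → W) (k : ℕ) : Prop :=
  ∃ C : ℝ, ∀ ε : ℝ, 0 < ε → ε ≤ ε₀ → ∀ z : V, ‖iteratedFDeriv ℝ k (u ε) z‖ ≤ C * w z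

theorem DerivBound.mono {u : ℝ → V → W} {k : ℕ} (h : DerivBound ε₀ w u k)
    (hw : ∀ z, 0 ≤ w z) {C : ℝ} (hC : ∀ z, w z ≤ C * w' z) : DerivBound ε₀ w' u k := by
  obtain ⟨D, hD⟩ := h
  refine ⟨|D| * C, fun ε h0 h1 z => (hD ε h0 h1 z).trans ?_⟩
  calc D * w z ≤ |D| * w z := by gcongr; exacts [hw z, le_abs_self D]
    _ ≤ |D| * (C * w' z) := by gcongr; exact hC z
    _ = _ := by ring

theorem IsSymbol.mono {u : ℝ → V → W} (h : IsSymbol ε₀ w u) (hw : ∀ z, 0 ≤ w z) {C : ℝ}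
    (hC : ∀ z, w z ≤ C * w' z) : IsSymbol ε₀ w' u :=
  ⟨h.1, fun k => DerivBound.mono (h.2 k) hw hC⟩

theorem IsSymbol.bound {u : ℝ → V → W} (h : IsSymbol ε₀ w u) :
    ∃ C : ℝ, ∀ ε : ℝ, 0 < ε → ε ≤ ε₀ → ∀ z, ‖u ε z‖ ≤ C * w z := by
  obtain ⟨C, hC⟩ := h.2 0
  exact ⟨C, fun ε h0 h1 z => by simpa using hC ε h0 h1 z⟩

/-- Functions without a parameter are treated as constant families on `0 < ε ≤ 1`; this and the next
lemma pass between the two points of view. -/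
theorem IsSymbol.fixed {u : ℝ → V → W} (h : IsSymbol ε₀ w u) {ε : ℝ} (h0 : 0 < ε)
    (h1 : ε ≤ ε₀) : IsSymbol 1 w (fun _ => u ε) :=
  ⟨fun _ _ _ => h.1 ε h0 h1, fun k => (h.2 k).imp fun _ hC _ _ _ z => hC ε h0 h1 z⟩

theorem IsSymbol.of_fixed {f : V → W} (h : IsSymbol 1 w (fun _ => f)) (ε₀ : ℝ) :
    IsSymbol ε₀ w (fun _ => f) :=
  ⟨fun _ _ _ => h.1 1 one_pos le_rfl, fun k => (h.2 k).imp fun _ hC _ _ _ z =>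
    hC 1 one_pos le_rfl z⟩

theorem IsSymbol.contDiff {f : V → W} (h : IsSymbol 1 w (fun _ => f)) : ContDiff ℝ ∞ f :=
  h.1 1 one_pos le_rfl

/-- Leibniz rule. Only orders up to `n` of the factors enter, so the bound can be used inside an
induction on the order of differentiation. -/
theorem DerivBound.bilin (B : W →L[ℝ] W' →L[ℝ] W'') {u : ℝ → V → W} {v : ℝ → V → W'} {n : ℕ}
    (hu : ∀ ε : ℝ, 0 < ε → ε ≤ ε₀ → ContDiff ℝ ∞ (u ε))
    (hv : ∀ ε : ℝ, 0 < ε → ε ≤ ε₀ → ContDiff ℝ ∞ (v ε))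
    (hun : ∀ i ≤ n, DerivBound ε₀ w u i) (hvn : ∀ i ≤ n, DerivBound ε₀ w' v i) :
    DerivBound ε₀ (fun z => w z * w' z) (fun ε z => B (u ε z) (v ε z)) n := by
  choose! C hC using hun
  choose! D hD using hvn
  refine ⟨‖B‖ * ∑ i ∈ Finset.range (n + 1), (n.choose i : ℝ) * C i * D (n - i),
    fun ε h0 h1 z => ?_⟩
  refine (B.norm_iteratedFDeriv_le_of_bilinear (hu ε h0 h1) (hv ε h0 h1) z
    (n := n) (by exact_mod_cast le_top)).trans ?_
  rw [mul_assoc]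
  refine mul_le_mul_of_nonneg_left ?_ (norm_nonneg B)
  rw [Finset.sum_mul]
  refine Finset.sum_le_sum fun i hi => ?_
  have hi' : i ≤ n := Nat.lt_succ_iff.mp (Finset.mem_range.mp hi)
  have h2 := hC i hi' ε h0 h1 z
  have h3 := hD (n - i) (Nat.sub_le _ _) ε h0 h1 z
  calc (n.choose i : ℝ) * ‖iteratedFDeriv ℝ i (u ε) z‖ * ‖iteratedFDeriv ℝ (n - i) (v ε) z‖
      ≤ (n.choose i : ℝ) * (C i * w z) * (D (n - i) * w' z) := by
        have := (norm_nonneg _).trans h2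
        gcongr
    _ = _ := by ring

theorem IsSymbol.bilin (B : W →L[ℝ] W' →L[ℝ] W'') {u : ℝ → V → W} {v : ℝ → V → W'}
    (hu : IsSymbol ε₀ w u) (hv : IsSymbol ε₀ w' v) :
    IsSymbol ε₀ (fun z => w z * w' z) (fun ε z => B (u ε z) (v ε z)) :=
  ⟨fun ε h0 h1 => B.isBoundedBilinearMap.contDiff.comp ((hu.1 ε h0 h1).prodMk (hv.1 ε h0 h1)),
    fun _ => DerivBound.bilin B hu.1 hv.1 (fun i _ => hu.2 i) (fun i _ => hv.2 i)⟩

theorem IsSymbol.mul {u v : ℝ → V → ℂ}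
    (hu : IsSymbol ε₀ w u) (hv : IsSymbol ε₀ w' v) :
    IsSymbol ε₀ (fun z => w z * w' z) (fun ε z => u ε z * v ε z) :=
  hu.bilin (ContinuousLinearMap.mul ℝ ℂ) hv

theorem isSymbol_const (c : W) : IsSymbol ε₀ (fun _ : V => 1) (fun _ _ => c) := by
  refine ⟨fun _ _ _ => contDiff_const, fun k => ⟨‖c‖, fun ε _ _ z => ?_⟩⟩
  rcases Nat.eq_zero_or_pos k with rfl | hk
  · simp
  · rw [iteratedFDeriv_const_of_ne hk.ne']
    simp

theorem IsSymbol.comp_affine {u : ℝ → V → W} (h : IsSymbol ε₀ w u) (c : V) (L : V' →L[ℝ] V) :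
    IsSymbol ε₀ (fun z => w (c + L z)) (fun ε z => u ε (c + L z)) := by
  refine ⟨fun ε h0 h1 => (h.1 ε h0 h1).comp (contDiff_const.add L.contDiff), fun k => ?_⟩
  obtain ⟨C, hC⟩ := h.2 k
  refine ⟨C * ‖L‖ ^ k, fun ε h0 h1 z => ?_⟩
  have h2 : ContDiff ℝ ∞ (fun y => u ε (c + y)) :=
    (h.1 ε h0 h1).comp (contDiff_const.add contDiff_id)
  change ‖iteratedFDeriv ℝ k ((fun y => u ε (c + y)) ∘ L) z‖ ≤ _
  rw [L.iteratedFDeriv_comp_right h2 z (i := k) (by exact_mod_cast le_top)]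
  refine (ContinuousMultilinearMap.norm_compContinuousLinearMap_le _ _).trans ?_
  rw [iteratedFDeriv_comp_add_left]
  simp only [Finset.prod_const, Finset.card_univ, Fintype.card_fin]
  calc _ ≤ C * w (c + L z) * ‖L‖ ^ k := by gcongr; exact hC ε h0 h1 _
    _ = _ := by ring

theorem IsSymbol.comp_clm {u : ℝ → V → W} (h : IsSymbol ε₀ w u) (L : V' →L[ℝ] V) :
    IsSymbol ε₀ (fun z => w (L z)) (fun ε z => u ε (L z)) := by
  simpa using h.comp_affine 0 L

theorem IsSymbol.clm_comp {u : ℝ → V → W} (h : IsSymbol ε₀ w u) (L : W →L[ℝ] W') :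
    IsSymbol ε₀ w (fun ε z => L (u ε z)) := by
  refine ⟨fun ε h0 h1 => L.contDiff.comp (h.1 ε h0 h1), fun k => ?_⟩
  obtain ⟨C, hC⟩ := h.2 k
  refine ⟨‖L‖ * C, fun ε h0 h1 z => ?_⟩
  refine (L.norm_iteratedFDeriv_comp_left (h.1 ε h0 h1).contDiffAt
    (n := k) (by exact_mod_cast le_top)).trans ?_
  rw [mul_assoc]
  gcongr
  exact hC ε h0 h1 z

theorem IsSymbol.fderiv {u : ℝ → V → W} (h : IsSymbol ε₀ w u) :
    IsSymbol ε₀ w (fun ε => fderiv ℝ (u ε)) := by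
  refine ⟨fun ε h0 h1 => (h.1 ε h0 h1).fderiv_right (by simp), fun k => ?_⟩
  obtain ⟨C, hC⟩ := h.2 (k + 1)
  exact ⟨C, fun ε h0 h1 z => by rw [norm_iteratedFDeriv_fderiv]; exact hC ε h0 h1 z⟩

theorem IsSymbol.fderiv_apply {u : ℝ → V → W} (h : IsSymbol ε₀ w u) (e : V) :
    IsSymbol ε₀ w (fun ε z => _root_.fderiv ℝ (u ε) z e) :=
  h.fderiv.clm_comp (ContinuousLinearMap.apply ℝ W e)

/-- Serves functions such as linear maps and `κ`, which grow although all their derivatives are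
bounded: the size of the function is estimated separately. -/
theorem IsSymbol.of_fderiv {u : ℝ → V → W}
    (hu : ∀ ε : ℝ, 0 < ε → ε ≤ ε₀ → ContDiff ℝ ∞ (u ε))
    (hb : ∃ C : ℝ, ∀ ε : ℝ, 0 < ε → ε ≤ ε₀ → ∀ z, ‖u ε z‖ ≤ C * w z)
    (h : IsSymbol ε₀ w (fun ε => _root_.fderiv ℝ (u ε))) : IsSymbol ε₀ w u := by
  refine ⟨hu, fun k => ?_⟩
  cases k with
  | zero => simpa using hb
  | succ k =>
    obtain ⟨C, hC⟩ := h.2 k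
    exact ⟨C, fun ε h0 h1 z => by rw [← norm_iteratedFDeriv_fderiv]; exact hC ε h0 h1 z⟩

theorem isSymbol_clm (L : V →L[ℝ] W) {C : ℝ} (h1 : ∀ z, 1 ≤ C * w z)
    (hL : ∀ z, ‖L z‖ ≤ C * w z) : IsSymbol ε₀ w (fun _ z => L z) := by
  refine IsSymbol.of_fderiv (fun _ _ _ => L.contDiff) ⟨C, fun _ _ _ z => hL z⟩ ?_
  have h2 : _root_.fderiv ℝ (fun z => L z) = fun _ => L := funext fun z => L.fderiv
  rw [h2]
  exact (isSymbol_const L).mono (fun _ => zero_le_one) h1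

theorem IsSymbol.add {u v : ℝ → V → W} (hu : IsSymbol ε₀ w u) (hv : IsSymbol ε₀ w v) :
    IsSymbol ε₀ w (fun ε z => u ε z + v ε z) := by
  refine ⟨fun ε h0 h1 => (hu.1 ε h0 h1).add (hv.1 ε h0 h1), fun k => ?_⟩
  obtain ⟨C, hC⟩ := hu.2 k
  obtain ⟨D, hD⟩ := hv.2 k
  refine ⟨C + D, fun ε h0 h1 z => ?_⟩
  change ‖iteratedFDeriv ℝ k (fun z => u ε z + v ε z) z‖ ≤ _
  rw [fun_iteratedFDeriv_add ((hu.1 ε h0 h1).of_le (by exact_mod_cast le_top))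
    ((hv.1 ε h0 h1).of_le (by exact_mod_cast le_top)), add_mul]
  exact (norm_add_le _ _).trans (add_le_add (hC ε h0 h1 z) (hD ε h0 h1 z))

theorem IsSymbol.const_smul {𝕜 : Type*} [NormedField 𝕜] [NormedSpace 𝕜 W] [SMulCommClass ℝ 𝕜 W]
    {u : ℝ → V → W} (h : IsSymbol ε₀ w u) (c : 𝕜) :
    IsSymbol ε₀ w (fun ε z => c • u ε z) :=
  h.clm_comp (c • ContinuousLinearMap.id ℝ W)

theorem IsSymbol.const_mul {u : ℝ → V → ℂ} (h : IsSymbol ε₀ w u) (c : ℂ) :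
    IsSymbol ε₀ w (fun ε z => c * u ε z) :=
  h.const_smul c

theorem IsSymbol.neg {u : ℝ → V → W} (h : IsSymbol ε₀ w u) :
    IsSymbol ε₀ w (fun ε z => -u ε z) := by
  simpa using h.const_smul (-1 : ℝ)

theorem IsSymbol.sub {u v : ℝ → V → W} (hu : IsSymbol ε₀ w u) (hv : IsSymbol ε₀ w v) :
    IsSymbol ε₀ w (fun ε z => u ε z - v ε z) := by
  simpa [sub_eq_add_neg] using hu.add hv.neg

theorem IsSymbol.zero : IsSymbol ε₀ w (fun _ _ => (0 : W)) :=
  ⟨fun _ _ _ => contDiff_const, fun k => ⟨0, fun _ _ _ z => by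
    simp [show (fun _ : V => (0 : W)) = 0 from rfl]⟩⟩

theorem IsSymbol.sum {ι : Type*} (s : Finset ι) {u : ι → ℝ → V → W}
    (h : ∀ i ∈ s, IsSymbol ε₀ w (u i)) : IsSymbol ε₀ w (fun ε z => ∑ i ∈ s, u i ε z) := by
  classical
  induction s using Finset.induction_on with
  | empty => simpa using IsSymbol.zero
  | insert a s ha ih =>
    simp only [Finset.sum_insert ha]
    exact (h a (by simp)).add (ih fun i hi => h i (by simp [hi]))

theorem IsSymbol.mul_one {u v : ℝ → V → ℂ} (hu : IsSymbol ε₀ (fun _ => 1) u)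
    (hv : IsSymbol ε₀ w v) : IsSymbol ε₀ w (fun ε z => u ε z * v ε z) := by
  simpa using hu.mul hv

theorem IsSymbol.prod {ι : Type*} (s : Finset ι) {u : ι → ℝ → V → ℂ}
    (h : ∀ i ∈ s, IsSymbol ε₀ (fun _ => 1) (u i)) :
    IsSymbol ε₀ (fun _ => 1) (fun ε z => ∏ i ∈ s, u i ε z) := by
  classical
  induction s using Finset.induction_on with
  | empty => simpa using isSymbol_const (1 : ℂ)
  | insert a s ha ih =>
    simp only [Finset.prod_insert ha]
    exact (h a (by simp)).mul_one (ih fun i hi => h i (by simp [hi]))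

theorem IsSymbol.det {n : Type*} [Fintype n] [DecidableEq n] {M : ℝ → V → Matrix n n ℂ}
    (h : ∀ i k, IsSymbol ε₀ (fun _ => 1) (fun ε z => M ε z i k)) :
    IsSymbol ε₀ (fun _ => 1) (fun ε z => (M ε z).det) := by
  simp only [Matrix.det_apply]
  refine IsSymbol.sum _ fun σ _ => ?_
  simp only [Units.smul_def, zsmul_eq_mul]
  exact (IsSymbol.prod _ fun i _ => h (σ i) i).const_mul _

/-- The derivative of `1/f` is `-f⁻² f'`, whose derivatives of order `k` involve `1/f` only up to
order `k`. This allows strong induction, with weights `w⁻¹ w⁻¹ w = w⁻¹`. -/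
theorem IsSymbol.inv {f : ℝ → V → ℂ} (h : IsSymbol ε₀ w f) (hw : ∀ z, 0 < w z) {c : ℝ}
    (hc : 0 < c) (hf : ∀ ε : ℝ, 0 < ε → ε ≤ ε₀ → ∀ z, c * w z ≤ ‖f ε z‖) :
    IsSymbol ε₀ (fun z => (w z)⁻¹) (fun ε z => (f ε z)⁻¹) := by
  have hne : ∀ ε : ℝ, 0 < ε → ε ≤ ε₀ → ∀ z, f ε z ≠ 0 := fun ε h0 h1 z h2 => by
    have := hf ε h0 h1 z
    rw [h2, norm_zero] at this
    exact absurd this (not_le.mpr (mul_pos hc (hw z)))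
  have hcd : ∀ ε : ℝ, 0 < ε → ε ≤ ε₀ → ContDiff ℝ ∞ (fun z => (f ε z)⁻¹) :=
    fun ε h0 h1 => (h.1 ε h0 h1).inv (hne ε h0 h1)
  refine ⟨hcd, fun k => ?_⟩
  change DerivBound _ _ _ k
  induction k using Nat.strong_induction_on with
  | _ k ih =>
  cases k with
  | zero =>
    refine ⟨c⁻¹, fun ε h0 h1 z => ?_⟩
    rw [norm_iteratedFDeriv_zero, norm_inv, ← mul_inv]
    exact inv_anti₀ (mul_pos hc (hw z)) (hf ε h0 h1 z)
  | succ k =>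
    have h2 : ∀ i ≤ k, DerivBound ε₀ (fun z => (w z)⁻¹ * (w z)⁻¹)
        (fun ε z => (f ε z)⁻¹ * (f ε z)⁻¹) i := fun i hi =>
      DerivBound.bilin (ContinuousLinearMap.mul ℝ ℂ) hcd hcd
        (fun l hl => ih l (by omega)) (fun l hl => ih l (by omega))
    have h3 : DerivBound ε₀ (fun z => (w z)⁻¹ * (w z)⁻¹ * w z) (fun ε z =>
        (-ContinuousLinearMap.lsmul ℝ ℂ : ℂ →L[ℝ] (V →L[ℝ] ℂ) →L[ℝ] (V →L[ℝ] ℂ))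
          ((f ε z)⁻¹ * (f ε z)⁻¹) (_root_.fderiv ℝ (f ε) z)) k :=
      DerivBound.bilin _ (fun ε h0 h1 => (hcd ε h0 h1).mul (hcd ε h0 h1)) h.fderiv.1
        h2 (fun i _ => h.fderiv.2 i)
    obtain ⟨C, hC⟩ := h3
    refine ⟨C, fun ε h0 h1 z => ?_⟩
    rw [← norm_iteratedFDeriv_fderiv]
    have h4 : (_root_.fderiv ℝ fun z => (f ε z)⁻¹) = fun z =>
        (-ContinuousLinearMap.lsmul ℝ ℂ : ℂ →L[ℝ] (V →L[ℝ] ℂ) →L[ℝ] (V →L[ℝ] ℂ))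
          ((f ε z)⁻¹ * (f ε z)⁻¹) (_root_.fderiv ℝ (f ε) z) := by
      funext y
      have h5 : HasFDerivAt (f ε) (_root_.fderiv ℝ (f ε) y) y :=
        ((h.1 ε h0 h1).differentiable (by simp)).differentiableAt.hasFDerivAt
      have h6 := (hasDerivAt_inv (hne ε h0 h1 y)).comp_hasFDerivAt_of_eq y h5 rfl
      refine Eq.trans (HasFDerivAt.fderiv (f := fun z => (f ε z)⁻¹) h6) ?_
      ext e
      simp [pow_two]
    rw [h4]
    refine (hC ε h0 h1 z).trans (le_of_eq ?_)
    have := (hw z).ne'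
    field_simp

end SymbolCalculus

/-! ### Admissible matrices and the invertibility of `𝒵`. -/

variable {d : ℕ}

/-- The cross terms between real and imaginary parts of `v` carry `Im Θ`, and they cancel because
`Im Θ` is symmetric. -/
theorem IsAdmissible.re_form_eq {Θ : Matrix (Fin d) (Fin d) ℂ} (h : IsAdmissible Θ)
    (v : Fin d → ℂ) : (star v ⬝ᵥ (Θ *ᵥ v)).re =
      (fun k => (v k).re) ⬝ᵥ (Θ.map Complex.re *ᵥ fun k => (v k).re) +
      (fun k => (v k).im) ⬝ᵥ (Θ.map Complex.re *ᵥ fun k => (v k).im) := by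
  have h0 : ∑ i, ∑ k, (Θ i k).im * ((v i).re * (v k).im) =
      ∑ i, ∑ k, (Θ i k).im * ((v i).im * (v k).re) := by
    rw [Finset.sum_comm]
    refine Finset.sum_congr rfl fun i _ => Finset.sum_congr rfl fun k _ => ?_
    rw [h.symm.apply]
    ring
  simp only [dotProduct, Matrix.mulVec, Finset.mul_sum, Complex.re_sum, Matrix.map_apply,
    Pi.star_apply]
  rw [← Finset.sum_add_distrib, ← sub_eq_zero, ← Finset.sum_sub_distrib]
  simp only [← Finset.sum_add_distrib, ← Finset.sum_sub_distrib]
  rw [← sub_eq_zero] at h0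
  simp only [← Finset.sum_sub_distrib] at h0
  rw [← neg_eq_zero, ← h0, ← Finset.sum_neg_distrib]
  refine Finset.sum_congr rfl fun i _ => ?_
  rw [← Finset.sum_neg_distrib]
  refine Finset.sum_congr rfl fun k _ => ?_
  simp [Complex.mul_re, Complex.mul_im]
  ring

theorem IsAdmissible.re_form_nonneg {Θ : Matrix (Fin d) (Fin d) ℂ} (h : IsAdmissible Θ)
    (v : Fin d → ℂ) : 0 ≤ (star v ⬝ᵥ (Θ *ᵥ v)).re := by
  rw [h.re_form_eq]
  exact add_nonneg (by simpa using h.posDef_re.posSemidef.dotProduct_mulVec_nonneg _)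
    (by simpa using h.posDef_re.posSemidef.dotProduct_mulVec_nonneg _)

theorem IsAdmissible.eq_zero_of_re_form {Θ : Matrix (Fin d) (Fin d) ℂ} (h : IsAdmissible Θ)
    {v : Fin d → ℂ} (hv : (star v ⬝ᵥ (Θ *ᵥ v)).re ≤ 0) : v = 0 := by
  have hn : ∀ a : Fin d → ℝ, 0 ≤ a ⬝ᵥ (Θ.map Complex.re *ᵥ a) := fun a => by
    simpa using h.posDef_re.posSemidef.dotProduct_mulVec_nonneg a
  have hp : ∀ a : Fin d → ℝ, a ⬝ᵥ (Θ.map Complex.re *ᵥ a) ≤ 0 → a = 0 := fun a ha => by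
    by_contra hne
    have := h.posDef_re.dotProduct_mulVec_pos hne
    rw [star_trivial] at this
    exact absurd ha (not_le.mpr this)
  rw [h.re_form_eq] at hv
  have h1 := hp _ (by linarith [hn fun k => (v k).im, hn fun k => (v k).re] :
    (fun k => (v k).re) ⬝ᵥ (Θ.map Complex.re *ᵥ fun k => (v k).re) ≤ 0)
  have h2 := hp _ (by linarith [hn fun k => (v k).im, hn fun k => (v k).re] :
    (fun k => (v k).im) ⬝ᵥ (Θ.map Complex.re *ᵥ fun k => (v k).im) ≤ 0)
  funext k
  exact Complex.ext (congrFun h1 k) (congrFun h2 k)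

theorem IsAdmissible.isUnit {Θ : Matrix (Fin d) (Fin d) ℂ} (h : IsAdmissible Θ) :
    IsUnit Θ := by
  rw [← Matrix.mulVec_injective_iff_isUnit]
  refine (injective_iff_map_eq_zero Θ.mulVecLin).mpr fun v hv => ?_
  refine h.eq_zero_of_re_form (le_of_eq ?_)
  rw [Matrix.mulVecLin_apply] at hv
  simp [hv]

theorem IsAdmissible.mul_inv {Θ : Matrix (Fin d) (Fin d) ℂ} (h : IsAdmissible Θ) :
    Θ * Θ⁻¹ = 1 :=
  Matrix.mul_nonsing_inv _ ((Matrix.isUnit_iff_isUnit_det _).mp h.isUnit)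

theorem IsAdmissible.inv_mul {Θ : Matrix (Fin d) (Fin d) ℂ} (h : IsAdmissible Θ) :
    Θ⁻¹ * Θ = 1 :=
  Matrix.nonsing_inv_mul _ ((Matrix.isUnit_iff_isUnit_det _).mp h.isUnit)

/-- The matrix `(i(Θ^y)⁻¹  id) F† (-iΘ^x  id)†` as a function of `F`. -/
def matZOf (Θx Θy : Matrix (Fin d) (Fin d) ℂ) (F : Matrix (Fin d ⊕ Fin d) (Fin d ⊕ Fin d) ℝ) :
    Matrix (Fin d) (Fin d) ℂ :=
  (Matrix.fromCols (Complex.I • Θy⁻¹) 1 : Matrix (Fin d) (Fin d ⊕ Fin d) ℂ) *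
    (F.map Complex.ofReal)ᵀ *
    (Matrix.fromRows (-(Complex.I • Θx)) 1 : Matrix (Fin d ⊕ Fin d) (Fin d) ℂ)

theorem star_dotProduct_J_mulVec (a b : Fin d → ℂ) :
    star (Sum.elim a b) ⬝ᵥ ((Matrix.J (Fin d) ℂ) *ᵥ Sum.elim a b) =
      star b ⬝ᵥ a - star a ⬝ᵥ b := by
  have : star (Sum.elim a b) = Sum.elim (star a) (star b) := by
    funext i; cases i <;> rfl
  rw [this, Matrix.J, Matrix.fromBlocks_mulVec, sumElim_dotProduct_sumElim]
  simp [Matrix.neg_mulVec]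
  ring

/-- For `v` in the kernel put `(a, b) = F† (-iΘ^x v, v)`; then `a = iΘ^y b`. The form `b̄·a - ā·b`
is invariant under `F†`. It equals `2i Re(b̄·Θ^y b)` at `(a, b)` and `-2i Re(v̄·Θ^x v)` at `(-iΘ^x
v, v)`. Both real parts are nonnegative, hence zero. -/
theorem isUnit_matZOf {Θx Θy : Matrix (Fin d) (Fin d) ℂ} (hΘx : IsAdmissible Θx)
    (hΘy : IsAdmissible Θy) {F : Matrix (Fin d ⊕ Fin d) (Fin d ⊕ Fin d) ℝ}
    (hF : F ∈ Matrix.symplecticGroup (Fin d) ℝ) : IsUnit (matZOf Θx Θy F) := by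
  rw [← Matrix.mulVec_injective_iff_isUnit]
  refine (injective_iff_map_eq_zero (matZOf Θx Θy F).mulVecLin).mpr fun v hv => ?_
  rw [Matrix.mulVecLin_apply] at hv
  set G : Matrix (Fin d ⊕ Fin d) (Fin d ⊕ Fin d) ℂ := F.map Complex.ofReal with hG
  have hFJ : G * Matrix.J (Fin d) ℂ * Gᵀ = Matrix.J (Fin d) ℂ := by
    have h1 := congrArg (fun M => M.map Complex.ofReal) (SymplecticGroup.mem_iff.mp hF)
    have hJ : (Matrix.J (Fin d) ℝ).map Complex.ofReal = Matrix.J (Fin d) ℂ := by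
      rw [Matrix.J, Matrix.J, Matrix.fromBlocks_map]
      congr 1 <;> ext i k <;> simp [Matrix.one_apply, apply_ite]
    have h2 : ∀ A B : Matrix (Fin d ⊕ Fin d) (Fin d ⊕ Fin d) ℝ,
        (A * B).map Complex.ofReal = A.map Complex.ofReal * B.map Complex.ofReal :=
      fun A B => Matrix.map_mul (f := Complex.ofRealHom)
    simpa only [h2, hJ, Matrix.transpose_map] using h1
  have hGc : star G = Gᵀ := by
    ext i k; simp [hG, Matrix.star_apply]
  set q : Fin d ⊕ Fin d → ℂ := Sum.elim (-(Complex.I • (Θx *ᵥ v))) v with hq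
  set Y := Gᵀ *ᵥ q with hY
  set a : Fin d → ℂ := fun k => Y (Sum.inl k) with ha
  set b : Fin d → ℂ := fun k => Y (Sum.inr k) with hb
  have hYab : Y = Sum.elim a b := by funext i; cases i <;> rfl
  -- Invariance of the Hermitian form: `G` is real, so that `star Y = star q ᵥ* G`, and `G J Gᵀ =
  -- J`.
  have h1 : star Y ⬝ᵥ (Matrix.J (Fin d) ℂ *ᵥ Y) = star q ⬝ᵥ (Matrix.J (Fin d) ℂ *ᵥ q) := by
    have : star Y = star q ᵥ* G := by
      rw [hY, Matrix.star_mulVec, ← Matrix.star_eq_conjTranspose, ← hGc, star_star]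
    rw [this, hY, ← Matrix.dotProduct_mulVec, Matrix.mulVec_mulVec, Matrix.mulVec_mulVec,
      hFJ]
  have h2 : a = Complex.I • (Θy *ᵥ b) := by
    have h3 : Complex.I • (Θy⁻¹ *ᵥ a) + b = 0 := by
      rw [← hv, matZOf, ← Matrix.mulVec_mulVec, ← Matrix.mulVec_mulVec, Matrix.fromRows_mulVec]
      rw [Matrix.one_mulVec, Matrix.neg_mulVec, Matrix.smul_mulVec, ← hq, ← hY, hYab,
        Matrix.fromCols_mulVec_sumElim, Matrix.smul_mulVec, Matrix.one_mulVec]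
    rw [eq_neg_of_add_eq_zero_right h3, Matrix.mulVec_neg, Matrix.mulVec_smul,
      Matrix.mulVec_mulVec, hΘy.mul_inv, Matrix.one_mulVec, smul_neg, smul_smul,
      Complex.I_mul_I]
    simp
  rw [hYab, hq, star_dotProduct_J_mulVec, star_dotProduct_J_mulVec, h2] at h1
  have h4 : ∀ (Θ : Matrix (Fin d) (Fin d) ℂ) (c : Fin d → ℂ),
      star (Θ *ᵥ c) ⬝ᵥ c = star (star c ⬝ᵥ (Θ *ᵥ c)) := fun Θ c => by
    rw [← Matrix.star_dotProduct]
  rw [star_smul, star_neg, star_smul] at h1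
  simp only [dotProduct_smul, smul_dotProduct, dotProduct_neg, neg_dotProduct, h4] at h1
  -- Both sides are purely imaginary; the imaginary parts compare the two quadratic forms with
  -- opposite signs.
  have h5 := congrArg Complex.im h1
  simp at h5
  refine hΘx.eq_zero_of_re_form ?_
  linarith [hΘy.re_form_nonneg b]

/-! ### Uniform bounds on `𝒵⁻¹` and the symbol class of `v`. -/

theorem IsClassB.exists_bound {κ : Vec d × Vec d → Vec d × Vec d} (hκ : IsClassB κ) :
    ∃ C : ℝ, ∀ z i k, ‖jacobian κ z i k‖ ≤ C := by
  choose C hC using fun i k => (hκ.jacobian_symbol i k).bound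
  refine ⟨∑ i, ∑ k, |C i k|, fun z i k => (hC i k 1 one_pos le_rfl z).trans ?_⟩
  rw [mul_one]
  refine (le_abs_self _).trans ?_
  refine (Finset.single_le_sum (f := fun k => |C i k|) (fun _ _ => abs_nonneg _)
    (Finset.mem_univ k)).trans ?_
  exact Finset.single_le_sum (f := fun i => ∑ k, |C i k|)
    (fun _ _ => Finset.sum_nonneg fun _ _ => abs_nonneg _) (Finset.mem_univ i)

/-- The symplectic matrices with entries in `[-C, C]` form a compact set on which `|det 𝒵|`, as a
function of `F`, is continuous and positive, so its minimum there serves for all `(q, p)`. -/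
theorem exists_det_matZ_bound {κ : Vec d × Vec d → Vec d × Vec d} (hκ : IsClassB κ)
    {Θx Θy : Matrix (Fin d) (Fin d) ℂ} (hΘx : IsAdmissible Θx) (hΘy : IsAdmissible Θy) :
    ∃ c : ℝ, 0 < c ∧ ∀ z, c ≤ ‖(matZ κ Θx Θy z).det‖ := by
  obtain ⟨C, hC⟩ := hκ.exists_bound
  set K : Set (Matrix (Fin d ⊕ Fin d) (Fin d ⊕ Fin d) ℝ) :=
    (Set.univ.pi fun _ => Set.univ.pi fun _ => Set.Icc (-C) C) ∩
      {F | F * Matrix.J (Fin d) ℝ * Fᵀ = Matrix.J (Fin d) ℝ} with hK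
  have hKc : IsCompact K := by
    refine IsCompact.inter_right
      (isCompact_univ_pi fun _ => isCompact_univ_pi fun _ => isCompact_Icc) ?_
    exact isClosed_eq ((continuous_id.matrix_mul continuous_const).matrix_mul
      continuous_id.matrix_transpose) continuous_const
  have hcont : Continuous fun F => ‖(matZOf Θx Θy F).det‖ := by
    refine (Continuous.matrix_det ?_).norm
    exact (continuous_const.matrix_mul
      (continuous_id.matrix_map Complex.continuous_ofReal).matrix_transpose).matrix_mul
      continuous_const
  have hmem : ∀ z, jacobian κ z ∈ K := fun z =>
    ⟨fun i _ k _ => abs_le.mp (hC z i k), SymplecticGroup.mem_iff.mp (hκ.symplectic z)⟩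
  obtain ⟨F, hF, hmin⟩ := hKc.exists_isMinOn ⟨_, hmem 0⟩ hcont.continuousOn
  refine ⟨_, ?_, fun z => hmin (hmem z)⟩
  have := isUnit_matZOf hΘx hΘy (SymplecticGroup.mem_iff.mpr hF.2)
  exact norm_pos_iff.mpr ((Matrix.isUnit_iff_isUnit_det _).mp this).ne_zero

theorem isSymbol_matZ {κ : Vec d × Vec d → Vec d × Vec d} (hκ : IsClassB κ)
    (Θx Θy : Matrix (Fin d) (Fin d) ℂ) (i k : Fin d) :
    IsSymbol 1 (fun _ => 1) (fun _ z => matZ κ Θx Θy z i k) := by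
  simp only [matZ, Matrix.mul_apply, Finset.sum_mul]
  refine IsSymbol.sum _ fun b _ => IsSymbol.sum _ fun a _ => ?_
  have h1 := ((hκ.jacobian_symbol b a).clm_comp Complex.ofRealCLM).const_mul
    ((Matrix.fromCols (Complex.I • Θy⁻¹) 1 : Matrix (Fin d) (Fin d ⊕ Fin d) ℂ) i a)
  have h2 := h1.const_mul
    ((Matrix.fromRows (-(Complex.I • Θx)) 1 : Matrix (Fin d ⊕ Fin d) (Fin d) ℂ) b k)
  convert h2 using 3
  simp [mul_comm]

/-- Cramer's rule: the adjugate is polynomial in the entries of `𝒵`, and `1/det 𝒵` is a symbol of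
order zero by the uniform lower bound. -/
theorem isSymbol_matZ_inv {κ : Vec d × Vec d → Vec d × Vec d} (hκ : IsClassB κ)
    {Θx Θy : Matrix (Fin d) (Fin d) ℂ} (hΘx : IsAdmissible Θx) (hΘy : IsAdmissible Θy)
    (i k : Fin d) : IsSymbol 1 (fun _ => 1) (fun _ z => (matZ κ Θx Θy z)⁻¹ i k) := by
  obtain ⟨c, hc, hdet⟩ := exists_det_matZ_bound hκ hΘx hΘy
  have h1 : IsSymbol 1 (fun _ : Vec d × Vec d => (1 : ℝ)⁻¹)
      (fun _ z => ((matZ κ Θx Θy z).det)⁻¹) :=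
    IsSymbol.inv (w := fun _ => (1 : ℝ)) (IsSymbol.det (M := fun _ z => matZ κ Θx Θy z)
      (isSymbol_matZ hκ Θx Θy)) (fun _ => one_pos) hc (fun _ _ _ z => by simpa using hdet z)
  have h2 : IsSymbol 1 (fun _ : Vec d × Vec d => (1 : ℝ))
      (fun _ z => (matZ κ Θx Θy z).adjugate i k) := by
    simp only [Matrix.adjugate_apply]
    refine IsSymbol.det (M := fun _ z => (matZ κ Θx Θy z).updateRow k (Pi.single i 1))
      fun a b => ?_
    by_cases hak : a = k
    · subst hak
      simp only [Matrix.updateRow_self]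
      exact isSymbol_const _
    · simp only [Matrix.updateRow_ne hak]
      exact isSymbol_matZ hκ Θx Θy a b
  simp only [inv_one] at h1
  simpa [Matrix.inv_def, Ring.inverse_eq_inv'] using h1.mul_one h2

theorem fderiv_section {V V' W : Type*} [NormedAddCommGroup V] [NormedSpace ℝ V]
    [NormedAddCommGroup V'] [NormedSpace ℝ V'] [NormedAddCommGroup W] [NormedSpace ℝ W]
    {g : V × V' → W} (hg : Differentiable ℝ g) (w : V × V') (e : V') :
    fderiv ℝ (fun z => g (w.1, z)) w.2 e = fderiv ℝ g w (0, e) := by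
  have h : HasFDerivAt (fun z => g (w.1, z))
      ((fderiv ℝ g w).comp (ContinuousLinearMap.inr ℝ V V')) w.2 :=
    HasFDerivAt.comp w.2 (hg w).hasFDerivAt (hasFDerivAt_prodMk_right w.1 w.2)
  rw [h.fderiv]
  simp

theorem isSymbol_symbolV {κ : Vec d × Vec d → Vec d × Vec d} (hκ : IsClassB κ)
    {Θx Θy : Matrix (Fin d) (Fin d) ℂ} (hΘx : IsAdmissible Θx) (hΘy : IsAdmissible Θy)
    {ε₀ : ℝ} {w : Vec d × Vec d × Vec d → ℝ} {u : ℝ → Vec d × Vec d × Vec d → ℂ}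
    (hu : IsSymbol ε₀ w u) (j : Fin d) : IsSymbol ε₀ w (symbolV κ Θx Θy j u) := by
  have hg : ∀ k, IsSymbol ε₀ w (fun ε z => (matZ κ Θx Θy z.2)⁻¹ j k * u ε z) := fun k =>
    (((isSymbol_matZ_inv hκ hΘx hΘy j k).comp_clm
      (ContinuousLinearMap.snd ℝ (Vec d) (Vec d × Vec d))).of_fixed ε₀).mul_one hu
  have h1 : IsSymbol ε₀ w (fun ε z => -∑ k,
      ((∑ l, Θy⁻¹ k l * fderiv ℝ (fun z : Vec d × Vec d × Vec d =>
          (matZ κ Θx Θy z.2)⁻¹ j k * u ε z) z (0, (EuclideanSpace.single l 1, 0))) -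
        Complex.I * fderiv ℝ (fun z : Vec d × Vec d × Vec d =>
          (matZ κ Θx Θy z.2)⁻¹ j k * u ε z) z (0, (0, EuclideanSpace.single k 1)))) := by
    refine (IsSymbol.sum _ fun k _ => ?_).neg
    refine (IsSymbol.sum _ fun l _ => ?_).sub ?_
    · exact ((hg k).fderiv_apply _).const_mul _
    · exact ((hg k).fderiv_apply _).const_mul _
  -- Derivatives at fixed `x` become derivatives in directions `(0, e)` of the function of all
  -- variables. This needs smoothness of `u^ε`, known only for `ε ≤ ε₀`.
  have h2 : ∀ ε : ℝ, 0 < ε → ε ≤ ε₀ → symbolV κ Θx Θy j u ε = fun z => -∑ k,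
      ((∑ l, Θy⁻¹ k l * fderiv ℝ (fun z : Vec d × Vec d × Vec d =>
          (matZ κ Θx Θy z.2)⁻¹ j k * u ε z) z (0, (EuclideanSpace.single l 1, 0))) -
        Complex.I * fderiv ℝ (fun z : Vec d × Vec d × Vec d =>
          (matZ κ Θx Θy z.2)⁻¹ j k * u ε z) z (0, (0, EuclideanSpace.single k 1))) := by
    intro ε h0 h1
    funext z
    simp only [symbolV, divZ, partialZ, partialQ, partialP]
    congr 1
    refine Finset.sum_congr rfl fun k _ => ?_
    have h3 := fun e => fderiv_section (((hg k).1 ε h0 h1).differentiable (by simp)) z e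
    simp only at h3
    simp only [h3]
  exact ⟨fun ε h0 h1' => by rw [h2 ε h0 h1']; exact h1.1 ε h0 h1', fun k => (h1.2 k).imp
    fun C hC ε h0 h1' z => by rw [h2 ε h0 h1']; exact hC ε h0 h1' z⟩

/-! ### Brackets, Gaussian decay and the size of `e^{iΦ/ε}`. -/

/-- The `k`-th coordinate as a continuous linear map. -/
def coord (k : Fin d) : Vec d →L[ℝ] ℝ := EuclideanSpace.proj k

theorem coord_apply (k : Fin d) (v : Vec d) : coord k v = v k := rfl

theorem bracket_sq (z : Vec d) : bracket z ^ 2 = 1 + ‖z‖ ^ 2 :=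
  Real.sq_sqrt (by positivity)

theorem one_le_bracket (z : Vec d) : 1 ≤ bracket z :=
  Real.one_le_sqrt.mpr (by nlinarith [sq_nonneg ‖z‖])

theorem bracket_pos (z : Vec d) : 0 < bracket z := one_pos.trans_le (one_le_bracket z)

theorem norm_le_bracket (z : Vec d) : ‖z‖ ≤ bracket z :=
  Real.le_sqrt_of_sq_le (by linarith)

theorem bracket_le_one_add_norm (z : Vec d) : bracket z ≤ 1 + ‖z‖ := by
  rw [bracket, Real.sqrt_le_left (by positivity)]
  nlinarith [norm_nonneg z]

theorem continuous_bracket : Continuous (bracket : Vec d → ℝ) := by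
  unfold bracket
  fun_prop

/-- Peetre's inequality, from `|q| ≤ |y - q| + |y|`. -/
theorem bracket_le_mul_bracket (q y : Vec d) :
    bracket q ^ 2 ≤ 2 * bracket (y - q) ^ 2 * bracket y ^ 2 := by
  simp only [bracket_sq]
  have h1 : ‖q‖ ≤ ‖y - q‖ + ‖y‖ := by
    have := norm_sub_le y (y - q)
    rw [sub_sub_cancel] at this
    linarith
  nlinarith [norm_nonneg q, sq_nonneg (‖y - q‖ - ‖y‖), mul_nonneg (sq_nonneg ‖y - q‖)
    (sq_nonneg ‖y‖), norm_nonneg y, norm_nonneg (y - q)]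

/-- By Peetre's inequality a Gaussian in `y - q` buys any power of `⟨q⟩⁻¹` at the price of the same
power of `⟨y⟩`, which a Schwartz function can pay. -/
theorem exists_gaussian_le {c : ℝ} (hc : 0 < c) (n : ℕ) : ∃ C : ℝ, 0 ≤ C ∧ ∀ q y : Vec d,
    Real.exp (-(c * ‖y - q‖ ^ 2)) ≤ C * (bracket q ^ (-(2 * n : ℝ)) * bracket y ^ (2 * n : ℝ)) := by
  -- The factor `2^n` comes from Peetre's inequality, the rest from `tⁿ/n! ≤ e^t` at `t = c⟨y -
  -- q⟩²`.
  refine ⟨2 ^ n * (n.factorial / c ^ n * Real.exp c), by positivity, fun q y => ?_⟩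
  have hq := bracket_pos q
  have hy := bracket_pos y
  have e1 : ∀ z : Vec d, bracket z ^ (2 * n : ℝ) = (bracket z ^ 2) ^ n := fun z => by
    rw [← pow_mul, ← Real.rpow_natCast]; push_cast; rfl
  have h1 : (bracket q ^ 2) ^ n ≤ 2 ^ n * (bracket (y - q) ^ 2) ^ n * (bracket y ^ 2) ^ n := by
    rw [← mul_pow, ← mul_pow]
    exact pow_le_pow_left₀ (by positivity) (bracket_le_mul_bracket q y) n
  have h2 : (bracket (y - q) ^ 2) ^ n * Real.exp (-(c * ‖y - q‖ ^ 2)) ≤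
      n.factorial / c ^ n * Real.exp c := by
    have h3 := Real.pow_div_factorial_le_exp (c * bracket (y - q) ^ 2) (by positivity) n
    have h4 : Real.exp (c * bracket (y - q) ^ 2) =
        Real.exp c * Real.exp (c * ‖y - q‖ ^ 2) := by
      rw [bracket_sq, ← Real.exp_add]; ring_nf
    rw [h4, div_le_iff₀ (by positivity), mul_pow] at h3
    rw [Real.exp_neg, ← div_eq_mul_inv, div_le_iff₀ (Real.exp_pos _), div_mul_eq_mul_div,
      div_mul_eq_mul_div, le_div_iff₀ (by positivity)]
    linarith
  rw [Real.rpow_neg hq.le, e1, e1]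
  rw [← mul_assoc, mul_comm (2 ^ n * _) _, mul_assoc, inv_mul_eq_div,
    le_div_iff₀ (by positivity)]
  calc Real.exp (-(c * ‖y - q‖ ^ 2)) * (bracket q ^ 2) ^ n
      ≤ Real.exp (-(c * ‖y - q‖ ^ 2)) *
        (2 ^ n * (bracket (y - q) ^ 2) ^ n * (bracket y ^ 2) ^ n) := by gcongr
    _ = 2 ^ n * ((bracket (y - q) ^ 2) ^ n * Real.exp (-(c * ‖y - q‖ ^ 2))) *
        (bracket y ^ 2) ^ n := by ring
    _ ≤ _ := by gcongr

theorem IsAdmissible.exists_coercive {Θ : Matrix (Fin d) (Fin d) ℂ} (h : IsAdmissible Θ) :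
    ∃ c : ℝ, 0 < c ∧ ∀ r : Vec d, c * ‖r‖ ^ 2 ≤ (toC r ⬝ᵥ (Θ *ᵥ toC r)).re := by
  have hstar : ∀ r : Vec d, star (toC r) = toC r := fun r => by
    funext k; simp [toC]
  have hcont : Continuous fun r : Vec d => (toC r ⬝ᵥ (Θ *ᵥ toC r)).re := by
    simp only [toC, dotProduct, Matrix.mulVec]
    fun_prop
  -- This form of the minimum principle needs no point on the sphere, which is empty for `d = 0`.
  obtain ⟨c, hc, hle⟩ := (isCompact_sphere (0 : Vec d) 1).exists_forall_le'
    hcont.continuousOn (a := 0) fun r hr => by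
      by_contra hlt
      have h0 := h.eq_zero_of_re_form (v := toC r) (by rw [hstar]; exact not_lt.mp hlt)
      have : r = 0 := by
        ext k
        simpa [toC] using congrFun h0 k
      simp [this] at hr
  refine ⟨c, hc, fun r => ?_⟩
  rcases eq_or_ne r 0 with rfl | hr
  · have : toC (0 : Vec d) = 0 := by funext k; simp [toC]
    simp [this]
  · have hn := norm_pos_iff.mpr hr
    have h1 := hle (‖r‖⁻¹ • r) (by simp [norm_smul, hn.ne'])
    have h2 : toC (‖r‖⁻¹ • r) = ((‖r‖⁻¹ : ℝ) : ℂ) • toC r := by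
      funext k; simp [toC]
    rw [h2, Matrix.mulVec_smul, dotProduct_smul, smul_dotProduct, smul_smul, smul_eq_mul,
      ← Complex.ofReal_mul, Complex.re_ofReal_mul, ← _root_.mul_inv, inv_mul_eq_div,
      le_div_iff₀ (mul_pos hn hn)] at h1
    rwa [pow_two]

/-- The oscillating exponential `e^{iΦ/ε}` as a function of `(q, p, y)`. -/
def expPhase (κ : Vec d × Vec d → Vec d × Vec d) (S : Vec d × Vec d → ℝ)
    (Θx Θy : Matrix (Fin d) (Fin d) ℂ) (ε : ℝ) (x : Vec d) (z : Vec d × Vec d × Vec d) : ℂ :=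
  Complex.exp (Complex.I / ε * phase κ S Θx Θy x z.2.2 z.1 z.2.1)

/-- The modulus is `e^{-Im Φ/ε}`, and only the two quadratic terms contribute to `Im Φ`. The one
with `Θ^x` is nonnegative and is dropped; the one with `Θ^y` is coercive. -/
theorem exists_norm_expPhase_le (κ : Vec d × Vec d → Vec d × Vec d) (S : Vec d × Vec d → ℝ)
    {Θx Θy : Matrix (Fin d) (Fin d) ℂ} (hΘx : IsAdmissible Θx) (hΘy : IsAdmissible Θy)
    {ε : ℝ} (hε : 0 < ε) (x : Vec d) : ∃ c : ℝ, 0 < c ∧ ∀ z : Vec d × Vec d × Vec d,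
      ‖expPhase κ S Θx Θy ε x z‖ ≤ Real.exp (-(c * ‖z.2.2 - z.1‖ ^ 2)) := by
  obtain ⟨c, hc, hle⟩ := hΘy.exists_coercive
  obtain ⟨c', hc', hle'⟩ := hΘx.exists_coercive
  refine ⟨c / (2 * ε), by positivity, fun z => ?_⟩
  have him : ∀ a b : Vec d, (toC a ⬝ᵥ toC b).im = 0 := fun a b => by
    simp [toC, dotProduct]
  have hhalf : ∀ a : ℂ, (Complex.I / 2 * a).im = a.re / 2 := fun a => by
    rw [div_mul_eq_mul_div, show (2 : ℂ) = ((2 : ℝ) : ℂ) by simp, Complex.div_ofReal_im]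
    simp
  rw [expPhase, Complex.norm_exp]
  refine Real.exp_le_exp.mpr ?_
  have h1 : (Complex.I / ε * phase κ S Θx Θy x z.2.2 z.1 z.2.1).re =
      -((phase κ S Θx Θy x z.2.2 z.1 z.2.1).im / ε) := by
    rw [div_mul_eq_mul_div, Complex.div_ofReal_re]
    simp [neg_div]
  have h2 : (phase κ S Θx Θy x z.2.2 z.1 z.2.1).im =
      (toC (z.2.2 - z.1) ⬝ᵥ (Θy *ᵥ toC (z.2.2 - z.1))).re / 2 +
      (toC (x - (κ (z.1, z.2.1)).1) ⬝ᵥ (Θx *ᵥ toC (x - (κ (z.1, z.2.1)).1))).re / 2 := by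
    simp only [phase, Complex.add_im, Complex.sub_im, him, hhalf, Complex.ofReal_im]
    ring
  rw [h1, h2, neg_le_neg_iff, div_mul_eq_mul_div, div_le_div_iff₀ (by positivity) hε]
  have h3 := hle (z.2.2 - z.1)
  have h4 := hle' (x - (κ (z.1, z.2.1)).1)
  have h5 : 0 ≤ c' * ‖x - (κ (z.1, z.2.1)).1‖ ^ 2 := by positivity
  nlinarith

/-! ### The derivative of the phase. -/

theorem hasFDerivAt_quadratic {V : Type*} [NormedAddCommGroup V] [NormedSpace ℝ V]
    {Θ : Matrix (Fin d) (Fin d) ℂ} (h : Θ.IsSymm) {a : V → Vec d} {a' : V →L[ℝ] Vec d} {z : V}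
    (ha : HasFDerivAt a a' z) : ∃ Q : V →L[ℝ] ℂ,
      HasFDerivAt (fun z => toC (a z) ⬝ᵥ (Θ *ᵥ toC (a z))) Q z ∧
      ∀ e, Q e = 2 * (toC (a' e) ⬝ᵥ (Θ *ᵥ toC (a z))) := by
  have h1 : ∀ k, HasFDerivAt (fun z => ((a z k : ℝ) : ℂ))
      (Complex.ofRealCLM.comp ((coord k).comp a')) z := fun k =>
    Complex.ofRealCLM.hasFDerivAt.comp z ((coord k).hasFDerivAt.comp z ha)
  have h2 := HasFDerivAt.fun_sum (u := Finset.univ) fun k _ => (h1 k).mul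
    (HasFDerivAt.fun_sum (u := Finset.univ) fun l _ => (h1 l).const_mul (Θ k l))
  refine ⟨_, h2, fun e => ?_⟩
  simp only [_root_.sum_apply, _root_.add_apply,
    _root_.smul_apply, ContinuousLinearMap.comp_apply, smul_eq_mul,
    Complex.ofRealCLM_apply, coord_apply, dotProduct, Matrix.mulVec, toC]
  rw [Finset.sum_add_distrib, two_mul]
  simp only [Finset.mul_sum, Finset.sum_mul]
  congr 1
  · rw [Finset.sum_comm]
    refine Finset.sum_congr rfl fun k _ => Finset.sum_congr rfl fun l _ => ?_
    rw [h.apply]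
    ring
  · refine Finset.sum_congr rfl fun k _ => Finset.sum_congr rfl fun l _ => ?_
    ring

theorem hasFDerivAt_dotProduct {V : Type*} [NormedAddCommGroup V] [NormedSpace ℝ V]
    {a b : V → Vec d} {a' b' : V →L[ℝ] Vec d} {z : V}
    (ha : HasFDerivAt a a' z) (hb : HasFDerivAt b b' z) : ∃ Q : V →L[ℝ] ℂ,
      HasFDerivAt (fun z => toC (a z) ⬝ᵥ toC (b z)) Q z ∧
      ∀ e, Q e = toC (a' e) ⬝ᵥ toC (b z) + toC (a z) ⬝ᵥ toC (b' e) := by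
  have h1 : ∀ (c : V → Vec d) (c' : V →L[ℝ] Vec d), HasFDerivAt c c' z → ∀ k,
      HasFDerivAt (fun z => ((c z k : ℝ) : ℂ))
      (Complex.ofRealCLM.comp ((coord k).comp c')) z := fun c c' hc k =>
    Complex.ofRealCLM.hasFDerivAt.comp z ((coord k).hasFDerivAt.comp z hc)
  have h2 := HasFDerivAt.fun_sum (u := Finset.univ) fun k _ =>
    (h1 a a' ha k).mul (h1 b b' hb k)
  refine ⟨_, h2, fun e => ?_⟩
  simp only [_root_.sum_apply, _root_.add_apply,
    _root_.smul_apply, ContinuousLinearMap.comp_apply, smul_eq_mul,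
    Complex.ofRealCLM_apply, coord_apply, dotProduct, toC]
  rw [← Finset.sum_add_distrib]
  refine Finset.sum_congr rfl fun k _ => ?_
  ring

theorem toC_add (a b : Vec d) : toC (a + b) = toC a + toC b := by
  funext k; simp [toC]

theorem toC_sub (a b : Vec d) : toC (a - b) = toC a - toC b := by
  funext k; simp [toC]

theorem toC_neg (a : Vec d) : toC (-a) = -toC a := by
  funext k; simp [toC]

theorem toC_zero : toC (0 : Vec d) = 0 := by
  funext k; simp [toC]

theorem toC_smul (c : ℝ) (a : Vec d) : toC (c • a) = (c : ℂ) • toC a := by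
  funext k; simp [toC]

theorem toC_single (k : Fin d) : toC (EuclideanSpace.single k (1 : ℝ)) = Pi.single k 1 := by
  funext l
  rcases eq_or_ne l k with rfl | h
  · simp [toC]
  · simp [toC, h]

theorem prod_eq_sum_single (e : Vec d × Vec d) :
    e = ∑ k, e.1 k • ((EuclideanSpace.single k (1 : ℝ), 0) : Vec d × Vec d) +
      ∑ k, e.2 k • ((0, EuclideanSpace.single k (1 : ℝ)) : Vec d × Vec d) := by
  have hb : ∀ v : Vec d, v = ∑ k, v k • EuclideanSpace.single k (1 : ℝ) := fun v => by
    simpa using ((EuclideanSpace.basisFun (Fin d) ℝ).sum_repr v).symm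
  refine Prod.ext ?_ ?_
  · rw [Prod.fst_add, Prod.fst_sum, Prod.fst_sum]
    simpa using hb e.1
  · rw [Prod.snd_add, Prod.snd_sum, Prod.snd_sum]
    simpa using hb e.2

/-- The components of `κ = (X, Ξ)`. -/
def component (κ : Vec d × Vec d → Vec d × Vec d) (b : Fin d ⊕ Fin d) (z : Vec d × Vec d) : ℝ :=
  Sum.elim (fun k => (κ z).1 k) (fun k => (κ z).2 k) b

theorem hasFDerivAt_component {κ : Vec d × Vec d → Vec d × Vec d}
    (hκ : Differentiable ℝ κ) (z : Vec d × Vec d) (b : Fin d ⊕ Fin d) :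
    HasFDerivAt (component κ b) ((Sum.elim
      (fun k => (coord k).comp (ContinuousLinearMap.fst ℝ (Vec d) (Vec d)))
      (fun k => (coord k).comp (ContinuousLinearMap.snd ℝ (Vec d) (Vec d))) b).comp
        (fderiv ℝ κ z)) z := by
  cases b with
  | inl k => exact ((coord k).comp
      (ContinuousLinearMap.fst ℝ (Vec d) (Vec d))).hasFDerivAt.comp z (hκ z).hasFDerivAt
  | inr k => exact ((coord k).comp
      (ContinuousLinearMap.snd ℝ (Vec d) (Vec d))).hasFDerivAt.comp z (hκ z).hasFDerivAt

theorem fderiv_component_inl {κ : Vec d × Vec d → Vec d × Vec d}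
    (hκ : Differentiable ℝ κ) (z e : Vec d × Vec d) (k : Fin d) :
    fderiv ℝ (fun w => (κ w).1 k) z e = (fderiv ℝ κ z e).1 k := by
  have h : fderiv ℝ (fun w => (κ w).1 k) z = _ := (hasFDerivAt_component hκ z (Sum.inl k)).fderiv
  rw [h]; rfl

theorem fderiv_component_inr {κ : Vec d × Vec d → Vec d × Vec d}
    (hκ : Differentiable ℝ κ) (z e : Vec d × Vec d) (k : Fin d) :
    fderiv ℝ (fun w => (κ w).2 k) z e = (fderiv ℝ κ z e).2 k := by
  have h : fderiv ℝ (fun w => (κ w).2 k) z = _ := (hasFDerivAt_component hκ z (Sum.inr k)).fderiv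
  rw [h]; rfl

/-- Coordinate-free form `dS = -p·dq + Ξ·dX` of the equations for the action. Both sides are linear
in `e`, and the equations give equality on the standard basis. -/
theorem IsAction.fderiv_eq {κ : Vec d × Vec d → Vec d × Vec d} (hκ : Differentiable ℝ κ)
    {S : Vec d × Vec d → ℝ} (hS : IsAction κ S) (z e : Vec d × Vec d) :
    ((fderiv ℝ S z e : ℝ) : ℂ) =
      -(toC z.2 ⬝ᵥ toC e.1) + toC (fderiv ℝ κ z e).1 ⬝ᵥ toC (κ z).2 := by
  have hlin : ∀ L : Vec d × Vec d →ₗ[ℝ] ℂ,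
      (∀ k, L (EuclideanSpace.single k 1, 0) = 0) →
      (∀ k, L (0, EuclideanSpace.single k 1) = 0) → ∀ e, L e = 0 := by
    intro L h1 h2 e
    rw [prod_eq_sum_single e, map_add, map_sum, map_sum]
    simp only [map_smul, h1, h2, smul_zero, Finset.sum_const_zero, add_zero]
  let L : Vec d × Vec d →ₗ[ℝ] ℂ :=
    { toFun := fun e => ((fderiv ℝ S z e : ℝ) : ℂ) -
        (-(toC z.2 ⬝ᵥ toC e.1) + toC (fderiv ℝ κ z e).1 ⬝ᵥ toC (κ z).2)
      map_add' := fun a b => by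
        simp only [map_add, Prod.fst_add, toC_add, dotProduct_add, add_dotProduct,
          Complex.ofReal_add]
        ring
      map_smul' := fun c a => by
        simp only [map_smul, Prod.smul_fst, toC_smul, dotProduct_smul, smul_dotProduct,
          smul_eq_mul, Complex.ofReal_mul, RingHom.id_apply, Complex.real_smul]
        ring }
  refine sub_eq_zero.mp (hlin L (fun k => ?_) (fun k => ?_) e)
  · have h1 := hS.partialQ_eq z k
    simp only [partialQ, transJacQ, Matrix.of_apply, fderiv_component_inl hκ] at h1
    change ((fderiv ℝ S z _ : ℝ) : ℂ) - _ = 0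
    rw [h1, toC_single, dotProduct_single_one]
    simp [toC, dotProduct]
  · have h1 := hS.partialP_eq z k
    simp only [partialP, transJacP, Matrix.of_apply, fderiv_component_inl hκ] at h1
    change ((fderiv ℝ S z _ : ℝ) : ℂ) - _ = 0
    rw [h1, toC_zero]
    simp [toC, dotProduct]

/-- The derivative of the phase in the direction `(e, e')` of `(q, p) × y`-space. -/
def phaseDeriv (κ : Vec d × Vec d → Vec d × Vec d) (Θx Θy : Matrix (Fin d) (Fin d) ℂ)
    (x : Vec d) (e z : Vec d × Vec d × Vec d) : ℂ :=
  -(toC (z.2.2 - z.1) ⬝ᵥ toC e.2.1) - toC z.2.1 ⬝ᵥ toC e.2.2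
    + Complex.I * (toC (e.2.2 - e.1) ⬝ᵥ (Θy *ᵥ toC (z.2.2 - z.1)))
    + toC (fderiv ℝ κ (z.1, z.2.1) (e.1, e.2.1)).2 ⬝ᵥ toC (x - (κ (z.1, z.2.1)).1)
    - Complex.I * (toC (fderiv ℝ κ (z.1, z.2.1) (e.1, e.2.1)).1 ⬝ᵥ
        (Θx *ᵥ toC (x - (κ (z.1, z.2.1)).1)))

/-- The terms `-p·dq` and `Ξ·dX` of `dS` cancel against those from `-p·(y - q)` and `Ξ·(x - X)`.
Apart from `-p·dy`, everything left contains `y - q` or `x - X`. -/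
theorem hasFDerivAt_phase {κ : Vec d × Vec d → Vec d × Vec d} (hκ : Differentiable ℝ κ)
    {S : Vec d × Vec d → ℝ} (hS : IsAction κ S)
    {Θx Θy : Matrix (Fin d) (Fin d) ℂ} (hΘx : IsAdmissible Θx) (hΘy : IsAdmissible Θy)
    (x : Vec d) (z : Vec d × Vec d × Vec d) : ∃ Q : Vec d × Vec d × Vec d →L[ℝ] ℂ,
      HasFDerivAt (fun z : Vec d × Vec d × Vec d => phase κ S Θx Θy x z.2.2 z.1 z.2.1) Q z ∧
      ∀ e, Q e = phaseDeriv κ Θx Θy x e z := by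
  have hqp : HasFDerivAt (fun z : Vec d × Vec d × Vec d => (z.1, z.2.1))
      ((ContinuousLinearMap.fst ℝ (Vec d) (Vec d × Vec d)).prod
        ((ContinuousLinearMap.fst ℝ (Vec d) (Vec d)).comp
          (ContinuousLinearMap.snd ℝ (Vec d) (Vec d × Vec d)))) z :=
    ContinuousLinearMap.hasFDerivAt
      ((ContinuousLinearMap.fst ℝ (Vec d) (Vec d × Vec d)).prod
        ((ContinuousLinearMap.fst ℝ (Vec d) (Vec d)).comp
          (ContinuousLinearMap.snd ℝ (Vec d) (Vec d × Vec d))))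
  have hp : HasFDerivAt (fun z : Vec d × Vec d × Vec d => z.2.1)
      ((ContinuousLinearMap.fst ℝ (Vec d) (Vec d)).comp
          (ContinuousLinearMap.snd ℝ (Vec d) (Vec d × Vec d))) z :=
    ContinuousLinearMap.hasFDerivAt
      ((ContinuousLinearMap.fst ℝ (Vec d) (Vec d)).comp
          (ContinuousLinearMap.snd ℝ (Vec d) (Vec d × Vec d)))
  have hr : HasFDerivAt (fun z : Vec d × Vec d × Vec d => z.2.2 - z.1)
      ((ContinuousLinearMap.snd ℝ (Vec d) (Vec d)).comp
          (ContinuousLinearMap.snd ℝ (Vec d) (Vec d × Vec d)) -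
        ContinuousLinearMap.fst ℝ (Vec d) (Vec d × Vec d)) z :=
    ContinuousLinearMap.hasFDerivAt
      ((ContinuousLinearMap.snd ℝ (Vec d) (Vec d)).comp
          (ContinuousLinearMap.snd ℝ (Vec d) (Vec d × Vec d)) -
        ContinuousLinearMap.fst ℝ (Vec d) (Vec d × Vec d))
  have hκ' := HasFDerivAt.comp z (hκ (z.1, z.2.1)).hasFDerivAt hqp
  have hX := (ContinuousLinearMap.fst ℝ (Vec d) (Vec d)).hasFDerivAt.comp z hκ'
  have hΞ := (ContinuousLinearMap.snd ℝ (Vec d) (Vec d)).hasFDerivAt.comp z hκ'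
  have hxX := hX.const_sub x
  have hSz := Complex.ofRealCLM.hasFDerivAt.comp z
    (HasFDerivAt.comp z (hS.differentiable (z.1, z.2.1)).hasFDerivAt hqp)
  obtain ⟨Q1, h1, e1⟩ := hasFDerivAt_dotProduct hp hr
  obtain ⟨Q2, h2, e2⟩ := hasFDerivAt_dotProduct hΞ hxX
  obtain ⟨Q3, h3, e3⟩ := hasFDerivAt_quadratic hΘy.symm hr
  obtain ⟨Q4, h4, e4⟩ := hasFDerivAt_quadratic hΘx.symm hxX
  refine ⟨_, (((hSz.sub h1).add h2).add (h3.const_mul (Complex.I / 2))).add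
    (h4.const_mul (Complex.I / 2)), fun e => ?_⟩
  have e5 := hS.fderiv_eq hκ (z.1, z.2.1) (e.1, e.2.1)
  simp only [_root_.add_apply, _root_.sub_apply,
    _root_.smul_apply, e1, e2, e3, e4, ContinuousLinearMap.comp_apply,
    _root_.neg_apply, ContinuousLinearMap.prod_apply,
    ContinuousLinearMap.coe_fst', ContinuousLinearMap.coe_snd', Complex.ofRealCLM_apply,
    Function.comp_apply, e5, smul_eq_mul, toC_neg, neg_dotProduct, dotProduct_neg, phaseDeriv]
  rw [dotProduct_comm (toC e.2.1), dotProduct_comm (toC (κ _).2), toC_sub e.2.2,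
    dotProduct_sub, sub_dotProduct]
  ring

/-! ### The gradient in `y` and the coefficients of `L_y†`. -/

/-- The component `∂_{y_k} Φ = -p_k + i (Θ^y (y - q))_k` of the gradient of the phase, as a linear
function of `(q, p, y)`. -/
def phaseGradY (Θy : Matrix (Fin d) (Fin d) ℂ) (k : Fin d) :
    Vec d × Vec d × Vec d →L[ℝ] ℂ :=
  LinearMap.toContinuousLinearMap
    { toFun := fun z => -toC z.2.1 k + Complex.I * (Θy *ᵥ toC (z.2.2 - z.1)) k
      map_add' := fun a b => by
        have : (a + b).2.2 - (a + b).1 = (a.2.2 - a.1) + (b.2.2 - b.1) := by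
          simp only [Prod.fst_add, Prod.snd_add]; abel
        rw [this, toC_add, Matrix.mulVec_add]
        simp only [Prod.fst_add, Prod.snd_add, toC_add, Pi.add_apply]
        ring
      map_smul' := fun c a => by
        have : (c • a).2.2 - (c • a).1 = c • (a.2.2 - a.1) := by
          simp only [Prod.smul_fst, Prod.smul_snd, smul_sub]
        rw [this, toC_smul, Matrix.mulVec_smul]
        simp only [Prod.smul_fst, Prod.smul_snd, toC_smul, Pi.smul_apply, smul_eq_mul,
          Complex.real_smul, RingHom.id_apply]
        ring }

theorem phaseGradY_apply (Θy : Matrix (Fin d) (Fin d) ℂ) (k : Fin d)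
    (z : Vec d × Vec d × Vec d) :
    phaseGradY Θy k z = -toC z.2.1 k + Complex.I * (Θy *ᵥ toC (z.2.2 - z.1)) k := rfl

/-- The quantity `1 + |∇_y Φ|²`. -/
def gradWeight (Θy : Matrix (Fin d) (Fin d) ℂ) (z : Vec d × Vec d × Vec d) : ℝ :=
  1 + ∑ k, ‖phaseGradY Θy k z‖ ^ 2

theorem one_le_gradWeight (Θy : Matrix (Fin d) (Fin d) ℂ) (z : Vec d × Vec d × Vec d) :
    1 ≤ gradWeight Θy z :=
  le_add_of_nonneg_right (Finset.sum_nonneg fun _ _ => by positivity)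

theorem norm_phaseGradY_le (Θy : Matrix (Fin d) (Fin d) ℂ) (k : Fin d)
    (z : Vec d × Vec d × Vec d) : ‖phaseGradY Θy k z‖ ≤ Real.sqrt (gradWeight Θy z) := by
  refine Real.le_sqrt_of_sq_le ?_
  have := Finset.single_le_sum (f := fun k => ‖phaseGradY Θy k z‖ ^ 2)
    (fun _ _ => by positivity) (Finset.mem_univ k)
  simp only [gradWeight]
  linarith

/-- The gradient `-p + iΘ^y r` is an injective real-linear function of `(p, r)`, `r = y - q`, and an
injective linear map in finite dimension is bounded below. -/
theorem exists_bracket_le_gradWeight {Θy : Matrix (Fin d) (Fin d) ℂ} (hΘy : IsAdmissible Θy) :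
    ∃ C : ℝ, 0 < C ∧ ∀ z : Vec d × Vec d × Vec d,
      bracket z.2.1 ≤ C * Real.sqrt (gradWeight Θy z) := by
  let T : Vec d × Vec d →ₗ[ℝ] (Fin d → ℂ) :=
    LinearMap.pi fun k => ((phaseGradY Θy k).comp
      ((0 : Vec d × Vec d →L[ℝ] Vec d).prod (ContinuousLinearMap.id ℝ _))).toLinearMap
  have hT : ∀ v k, T v k = phaseGradY Θy k (0, v) := fun v k => rfl
  have hinj : T.ker = ⊥ := by
    refine LinearMap.ker_eq_bot'.mpr fun v hv => ?_
    have h1 : toC v.1 = Complex.I • (Θy *ᵥ toC v.2) := by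
      funext k
      have := congrFun hv k
      rw [hT, phaseGradY_apply] at this
      simp only [sub_zero, Pi.zero_apply] at this
      rw [Pi.smul_apply, smul_eq_mul]
      linear_combination -this
    -- On the kernel `r·Θ^y r = -i p·r` is purely imaginary, so positivity of `Re Θ^y` gives `r =
    -- 0`.
    have h2 : toC v.2 = 0 := by
      refine hΘy.eq_zero_of_re_form (le_of_eq ?_)
      have h3 : Θy *ᵥ toC v.2 = -(Complex.I • toC v.1) := by
        rw [h1, smul_smul, Complex.I_mul_I]; simp
      rw [h3]
      simp [toC, dotProduct]
    have h0 : ∀ a : Vec d, toC a = 0 → a = 0 := fun a ha => by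
      ext k
      simpa [toC] using congrFun ha k
    rw [h2] at h1
    exact Prod.ext (h0 _ (by simpa using h1)) (h0 _ h2)
  obtain ⟨K, hK, hanti⟩ := T.exists_antilipschitzWith hinj
  refine ⟨1 + K, by positivity, fun z => ?_⟩
  have h1 := hanti.le_mul_norm_sub (x := (z.2.1, z.2.2 - z.1)) (y := 0)
  simp only [map_zero, add_zero, norm_neg] at h1
  have h2 : ‖T (z.2.1, z.2.2 - z.1)‖ ≤ Real.sqrt (gradWeight Θy z) := by
    refine (pi_norm_le_iff_of_nonneg (Real.sqrt_nonneg _)).mpr fun k => ?_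
    refine le_trans (le_of_eq ?_) (norm_phaseGradY_le Θy k z)
    rw [hT, phaseGradY_apply, phaseGradY_apply, sub_zero]
  have h3 : ‖z.2.1‖ ≤ K * Real.sqrt (gradWeight Θy z) :=
    (norm_fst_le (z.2.1, z.2.2 - z.1)).trans (h1.trans (by gcongr))
  have h4 : 1 ≤ Real.sqrt (gradWeight Θy z) := Real.one_le_sqrt.mpr (one_le_gradWeight Θy z)
  calc bracket z.2.1 ≤ 1 + ‖z.2.1‖ := bracket_le_one_add_norm _
    _ ≤ _ := by linarith

/-- The function `(1 + |∇_y Φ|²)⁻¹`. -/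
def coefA (Θy : Matrix (Fin d) (Fin d) ℂ) (z : Vec d × Vec d × Vec d) : ℂ :=
  (1 + ∑ k, (‖phaseGradY Θy k z‖ : ℂ) ^ 2)⁻¹

/-- The function `(1 + |∇_y Φ|²)⁻¹ ∂_{y_k} conj Φ`. -/
def coefB (Θy : Matrix (Fin d) (Fin d) ℂ) (k : Fin d) (z : Vec d × Vec d × Vec d) : ℂ :=
  coefA Θy z * (starRingEnd ℂ) (phaseGradY Θy k z)

theorem coefA_eq (Θy : Matrix (Fin d) (Fin d) ℂ) (z : Vec d × Vec d × Vec d) :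
    coefA Θy z = ((gradWeight Θy z : ℝ) : ℂ)⁻¹ := by
  simp [coefA, gradWeight]

theorem isSymbol_phaseGradY (Θy : Matrix (Fin d) (Fin d) ℂ) (k : Fin d) :
    IsSymbol 1 (fun z => Real.sqrt (gradWeight Θy z)) (fun _ z => phaseGradY Θy k z) :=
  isSymbol_clm (phaseGradY Θy k) (C := 1)
    (fun z => by simpa using one_le_gradWeight Θy z)
    (fun z => by simpa using norm_phaseGradY_le Θy k z)

theorem isSymbol_conj_phaseGradY (Θy : Matrix (Fin d) (Fin d) ℂ) (k : Fin d) :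
    IsSymbol 1 (fun z => Real.sqrt (gradWeight Θy z))
      (fun _ z => (starRingEnd ℂ) (phaseGradY Θy k z)) :=
  (isSymbol_phaseGradY Θy k).clm_comp Complex.conjCLE.toContinuousLinearMap

/-- Writing `|∂_k Φ|²` as a product with the conjugate exhibits `1 + |∇_y Φ|²` as a symbol whose
modulus equals its weight, so it can be inverted. -/
theorem isSymbol_coefA' (Θy : Matrix (Fin d) (Fin d) ℂ) :
    IsSymbol 1 (fun z => (gradWeight Θy z)⁻¹) (fun _ => coefA Θy) := by
  have h1 : IsSymbol 1 (gradWeight Θy) (fun _ z => (1 : ℂ) + ∑ k,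
      phaseGradY Θy k z * (starRingEnd ℂ) (phaseGradY Θy k z)) := by
    refine IsSymbol.add ((isSymbol_const (1 : ℂ)).mono (fun _ => zero_le_one) (C := 1)
      fun z => by simpa using one_le_gradWeight Θy z) (IsSymbol.sum _ fun k _ => ?_)
    have h := (isSymbol_phaseGradY Θy k).mul (isSymbol_conj_phaseGradY Θy k)
    have e : (fun z => Real.sqrt (gradWeight Θy z) * Real.sqrt (gradWeight Θy z)) =
        gradWeight Θy := funext fun z =>
      Real.mul_self_sqrt (zero_le_one.trans (one_le_gradWeight Θy z))
    rwa [e] at h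
  have e : ∀ z, (1 : ℂ) + ∑ k, phaseGradY Θy k z * (starRingEnd ℂ) (phaseGradY Θy k z) =
      ((gradWeight Θy z : ℝ) : ℂ) := fun z => by
    simp [gradWeight, Complex.mul_conj']
  have h2 := h1.inv (fun z => one_pos.trans_le (one_le_gradWeight Θy z)) one_pos
    fun ε _ _ z => by
      rw [e, Complex.norm_real, one_mul]
      exact Real.le_norm_self _
  convert h2 using 3 with _ z
  rw [e, coefA_eq]

theorem bracket_inv_rpow (p : Vec d) : bracket p ^ (-1 : ℝ) = (bracket p)⁻¹ :=
  Real.rpow_neg_one _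

/-- The decay is in fact of order `-2` in `p`; order `-1` is recorded because `coefB` has no better.
-/
theorem isSymbol_coefA {Θy : Matrix (Fin d) (Fin d) ℂ} (hΘy : IsAdmissible Θy) :
    IsSymbol 1 (fun z : Vec d × Vec d × Vec d => bracket z.2.1 ^ (-1 : ℝ))
      (fun _ => coefA Θy) := by
  obtain ⟨C, hC, hle⟩ := exists_bracket_le_gradWeight hΘy
  have hg := one_le_gradWeight Θy
  refine (isSymbol_coefA' Θy).mono (fun z => by have := hg z; positivity) (C := C) fun z => ?_
  have hp := bracket_pos z.2.1
  have h0 := hg z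
  rw [bracket_inv_rpow, ← div_eq_mul_inv, inv_eq_one_div, div_le_div_iff₀ (by positivity) hp,
    one_mul]
  refine (hle z).trans ?_
  gcongr
  exact Real.sqrt_le_iff.mpr ⟨by positivity, by nlinarith⟩

theorem isSymbol_coefB {Θy : Matrix (Fin d) (Fin d) ℂ} (hΘy : IsAdmissible Θy) (k : Fin d) :
    IsSymbol 1 (fun z : Vec d × Vec d × Vec d => bracket z.2.1 ^ (-1 : ℝ))
      (fun _ => coefB Θy k) := by
  obtain ⟨C, hC, hle⟩ := exists_bracket_le_gradWeight hΘy
  have hg := one_le_gradWeight Θy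
  refine ((isSymbol_coefA' Θy).mul (isSymbol_conj_phaseGradY Θy k)).mono
    (fun z => by have := hg z; positivity) (C := C) fun z => ?_
  have hp := bracket_pos z.2.1
  have h0 := hg z
  rw [bracket_inv_rpow, ← div_eq_mul_inv, inv_mul_eq_div, div_le_div_iff₀ (by positivity) hp]
  calc _ ≤ Real.sqrt (gradWeight Θy z) * (C * Real.sqrt (gradWeight Θy z)) := by
        gcongr; exact hle z
    _ = C * (Real.sqrt (gradWeight Θy z) * Real.sqrt (gradWeight Θy z)) := by ring
    _ = _ := by rw [Real.mul_self_sqrt (by positivity)]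

/-! ### Amplitudes -/

/-- The weight `⟨q⟩^M ⟨p⟩^m ⟨y⟩^{-N}`. -/
def ampWeight (M m N : ℝ) (z : Vec d × Vec d × Vec d) : ℝ :=
  bracket z.1 ^ M * bracket z.2.1 ^ m * bracket z.2.2 ^ (-N)

theorem ampWeight_pos (M m N : ℝ) (z : Vec d × Vec d × Vec d) : 0 < ampWeight M m N z :=
  mul_pos (mul_pos (Real.rpow_pos_of_pos (bracket_pos _) _)
    (Real.rpow_pos_of_pos (bracket_pos _) _)) (Real.rpow_pos_of_pos (bracket_pos _) _)

theorem ampWeight_mul (M m N M' m' N' : ℝ) (z : Vec d × Vec d × Vec d) :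
    ampWeight M m N z * ampWeight M' m' N' z = ampWeight (M + M') (m + m') (N + N') z := by
  simp only [ampWeight, neg_add, Real.rpow_add (bracket_pos _)]
  ring

theorem ampWeight_mono {M m N M' m' N' : ℝ} (hM : M ≤ M') (hm : m ≤ m') (hN : N' ≤ N)
    (z : Vec d × Vec d × Vec d) : ampWeight M m N z ≤ ampWeight M' m' N' z := by
  unfold ampWeight
  have h := @one_le_bracket d
  have h' := @bracket_pos d
  have := h' z.1
  have := h' z.2.1
  have := h' z.2.2
  have := h z.1
  have := h z.2.1
  have := h z.2.2
  gcongr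

/-- Smooth functions of `(q, p, y)` whose derivatives are `O(⟨q⟩^M ⟨p⟩^m ⟨y⟩^{-N})` for all `N`. -/
def IsAmplitude (M m : ℝ) (f : Vec d × Vec d × Vec d → ℂ) : Prop :=
  ∀ N : ℝ, IsSymbol 1 (ampWeight M m N) (fun _ => f)

theorem IsAmplitude.contDiff {M m : ℝ} {f : Vec d × Vec d × Vec d → ℂ}
    (h : IsAmplitude M m f) : ContDiff ℝ ∞ f := (h 0).contDiff

theorem IsAmplitude.mono {M m M' m' : ℝ} {f : Vec d × Vec d × Vec d → ℂ}
    (h : IsAmplitude M m f) (hM : M ≤ M') (hm : m ≤ m') : IsAmplitude M' m' f := fun N =>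
  (h N).mono (fun z => (ampWeight_pos _ _ _ z).le) (C := 1) fun z => by
    simpa using ampWeight_mono hM hm le_rfl z

theorem IsAmplitude.add {M m : ℝ} {f g : Vec d × Vec d × Vec d → ℂ}
    (hf : IsAmplitude M m f) (hg : IsAmplitude M m g) : IsAmplitude M m (fun z => f z + g z) :=
  fun N => (hf N).add (hg N)

theorem IsAmplitude.const_mul {M m : ℝ} {f : Vec d × Vec d × Vec d → ℂ}
    (hf : IsAmplitude M m f) (c : ℂ) : IsAmplitude M m (fun z => c * f z) :=
  fun N => (hf N).const_mul c

theorem IsAmplitude.sum {ι : Type*} {s : Finset ι} {M m : ℝ}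
    {f : ι → Vec d × Vec d × Vec d → ℂ} (hf : ∀ i ∈ s, IsAmplitude M m (f i)) :
    IsAmplitude M m (fun z => ∑ i ∈ s, f i z) :=
  fun N => IsSymbol.sum s fun i hi => hf i hi N

theorem IsAmplitude.fderiv_apply {M m : ℝ} {f : Vec d × Vec d × Vec d → ℂ}
    (hf : IsAmplitude M m f) (e : Vec d × Vec d × Vec d) :
    IsAmplitude M m (fun z => fderiv ℝ f z e) :=
  fun N => (hf N).fderiv_apply e

/-- Growth of the multiplier in `y` costs nothing, since the decay exponent `N` of an amplitude is
arbitrary. -/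
theorem IsAmplitude.symbol_mul {M m M' m' N' : ℝ} {a f : Vec d × Vec d × Vec d → ℂ}
    (hf : IsAmplitude M m f) (ha : IsSymbol 1 (ampWeight M' m' N') (fun _ => a)) :
    IsAmplitude (M' + M) (m' + m) (fun z => a z * f z) := fun N => by
  have h := ha.mul (hf (N - N'))
  simp only [ampWeight_mul] at h
  rwa [add_sub_cancel] at h

theorem isSymbol_of_bracket_p {a : Vec d × Vec d × Vec d → ℂ} {m : ℝ}
    (ha : IsSymbol 1 (fun z => bracket z.2.1 ^ m) (fun _ => a)) :
    IsSymbol 1 (ampWeight 0 m 0) (fun _ => a) := by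
  have : ampWeight 0 m 0 = fun z : Vec d × Vec d × Vec d => bracket z.2.1 ^ m := by
    funext z; simp [ampWeight]
  rwa [this]

/-! ### Action of `L_y†` on amplitudes. -/

/-- The operator `L_y†` on functions of `(q, p, y)`. -/
def jointLT (Θy : Matrix (Fin d) (Fin d) ℂ) (ε : ℝ) (f : Vec d × Vec d × Vec d → ℂ) :
    Vec d × Vec d × Vec d → ℂ := fun z =>
  coefA Θy z * f z + Complex.I * ε * ∑ k,
    fderiv ℝ (fun z' => coefB Θy k z' * f z') z (0, 0, EuclideanSpace.single k 1)

theorem IsAmplitude.coefB_mul {Θy : Matrix (Fin d) (Fin d) ℂ} (hΘy : IsAdmissible Θy)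
    {M m : ℝ} {f : Vec d × Vec d × Vec d → ℂ} (hf : IsAmplitude M m f) (k : Fin d) :
    IsAmplitude M (m - 1) (fun z => coefB Θy k z * f z) := by
  have h := hf.symbol_mul (isSymbol_of_bracket_p (isSymbol_coefB hΘy k))
  rwa [zero_add, neg_add_eq_sub] at h

theorem IsAmplitude.coefA_mul {Θy : Matrix (Fin d) (Fin d) ℂ} (hΘy : IsAdmissible Θy)
    {M m : ℝ} {f : Vec d × Vec d × Vec d → ℂ} (hf : IsAmplitude M m f) :
    IsAmplitude M (m - 1) (fun z => coefA Θy z * f z) := by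
  have h := hf.symbol_mul (isSymbol_of_bracket_p (isSymbol_coefA hΘy))
  rwa [zero_add, neg_add_eq_sub] at h

theorem IsAmplitude.jointLT {Θy : Matrix (Fin d) (Fin d) ℂ} (hΘy : IsAdmissible Θy) (ε : ℝ)
    {M m : ℝ} {f : Vec d × Vec d × Vec d → ℂ} (hf : IsAmplitude M m f) :
    IsAmplitude M (m - 1) (jointLT Θy ε f) :=
  (hf.coefA_mul hΘy).add
    ((IsAmplitude.sum fun k _ => (hf.coefB_mul hΘy k).fderiv_apply _).const_mul _)

theorem IsAmplitude.iterate_jointLT {Θy : Matrix (Fin d) (Fin d) ℂ} (hΘy : IsAdmissible Θy)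
    (ε : ℝ) {M m : ℝ} {f : Vec d × Vec d × Vec d → ℂ} (hf : IsAmplitude M m f) (n : ℕ) :
    IsAmplitude M (m - n) ((HermanKluk.jointLT Θy ε)^[n] f) := by
  induction n with
  | zero => simpa using hf
  | succ n ih =>
    rw [Function.iterate_succ_apply']
    have := ih.jointLT hΘy ε
    rwa [sub_sub, ← Nat.cast_succ] at this

theorem hasFDerivAt_sectionY {W : Type*} [NormedAddCommGroup W] [NormedSpace ℝ W]
    {g : Vec d × Vec d × Vec d → W} {g' : Vec d × Vec d × Vec d →L[ℝ] W}
    {z : Vec d × Vec d × Vec d} (hg : HasFDerivAt g g' z) :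
    HasFDerivAt (fun y => g (z.1, z.2.1, y)) (g'.comp
      ((ContinuousLinearMap.inr ℝ (Vec d) (Vec d × Vec d)).comp
        (ContinuousLinearMap.inr ℝ (Vec d) (Vec d)))) z.2.2 := by
  have h1 : HasFDerivAt (fun y => (z.1, z.2.1, y))
      ((ContinuousLinearMap.inr ℝ (Vec d) (Vec d × Vec d)).comp
        (ContinuousLinearMap.inr ℝ (Vec d) (Vec d))) z.2.2 :=
    HasFDerivAt.comp z.2.2 (hasFDerivAt_prodMk_right z.1 z.2)
      (hasFDerivAt_prodMk_right z.2.1 z.2.2)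
  exact HasFDerivAt.comp z.2.2 hg h1

theorem partialY_section {g : Vec d × Vec d × Vec d → ℂ} {z : Vec d × Vec d × Vec d}
    (hg : DifferentiableAt ℝ g z) (k : Fin d) :
    partialY k (fun y => g (z.1, z.2.1, y)) z.2.2 =
      fderiv ℝ g z (0, 0, EuclideanSpace.single k 1) := by
  rw [partialY, (hasFDerivAt_sectionY hg.hasFDerivAt).fderiv]
  rfl

theorem phaseDeriv_y (κ : Vec d × Vec d → Vec d × Vec d) (Θx Θy : Matrix (Fin d) (Fin d) ℂ)
    (x : Vec d) (k : Fin d) (z : Vec d × Vec d × Vec d) :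
    phaseDeriv κ Θx Θy x (0, 0, EuclideanSpace.single k 1) z = phaseGradY Θy k z := by
  rw [phaseGradY_apply]
  simp [phaseDeriv, toC_zero, toC_single, show ((0 : Vec d), (0 : Vec d)) = 0 from rfl]

section Phase

variable {κ : Vec d × Vec d → Vec d × Vec d} {S : Vec d × Vec d → ℝ}
  {Θx Θy : Matrix (Fin d) (Fin d) ℂ}

theorem partialY_phase (hκ : Differentiable ℝ κ) (hS : IsAction κ S)
    (hΘx : IsAdmissible Θx) (hΘy : IsAdmissible Θy) (x : Vec d) (z : Vec d × Vec d × Vec d)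
    (k : Fin d) :
    partialY k (fun y => phase κ S Θx Θy x y z.1 z.2.1) z.2.2 = phaseGradY Θy k z := by
  obtain ⟨Q, hQ, e⟩ := hasFDerivAt_phase hκ hS hΘx hΘy x z
  have h := partialY_section hQ.differentiableAt k
  simp only at h
  rw [h, hQ.fderiv, e, phaseDeriv_y]

theorem partialY_conj_phase (hκ : Differentiable ℝ κ) (hS : IsAction κ S)
    (hΘx : IsAdmissible Θx) (hΘy : IsAdmissible Θy) (x : Vec d) (z : Vec d × Vec d × Vec d)
    (k : Fin d) :
    partialY k (fun y => (starRingEnd ℂ) (phase κ S Θx Θy x y z.1 z.2.1)) z.2.2 =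
      (starRingEnd ℂ) (phaseGradY Θy k z) := by
  obtain ⟨Q, hQ, e⟩ := hasFDerivAt_phase hκ hS hΘx hΘy x z
  have hc : HasFDerivAt (fun z : Vec d × Vec d × Vec d =>
      (starRingEnd ℂ) (phase κ S Θx Θy x z.2.2 z.1 z.2.1))
      (Complex.conjCLE.toContinuousLinearMap.comp Q) z :=
    Complex.conjCLE.toContinuousLinearMap.hasFDerivAt.comp z hQ
  have h := partialY_section hc.differentiableAt k
  simp only at h
  rw [h, hc.fderiv, ← phaseDeriv_y κ Θx Θy x, ← e]
  rfl

/-- Identifies the operator acting in `y` at frozen `(q, p)` with one acting on functions of all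
variables, to which the amplitude estimates apply. -/
theorem opLT_section (hκ : Differentiable ℝ κ) (hS : IsAction κ S)
    (hΘx : IsAdmissible Θx) (hΘy : IsAdmissible Θy) (x : Vec d) (ε : ℝ)
    {f : Vec d × Vec d × Vec d → ℂ} (hf : ContDiff ℝ ∞ f) (q p : Vec d) :
    opLT ε (fun y => phase κ S Θx Θy x y q p) (fun y => f (q, p, y)) =
      fun y => jointLT Θy ε f (q, p, y) := by
  funext y
  have h1 : ∀ y k, partialY k (fun y => phase κ S Θx Θy x y q p) y =
      phaseGradY Θy k (q, p, y) := fun y k =>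
    partialY_phase hκ hS hΘx hΘy x (q, p, y) k
  have h2 : ∀ y k, partialY k (fun y => (starRingEnd ℂ) (phase κ S Θx Θy x y q p)) y =
      (starRingEnd ℂ) (phaseGradY Θy k (q, p, y)) := fun y k =>
    partialY_conj_phase hκ hS hΘx hΘy x (q, p, y) k
  have h3 : ∀ k, ContDiff ℝ ∞ (coefB Θy k) := fun k => (isSymbol_coefB hΘy k).contDiff
  simp only [opLT, jointLT, h1, h2]
  congr 2
  refine Finset.sum_congr rfl fun k _ => ?_
  exact partialY_section (g := fun z => coefB Θy k z * f z) (z := (q, p, y))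
    (((h3 k).mul hf).differentiable (by simp)).differentiableAt k

theorem iterate_opLT_section (hκ : Differentiable ℝ κ) (hS : IsAction κ S)
    (hΘx : IsAdmissible Θx) (hΘy : IsAdmissible Θy) (x : Vec d) (ε : ℝ) {M m : ℝ}
    {f : Vec d × Vec d × Vec d → ℂ} (hf : IsAmplitude M m f) (q p : Vec d) (n : ℕ) :
    (opLT ε (fun y => phase κ S Θx Θy x y q p))^[n] (fun y => f (q, p, y)) =
      fun y => (jointLT Θy ε)^[n] f (q, p, y) := by
  induction n with
  | zero => rfl
  | succ n ih =>
    rw [Function.iterate_succ_apply', Function.iterate_succ_apply', ih]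
    exact opLT_section hκ hS hΘx hΘy x ε (hf.iterate_jointLT hΘy ε n).contDiff q p

end Phase

/-! ### Integrability of oscillatory integrands. -/

open MeasureTheory

/-- The data `(κ, S, Θ^x, Θ^y)` entering the phase function satisfy all assumptions. -/
structure IsPhase (κ : Vec d × Vec d → Vec d × Vec d) (S : Vec d × Vec d → ℝ)
    (Θx Θy : Matrix (Fin d) (Fin d) ℂ) : Prop where
  classB : IsClassB κ
  action : IsAction κ S
  admX : IsAdmissible Θx
  admY : IsAdmissible Θy

theorem IsClassB.differentiable {κ : Vec d × Vec d → Vec d × Vec d} (h : IsClassB κ) :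
    Differentiable ℝ κ := h.contDiff.differentiable (by simp)

theorem integrable_bracket_rpow {s : ℝ} (hs : s < -d) :
    Integrable fun v : Vec d => bracket v ^ s := by
  have h := integrable_rpow_neg_one_add_norm_sq (E := Vec d) (μ := volume) (r := -s)
    (by rw [finrank_euclideanSpace, Fintype.card_fin]; linarith)
  refine h.congr (Filter.Eventually.of_forall fun v => ?_)
  have h0 : (0 : ℝ) ≤ 1 + ‖v‖ ^ 2 := by positivity
  simp only [bracket, Real.sqrt_eq_rpow, ← Real.rpow_mul h0, neg_neg]
  ring_nf

theorem integrable_ampWeight {M m N : ℝ} (hM : M < -d) (hm : m < -d) (hN : d < N) :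
    Integrable (ampWeight (d := d) M m N) := by
  have h := (integrable_bracket_rpow (d := d) hM).mul_prod
    ((integrable_bracket_rpow (d := d) hm).mul_prod
      (integrable_bracket_rpow (d := d) (s := -N) (by linarith)))
  refine h.congr (Filter.Eventually.of_forall fun z => ?_)
  simp only [ampWeight, mul_assoc]

/-- The integral of a directional derivative vanishes. -/
theorem integral_eq_zero_of_hasLineDerivAt {V : Type*} [NormedAddCommGroup V] [NormedSpace ℝ V]
    [MeasurableSpace V] [BorelSpace V] [FiniteDimensional ℝ V] {μ : Measure V}
    [μ.IsAddHaarMeasure] {F F' : V → ℂ} {v : V} (hF : Integrable F μ) (hF' : Integrable F' μ)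
    (h : ∀ z, HasLineDerivAt ℝ F (F' z) z v) : ∫ z, F' z ∂μ = 0 := by
  -- Integration by parts against the constant function `1`.
  have := integral_bilinear_hasLineDerivAt_right_eq_neg_left_of_integrable (μ := μ)
    (f := fun _ => (1 : ℂ)) (f' := fun _ => 0) (g := F) (g' := F') (v := v)
    (B := ContinuousLinearMap.mul ℝ ℂ) (by simp) (by simpa using hF') (by simpa using hF)
    (fun z _ => by simpa [HasLineDerivAt] using hasDerivAt_const (0 : ℝ) (1 : ℂ))
    (fun z _ => h z)
  simpa using this

section Amplitude

variable {κ : Vec d × Vec d → Vec d × Vec d} {S : Vec d × Vec d → ℝ}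
  {Θx Θy : Matrix (Fin d) (Fin d) ℂ}

theorem exists_norm_expPhase_le_ampWeight (hp : IsPhase κ S Θx Θy)
    {ε : ℝ} (hε : 0 < ε) (x : Vec d) (n : ℕ) : ∃ C : ℝ, 0 ≤ C ∧ ∀ z,
      ‖expPhase κ S Θx Θy ε x z‖ ≤ C * ampWeight (-(2 * n)) 0 (-(2 * n)) z := by
  obtain ⟨c, hc, hle⟩ := exists_norm_expPhase_le κ S hp.admX hp.admY hε x
  obtain ⟨C, hC, hle'⟩ := exists_gaussian_le (d := d) hc n
  refine ⟨C, hC, fun z => (hle z).trans ((hle' z.1 z.2.2).trans (le_of_eq ?_))⟩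
  simp [ampWeight]

theorem hasFDerivAt_expPhase (h : IsPhase κ S Θx Θy) (ε : ℝ) (x : Vec d)
    (z : Vec d × Vec d × Vec d) : ∃ Q : Vec d × Vec d × Vec d →L[ℝ] ℂ,
      HasFDerivAt (expPhase κ S Θx Θy ε x) Q z ∧
      ∀ e, Q e = expPhase κ S Θx Θy ε x z * (Complex.I / ε * phaseDeriv κ Θx Θy x e z) := by
  obtain ⟨Q, hQ, e⟩ := hasFDerivAt_phase h.classB.differentiable h.action h.admX h.admY x z
  refine ⟨_, (hQ.const_mul (Complex.I / ε)).cexp, fun v => ?_⟩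
  simp [e, expPhase]

theorem continuous_expPhase (h : IsPhase κ S Θx Θy) (ε : ℝ) (x : Vec d) :
    Continuous (expPhase κ S Θx Θy ε x) :=
  continuous_iff_continuousAt.mpr fun z =>
    (hasFDerivAt_expPhase h ε x z).choose_spec.1.continuousAt

theorem IsAmplitude.exists_bound {M m : ℝ} {f : Vec d × Vec d × Vec d → ℂ}
    (hf : IsAmplitude M m f) (N : ℝ) :
    ∃ C : ℝ, 0 ≤ C ∧ ∀ z, ‖f z‖ ≤ C * ampWeight M m N z := by
  obtain ⟨C, hC⟩ := (hf N).bound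
  exact ⟨|C|, abs_nonneg C, fun z => (hC 1 one_pos le_rfl z).trans
    (mul_le_mul_of_nonneg_right (le_abs_self C) (ampWeight_pos _ _ _ z).le)⟩

/-- The Gaussian lowers the exponent of `⟨q⟩` by `2n` and costs `⟨y⟩^{2n}`, compensated by the decay
of order `N + 2n` of the amplitude. -/
theorem IsAmplitude.exists_expPhase_mul_bound (hp : IsPhase κ S Θx Θy)
    {ε : ℝ} (hε : 0 < ε) (x : Vec d) {M m : ℝ} {f : Vec d × Vec d × Vec d → ℂ}
    (hf : IsAmplitude M m f) (n : ℕ) (N : ℝ) : ∃ C : ℝ, 0 ≤ C ∧ ∀ z,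
      ‖expPhase κ S Θx Θy ε x z * f z‖ ≤ C * ampWeight (M - 2 * n) m N z := by
  obtain ⟨C, hC, h⟩ := exists_norm_expPhase_le_ampWeight hp hε x n
  obtain ⟨D, hD, h'⟩ := hf.exists_bound (N + 2 * n)
  refine ⟨C * D, by positivity, fun z => ?_⟩
  rw [norm_mul]
  calc _ ≤ (C * ampWeight (-(2 * n)) 0 (-(2 * n)) z) * (D * ampWeight M m (N + 2 * n) z) := by
        have := (ampWeight_pos (-(2 * n)) 0 (-(2 * n)) z).le
        exact mul_le_mul (h z) (h' z) (norm_nonneg _) (by positivity)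
    _ = C * D * (ampWeight (-(2 * n)) 0 (-(2 * n)) z * ampWeight M m (N + 2 * n) z) := by ring
    _ = _ := by rw [ampWeight_mul]; congr 2 <;> ring

theorem continuous_expPhase_mul (hp : IsPhase κ S Θx Θy) (ε : ℝ) (x : Vec d) {M m : ℝ}
    {f : Vec d × Vec d × Vec d → ℂ} (hf : IsAmplitude M m f) :
    Continuous fun z => expPhase κ S Θx Θy ε x z * f z :=
  (continuous_expPhase hp ε x).mul hf.contDiff.continuous

theorem IsAmplitude.integrable (hp : IsPhase κ S Θx Θy) {ε : ℝ} (hε : 0 < ε) (x : Vec d)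
    {M m : ℝ} {f : Vec d × Vec d × Vec d → ℂ} (hf : IsAmplitude M m f) (hm : m < -d) :
    Integrable fun z => expPhase κ S Θx Θy ε x z * f z := by
  -- This `n` makes `M - 2n < -d`; only the decay in `p` has to be assumed.
  obtain ⟨n, hn⟩ := exists_nat_gt ((M + d) / 2)
  obtain ⟨C, hC, h⟩ := hf.exists_expPhase_mul_bound hp hε x n (d + 1)
  have hi : Integrable (ampWeight (d := d) (M - 2 * n) m (d + 1)) :=
    integrable_ampWeight (by linarith) hm (by linarith)
  exact (hi.const_mul C).mono' (continuous_expPhase_mul hp ε x hf).aestronglyMeasurable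
    (Filter.Eventually.of_forall h)

theorem IsAmplitude.integrable_y (hp : IsPhase κ S Θx Θy) {ε : ℝ} (hε : 0 < ε) (x : Vec d)
    {M m : ℝ} {f : Vec d × Vec d × Vec d → ℂ} (hf : IsAmplitude M m f) (q p : Vec d) :
    Integrable fun y => expPhase κ S Θx Θy ε x (q, p, y) * f (q, p, y) := by
  obtain ⟨C, hC, h⟩ := hf.exists_expPhase_mul_bound hp hε x 0 (d + 1)
  have hi : Integrable fun y : Vec d => ampWeight (d := d) (M - 2 * (0 : ℕ)) m (d + 1) (q, p, y) :=
    Integrable.const_mul (integrable_bracket_rpow (s := -(d + 1)) (by linarith))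
      (bracket q ^ (M - 2 * (0 : ℕ)) * bracket p ^ m)
  exact (hi.const_mul C).mono' ((continuous_expPhase_mul hp ε x hf).comp
    (by fun_prop : Continuous fun y : Vec d => (q, p, y))).aestronglyMeasurable
    (Filter.Eventually.of_forall fun y => h (q, p, y))

end Amplitude

/-! ### Symbol estimates for the canonical transformation and the phase -/

section Canonical

variable {κ : Vec d × Vec d → Vec d × Vec d}

theorem jacobian_inl (z : Vec d × Vec d) (b : Fin d ⊕ Fin d) (l : Fin d) :
    jacobian κ z b (Sum.inl l) =
      fderiv ℝ (component κ b) z (EuclideanSpace.single l 1, 0) := by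
  cases b <;> rfl

theorem jacobian_inr (z : Vec d × Vec d) (b : Fin d ⊕ Fin d) (l : Fin d) :
    jacobian κ z b (Sum.inr l) =
      fderiv ℝ (component κ b) z (0, EuclideanSpace.single l 1) := by
  cases b <;> rfl

theorem fderiv_component_eq (z : Vec d × Vec d) (b : Fin d ⊕ Fin d) :
    fderiv ℝ (component κ b) z =
      ∑ l, jacobian κ z b (Sum.inl l) •
          (coord l).comp (ContinuousLinearMap.fst ℝ (Vec d) (Vec d)) +
        ∑ l, jacobian κ z b (Sum.inr l) •
          (coord l).comp (ContinuousLinearMap.snd ℝ (Vec d) (Vec d)) := by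
  refine ContinuousLinearMap.ext fun e => ?_
  conv_lhs => rw [prod_eq_sum_single e]
  simp only [map_add, map_sum, map_smul, ← jacobian_inl, ← jacobian_inr, _root_.add_apply,
    _root_.sum_apply, _root_.smul_apply, ContinuousLinearMap.comp_apply,
    ContinuousLinearMap.coe_fst', ContinuousLinearMap.coe_snd', coord_apply, smul_eq_mul]
  simp only [mul_comm]

theorem isSymbol_fderiv_component (hκ : IsClassB κ) (b : Fin d ⊕ Fin d) :
    IsSymbol 1 (fun _ => 1) (fun _ => fderiv ℝ (component κ b)) := by
  have e : fderiv ℝ (component κ b) = _ := funext fun z => fderiv_component_eq z b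
  rw [e]
  refine (IsSymbol.sum _ fun l _ => ?_).add (IsSymbol.sum _ fun l _ => ?_)
  · exact (hκ.jacobian_symbol b (Sum.inl l)).clm_comp
      ((ContinuousLinearMap.id ℝ ℝ).smulRight _)
  · exact (hκ.jacobian_symbol b (Sum.inr l)).clm_comp
      ((ContinuousLinearMap.id ℝ ℝ).smulRight _)

theorem norm_le_bracket_mul (z : Vec d × Vec d) : ‖z‖ ≤ bracket z.1 * bracket z.2 := by
  have h1 := one_le_bracket z.1
  have h2 := one_le_bracket z.2
  exact max_le ((norm_le_bracket z.1).trans (le_mul_of_one_le_right (by linarith) h2))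
    ((norm_le_bracket z.2).trans (le_mul_of_one_le_left (by linarith) h1))

theorem one_le_bracket_mul (z : Vec d × Vec d) : 1 ≤ bracket z.1 * bracket z.2 :=
  one_le_mul_of_one_le_of_one_le (one_le_bracket z.1) (one_le_bracket z.2)

/-- Bounded derivatives imply at most linear growth, by the mean value inequality, and `|z| ≤
⟨q⟩⟨p⟩`. -/
theorem isSymbol_component (hκ : IsClassB κ) (b : Fin d ⊕ Fin d) :
    IsSymbol 1 (fun z => bracket z.1 * bracket z.2) (fun _ => component κ b) := by
  have hs := isSymbol_fderiv_component hκ b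
  have hd : ∀ z, HasFDerivAt (component κ b) _ z := fun z =>
    hasFDerivAt_component hκ.differentiable z b
  obtain ⟨C, hC⟩ := hs.bound
  have hcd : ContDiff ℝ ∞ (component κ b) :=
    contDiff_infty_iff_fderiv.mpr ⟨fun z => (hd z).differentiableAt, hs.contDiff⟩
  refine IsSymbol.of_fderiv (fun _ _ _ => hcd) ⟨‖component κ b 0‖ + |C|, fun _ _ _ z => ?_⟩
    (hs.mono (fun _ => zero_le_one) (C := 1) fun z => by simpa using one_le_bracket_mul z)
  have h1 := convex_univ.norm_image_sub_le_of_norm_fderiv_le (𝕜 := ℝ) (f := component κ b)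
    (C := |C|) (fun z _ => (hd z).differentiableAt)
    (fun z _ => (hC 1 one_pos le_rfl z).trans (by rw [mul_one]; exact le_abs_self C))
    (Set.mem_univ 0) (Set.mem_univ z)
  have h2 : ‖component κ b z‖ ≤ ‖component κ b 0‖ + ‖component κ b z - component κ b 0‖ := by
    have := norm_add_le (component κ b 0) (component κ b z - component κ b 0)
    rwa [add_sub_cancel] at this
  rw [sub_zero] at h1
  have h3 := norm_le_bracket_mul z
  have h4 := one_le_bracket_mul z
  rw [add_mul]
  refine h2.trans (add_le_add (le_mul_of_one_le_right (norm_nonneg _) h4) (h1.trans ?_))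
  gcongr

/-- The projection `(q, p, y) ↦ (q, p)`. -/
def projQP (d : ℕ) : Vec d × Vec d × Vec d →L[ℝ] Vec d × Vec d :=
  (ContinuousLinearMap.fst ℝ (Vec d) (Vec d × Vec d)).prod
    ((ContinuousLinearMap.fst ℝ (Vec d) (Vec d)).comp
      (ContinuousLinearMap.snd ℝ (Vec d) (Vec d × Vec d)))

theorem one_le_ampWeight {M m N : ℝ} (hM : 0 ≤ M) (hm : 0 ≤ m) (hN : N ≤ 0)
    (z : Vec d × Vec d × Vec d) : 1 ≤ ampWeight M m N z := by
  have := ampWeight_mono hM hm hN z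
  simpa [ampWeight] using this

/-- The index `-1` stands for growth like `⟨y⟩`. This crude weight suffices, since any polynomial
growth of an amplitude in `q` and `p` is admitted. -/
theorem isSymbol_clm_ampWeight (L : Vec d × Vec d × Vec d →L[ℝ] ℂ) :
    IsSymbol 1 (ampWeight 1 1 (-1)) (fun _ z => L z) := by
  have h1 : ∀ z : Vec d × Vec d × Vec d, 1 ≤ ampWeight 1 1 (-1) z :=
    one_le_ampWeight zero_le_one zero_le_one (by norm_num)
  refine isSymbol_clm L (C := 1 + ‖L‖) (fun z => ?_) (fun z => ?_)
  · nlinarith [h1 z, norm_nonneg L]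
  · have h2 : ‖z‖ ≤ ampWeight 1 1 (-1) z := by
      simp only [ampWeight, neg_neg, Real.rpow_one]
      have a1 := one_le_bracket z.1
      have a2 := one_le_bracket z.2.1
      have a3 := one_le_bracket z.2.2
      have b := norm_le_bracket_mul z.2
      rw [mul_assoc]
      exact max_le ((norm_le_bracket z.1).trans (le_mul_of_one_le_right (by linarith)
        (one_le_bracket_mul z.2))) (b.trans (le_mul_of_one_le_left (by positivity) a1))
    calc ‖L z‖ ≤ ‖L‖ * ‖z‖ := L.le_opNorm z
      _ ≤ (1 + ‖L‖) * ampWeight 1 1 (-1) z := by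
        gcongr
        linarith

theorem isSymbol_one_ampWeight {W : Type*} [NormedAddCommGroup W] [NormedSpace ℝ W]
    {a : Vec d × Vec d × Vec d → W} (ha : IsSymbol 1 (fun _ => 1) (fun _ => a)) :
    IsSymbol 1 (ampWeight 1 1 (-1)) (fun _ => a) :=
  ha.mono (fun _ => zero_le_one) (C := 1) fun z => by
    simpa using one_le_ampWeight zero_le_one zero_le_one (by norm_num) z

theorem isSymbol_fderiv_component_apply (hκ : IsClassB κ) (b : Fin d ⊕ Fin d)
    (e : Vec d × Vec d) : IsSymbol 1 (fun _ => 1) (fun _ (z : Vec d × Vec d × Vec d) =>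
      ((fderiv ℝ (component κ b) (z.1, z.2.1) e : ℝ) : ℂ)) :=
  (((isSymbol_fderiv_component hκ b).clm_comp (ContinuousLinearMap.apply ℝ ℝ e)).comp_clm
    (projQP d)).clm_comp Complex.ofRealCLM

theorem isSymbol_sub_component (hκ : IsClassB κ) (b : Fin d ⊕ Fin d) (c : ℝ) :
    IsSymbol 1 (ampWeight 1 1 (-1)) (fun _ (z : Vec d × Vec d × Vec d) =>
      ((c - component κ b (z.1, z.2.1) : ℝ) : ℂ)) := by
  have h1 : IsSymbol 1 (ampWeight 1 1 (-1)) (fun _ (z : Vec d × Vec d × Vec d) =>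
      component κ b (z.1, z.2.1)) := by
    refine ((isSymbol_component hκ b).comp_clm (projQP d)).mono
      (fun z => zero_le_one.trans (one_le_bracket_mul (projQP d z))) (C := 1) fun z => ?_
    have := one_le_bracket z.2.2
    simp only [ampWeight, neg_neg, Real.rpow_one, one_mul]
    exact le_mul_of_one_le_right (zero_le_one.trans (one_le_bracket_mul (z.1, z.2.1))) this
  exact ((isSymbol_one_ampWeight (isSymbol_const c)).sub h1).clm_comp Complex.ofRealCLM

theorem isSymbol_phaseDeriv (hκ : IsClassB κ) (Θx Θy : Matrix (Fin d) (Fin d) ℂ) (x : Vec d)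
    (e : Vec d × Vec d × Vec d) :
    IsSymbol 1 (ampWeight 1 1 (-1)) (fun _ => phaseDeriv κ Θx Θy x e) := by
  have hr : ∀ k, IsSymbol 1 (ampWeight 1 1 (-1)) (fun _ (z : Vec d × Vec d × Vec d) =>
      toC (z.2.2 - z.1) k) := fun k =>
    isSymbol_clm_ampWeight (Complex.ofRealCLM.comp ((coord k).comp
      ((ContinuousLinearMap.snd ℝ (Vec d) (Vec d)).comp
        (ContinuousLinearMap.snd ℝ (Vec d) (Vec d × Vec d)) -
        ContinuousLinearMap.fst ℝ (Vec d) (Vec d × Vec d))))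
  have hp : ∀ k, IsSymbol 1 (ampWeight 1 1 (-1)) (fun _ (z : Vec d × Vec d × Vec d) =>
      toC z.2.1 k) := fun k =>
    isSymbol_clm_ampWeight (Complex.ofRealCLM.comp ((coord k).comp
      ((ContinuousLinearMap.fst ℝ (Vec d) (Vec d)).comp
        (ContinuousLinearMap.snd ℝ (Vec d) (Vec d × Vec d)))))
  have hX : ∀ k, IsSymbol 1 (ampWeight 1 1 (-1)) (fun _ (z : Vec d × Vec d × Vec d) =>
      toC (x - (κ (z.1, z.2.1)).1) k) := fun k => isSymbol_sub_component hκ (Sum.inl k) (x k)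
  have h1 : ∀ k, IsSymbol 1 (fun _ => 1) (fun _ (z : Vec d × Vec d × Vec d) =>
      toC (fderiv ℝ κ (z.1, z.2.1) (e.1, e.2.1)).1 k) := fun k => by
    simp only [toC, ← fderiv_component_inl hκ.differentiable]
    exact isSymbol_fderiv_component_apply hκ (Sum.inl k) (e.1, e.2.1)
  have h2 : ∀ k, IsSymbol 1 (fun _ => 1) (fun _ (z : Vec d × Vec d × Vec d) =>
      toC (fderiv ℝ κ (z.1, z.2.1) (e.1, e.2.1)).2 k) := fun k => by
    simp only [toC, ← fderiv_component_inr hκ.differentiable]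
    exact isSymbol_fderiv_component_apply hκ (Sum.inr k) (e.1, e.2.1)
  unfold phaseDeriv
  simp only [dotProduct, Matrix.mulVec]
  refine ((((IsSymbol.sum _ fun k _ => ?_).neg.sub (IsSymbol.sum _ fun k _ => ?_)).add
    ((IsSymbol.sum _ fun k _ => ?_).const_mul _)).add (IsSymbol.sum _ fun k _ => ?_)).sub
    ((IsSymbol.sum _ fun k _ => ?_).const_mul _)
  · simpa only [mul_comm] using (hr k).const_mul (toC e.2.1 k)
  · simpa only [mul_comm] using (hp k).const_mul (toC e.2.2 k)
  · exact (IsSymbol.sum _ fun l _ => (hr l).const_mul _).const_mul _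
  · exact (h2 k).mul_one (hX k)
  · exact (h1 k).mul_one (IsSymbol.sum _ fun l _ => (hX l).const_mul _)

end Canonical

/-! ### Conjugated derivatives and the inner integral over `y`. -/

variable {κ : Vec d × Vec d → Vec d × Vec d} {S : Vec d × Vec d → ℝ}
  {Θx Θy : Matrix (Fin d) (Fin d) ℂ}

/-- The conjugated derivative `e^{-iΦ/ε} ∂_e (e^{iΦ/ε} f)`. -/
def twist (κ : Vec d × Vec d → Vec d × Vec d) (Θx Θy : Matrix (Fin d) (Fin d) ℂ) (ε : ℝ)
    (x : Vec d) (e : Vec d × Vec d × Vec d) (f : Vec d × Vec d × Vec d → ℂ)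
    (z : Vec d × Vec d × Vec d) : ℂ :=
  Complex.I / ε * (phaseDeriv κ Θx Θy x e z * f z) + fderiv ℝ f z e

theorem IsAmplitude.twist (hκ : IsClassB κ) (Θx Θy : Matrix (Fin d) (Fin d) ℂ) (ε : ℝ)
    (x : Vec d) (e : Vec d × Vec d × Vec d) {M m : ℝ} {f : Vec d × Vec d × Vec d → ℂ}
    (hf : IsAmplitude M m f) :
    IsAmplitude (1 + M) (1 + m) (twist κ Θx Θy ε x e f) :=
  ((hf.symbol_mul (isSymbol_phaseDeriv hκ Θx Θy x e)).const_mul _).add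
    ((hf.fderiv_apply e).mono (by linarith) (by linarith))

theorem hasFDerivAt_expPhase_mul (hp : IsPhase κ S Θx Θy) (ε : ℝ) (x : Vec d)
    {f : Vec d × Vec d × Vec d → ℂ} (hf : ContDiff ℝ ∞ f) (z : Vec d × Vec d × Vec d) :
    ∃ Q : Vec d × Vec d × Vec d →L[ℝ] ℂ,
      HasFDerivAt (fun z => expPhase κ S Θx Θy ε x z * f z) Q z ∧
      ∀ e, Q e = expPhase κ S Θx Θy ε x z * twist κ Θx Θy ε x e f z := by
  obtain ⟨Q, hQ, he⟩ := hasFDerivAt_expPhase hp ε x z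
  have hf' : HasFDerivAt f (fderiv ℝ f z) z :=
    (hf.differentiable (by simp)).differentiableAt.hasFDerivAt
  refine ⟨_, hQ.mul hf', fun e => ?_⟩
  simp only [_root_.add_apply, _root_.smul_apply, he, smul_eq_mul, twist]
  ring

theorem integral_twist_y (hp : IsPhase κ S Θx Θy) {ε : ℝ} (hε : 0 < ε) (x : Vec d) {M m : ℝ}
    {f : Vec d × Vec d × Vec d → ℂ} (hf : IsAmplitude M m f) (q p e : Vec d) :
    ∫ y, expPhase κ S Θx Θy ε x (q, p, y) * twist κ Θx Θy ε x (0, 0, e) f (q, p, y) = 0 := by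
  refine integral_eq_zero_of_hasLineDerivAt (v := e) (hf.integrable_y hp hε x q p)
    ((hf.twist hp.classB Θx Θy ε x _).integrable_y hp hε x q p) fun y => ?_
  obtain ⟨Q, hQ, he⟩ := hasFDerivAt_expPhase_mul hp ε x hf.contDiff (q, p, y)
  have h := (hasFDerivAt_sectionY hQ).hasLineDerivAt e
  rw [← he]
  exact h

/-- The integral of `e^{iΦ/ε} f` over `y`, as a function of `(q, p)`. -/
def ampIntegral (κ : Vec d × Vec d → Vec d × Vec d) (S : Vec d × Vec d → ℝ)
    (Θx Θy : Matrix (Fin d) (Fin d) ℂ) (ε : ℝ) (x : Vec d) (f : Vec d × Vec d × Vec d → ℂ)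
    (v : Vec d × Vec d) : ℂ :=
  ∫ y, expPhase κ S Θx Θy ε x (v.1, v.2, y) * f (v.1, v.2, y)

/-- This encodes `L_y e^{iΦ/ε} = e^{iΦ/ε}`. -/
theorem coefA_add_sum (Θy : Matrix (Fin d) (Fin d) ℂ) (z : Vec d × Vec d × Vec d) :
    coefA Θy z + ∑ k, phaseGradY Θy k z * coefB Θy k z = 1 := by
  have h0 : ((gradWeight Θy z : ℝ) : ℂ) ≠ 0 := by
    exact_mod_cast (zero_lt_one.trans_le (one_le_gradWeight Θy z)).ne'
  have h1 : ∑ k, phaseGradY Θy k z * coefB Θy k z =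
      coefA Θy z * ∑ k, (‖phaseGradY Θy k z‖ : ℂ) ^ 2 := by
    rw [Finset.mul_sum]
    refine Finset.sum_congr rfl fun k _ => ?_
    rw [coefB, ← Complex.mul_conj']
    ring
  have h2 : (1 : ℂ) + ∑ k, (‖phaseGradY Θy k z‖ : ℂ) ^ 2 = ((gradWeight Θy z : ℝ) : ℂ) := by
    simp [gradWeight]
  rw [h1, ← mul_one_add, h2, coefA_eq, inv_mul_cancel₀ h0]

/-- Since `iε · (i/ε) = -1`, the zero-order parts of the conjugated derivatives combine with `coefA`
to the identity. So `L_y† f - f` is a sum of terms whose `y`-integral against `e^{iΦ/ε}` vanishes.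
-/
theorem jointLT_eq (κ : Vec d × Vec d → Vec d × Vec d) (Θx Θy : Matrix (Fin d) (Fin d) ℂ)
    {ε : ℝ} (hε : 0 < ε) (x : Vec d) (f : Vec d × Vec d × Vec d → ℂ)
    (z : Vec d × Vec d × Vec d) :
    jointLT Θy ε f z = f z + Complex.I * ε * ∑ k,
      twist κ Θx Θy ε x (0, 0, EuclideanSpace.single k 1) (fun z => coefB Θy k z * f z) z := by
  have hε' : (ε : ℂ) ≠ 0 := by exact_mod_cast hε.ne'
  have h1 : Complex.I * ε * (Complex.I / ε) = -1 := by
    field_simp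
    exact Complex.I_sq
  simp only [jointLT, twist, phaseDeriv_y]
  rw [Finset.sum_add_distrib, mul_add, ← add_assoc]
  congr 1
  rw [← Finset.mul_sum, ← mul_assoc, h1]
  have h2 : ∑ k, phaseGradY Θy k z * (coefB Θy k z * f z) =
      (∑ k, phaseGradY Θy k z * coefB Θy k z) * f z := by
    rw [Finset.sum_mul]
    exact Finset.sum_congr rfl fun k _ => by ring
  rw [h2]
  linear_combination f z * coefA_add_sum Θy z

theorem ampIntegral_jointLT (hp : IsPhase κ S Θx Θy) {ε : ℝ} (hε : 0 < ε) (x : Vec d) {M m : ℝ}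
    {f : Vec d × Vec d × Vec d → ℂ} (hf : IsAmplitude M m f) :
    ampIntegral κ S Θx Θy ε x (jointLT Θy ε f) = ampIntegral κ S Θx Θy ε x f := by
  funext v
  have hB : ∀ k, IsAmplitude M (m - 1) (fun z => coefB Θy k z * f z) :=
    fun k => hf.coefB_mul hp.admY k
  simp only [ampIntegral, jointLT_eq κ Θx Θy hε x f, mul_add]
  have h1 : ∀ y, expPhase κ S Θx Θy ε x (v.1, v.2, y) * (Complex.I * ε * ∑ k,
      twist κ Θx Θy ε x (0, 0, EuclideanSpace.single k 1) (fun z => coefB Θy k z * f z)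
        (v.1, v.2, y)) = Complex.I * ε * ∑ k, expPhase κ S Θx Θy ε x (v.1, v.2, y) *
      twist κ Θx Θy ε x (0, 0, EuclideanSpace.single k 1) (fun z => coefB Θy k z * f z)
        (v.1, v.2, y) := fun y => by
    rw [← Finset.mul_sum]; ring
  have hi : ∀ k, Integrable fun y => expPhase κ S Θx Θy ε x (v.1, v.2, y) *
      twist κ Θx Θy ε x (0, 0, EuclideanSpace.single k 1) (fun z => coefB Θy k z * f z)
        (v.1, v.2, y) := fun k =>
    ((hB k).twist hp.classB Θx Θy ε x _).integrable_y hp hε x v.1 v.2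
  simp only [h1]
  rw [integral_add (hf.integrable_y hp hε x v.1 v.2)
    ((integrable_finsetSum _ fun k _ => hi k).const_mul _), integral_const_mul,
    integral_finsetSum _ fun k _ => hi k]
  simp only [integral_twist_y hp hε x (hB _), Finset.sum_const_zero, mul_zero, add_zero]

theorem ampIntegral_iterate_jointLT (hp : IsPhase κ S Θx Θy) {ε : ℝ} (hε : 0 < ε) (x : Vec d)
    {M m : ℝ} {f : Vec d × Vec d × Vec d → ℂ} (hf : IsAmplitude M m f) (n : ℕ) :
    ampIntegral κ S Θx Θy ε x ((jointLT Θy ε)^[n] f) = ampIntegral κ S Θx Θy ε x f := by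
  induction n with
  | zero => rfl
  | succ n ih =>
    rw [Function.iterate_succ_apply',
      ampIntegral_jointLT hp hε x (hf.iterate_jointLT hp.admY ε n), ih]

theorem integral_ampIntegral_of_lt (hp : IsPhase κ S Θx Θy) {ε : ℝ} (hε : 0 < ε) (x : Vec d)
    {M m : ℝ} {f : Vec d × Vec d × Vec d → ℂ} (hf : IsAmplitude M m f) (hm : m < -d) :
    Integrable (ampIntegral κ S Θx Θy ε x f) ∧
      ∫ z, expPhase κ S Θx Θy ε x z * f z = ∫ v, ampIntegral κ S Θx Θy ε x f v := by
  have hi := hf.integrable hp hε x hm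
  -- Fubini's theorem splits off `y` only after regrouping `(q, (p, y))` as `((q, p), y)`.
  have hmp := volume_preserving_prodAssoc (α₁ := Vec d) (β₁ := Vec d) (γ₁ := Vec d)
  have hi' := (hmp.integrable_comp_emb MeasurableEquiv.prodAssoc.measurableEmbedding).mpr hi
  refine ⟨hi'.integral_prod_left, ?_⟩
  rw [← hmp.integral_comp' (g := fun z => expPhase κ S Θx Θy ε x z * f z)]
  exact integral_prod _ hi'

/-- No bound on `m` is needed: the inner integral is unchanged by `L_y†`, and enough applications
bring the order in `p` below `-d`. -/
theorem integrable_ampIntegral (hp : IsPhase κ S Θx Θy) {ε : ℝ} (hε : 0 < ε) (x : Vec d)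
    {M m : ℝ} {f : Vec d × Vec d × Vec d → ℂ} (hf : IsAmplitude M m f) :
    Integrable (ampIntegral κ S Θx Θy ε x f) := by
  obtain ⟨n, hn⟩ := exists_nat_gt (m + d)
  rw [← ampIntegral_iterate_jointLT hp hε x hf n]
  exact (integral_ampIntegral_of_lt hp hε x (hf.iterate_jointLT hp.admY ε n) (by linarith)).1

/-- Differentiation under the integral sign. Along a compact piece of the line the weights in `q`
and `p` are bounded, and the decay in `y` gives an integrable majorant. -/
theorem hasLineDerivAt_ampIntegral (hp : IsPhase κ S Θx Θy) {ε : ℝ} (hε : 0 < ε) (x : Vec d)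
    {M m : ℝ} {f : Vec d × Vec d × Vec d → ℂ} (hf : IsAmplitude M m f) (v e : Vec d × Vec d) :
    HasLineDerivAt ℝ (ampIntegral κ S Θx Θy ε x f)
      (ampIntegral κ S Θx Θy ε x (twist κ Θx Θy ε x (e.1, e.2, 0) f) v) v e := by
  have ht := hf.twist hp.classB Θx Θy ε x (e.1, e.2, 0)
  obtain ⟨C, hC, hbound⟩ := ht.exists_expPhase_mul_bound hp hε x 0 (d + 1)
  set s := 1 + M - 2 * (0 : ℕ) with hs
  let G : ℝ → ℝ := fun t => bracket (v.1 + t • e.1) ^ s * bracket (v.2 + t • e.2) ^ (1 + m)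
  have hG : Continuous G := by
    have h : ∀ (r : ℝ) (a b : Vec d), Continuous fun t : ℝ => bracket (a + t • b) ^ r :=
      fun r a b => (continuous_bracket.comp (by fun_prop)).rpow_const
        fun t => Or.inl (bracket_pos _).ne'
    exact (h _ _ _).mul (h _ _ _)
  obtain ⟨D, hD⟩ := (isCompact_Icc (a := (-1 : ℝ)) (b := 1)).bddAbove_image hG.continuousOn
  have hD' : ∀ t ∈ Set.Icc (-1 : ℝ) 1, G t ≤ D := fun t ht => hD ⟨t, ht, rfl⟩
  let F : ℝ → Vec d → ℂ := fun t y =>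
    expPhase κ S Θx Θy ε x (v.1 + t • e.1, v.2 + t • e.2, y) *
      f (v.1 + t • e.1, v.2 + t • e.2, y)
  let F' : ℝ → Vec d → ℂ := fun t y =>
    expPhase κ S Θx Θy ε x (v.1 + t • e.1, v.2 + t • e.2, y) *
      twist κ Θx Θy ε x (e.1, e.2, 0) f (v.1 + t • e.1, v.2 + t • e.2, y)
  have key := hasDerivAt_integral_of_dominated_loc_of_deriv_le (μ := (volume : Measure (Vec d)))
    (F := F) (F' := F') (x₀ := 0) (s := Set.Icc (-1 : ℝ) 1)
    (bound := fun y => C * D * bracket y ^ (-((d : ℝ) + 1)))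
    (Icc_mem_nhds (by norm_num) (by norm_num))
    (Filter.Eventually.of_forall fun t =>
      (hf.integrable_y hp hε x (v.1 + t • e.1) (v.2 + t • e.2)).aestronglyMeasurable)
    (hf.integrable_y hp hε x _ _)
    (ht.integrable_y hp hε x _ _).aestronglyMeasurable
    (Filter.Eventually.of_forall fun y t htt => by
      refine (hbound _).trans ?_
      rw [mul_assoc]
      refine mul_le_mul_of_nonneg_left ?_ hC
      exact mul_le_mul_of_nonneg_right (hD' t htt) (Real.rpow_nonneg (bracket_pos y).le _))
    ((integrable_bracket_rpow (by linarith)).const_mul _)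
    (Filter.Eventually.of_forall fun y t _ => by
      obtain ⟨Q, hQ, he⟩ := hasFDerivAt_expPhase_mul hp ε x hf.contDiff
        (v.1 + t • e.1, v.2 + t • e.2, y)
      have h1 : HasDerivAt (fun t : ℝ => (v.1 + t • e.1, v.2 + t • e.2, y)) (e.1, e.2, 0) t := by
        have h2 : ∀ a b : Vec d, HasDerivAt (fun t : ℝ => a + t • b) b t := fun a b => by
          simpa using ((hasDerivAt_id t).smul_const b).const_add a
        exact (h2 _ _).prodMk ((h2 _ _).prodMk (hasDerivAt_const _ _))
      have h3 := hQ.comp_hasDerivAt t h1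
      rw [he] at h3
      exact h3)
  have h := key.2
  simp only [F', zero_smul, add_zero] at h
  exact h

theorem integral_ampIntegral_twist (hp : IsPhase κ S Θx Θy) {ε : ℝ} (hε : 0 < ε) (x : Vec d)
    {M m : ℝ} {f : Vec d × Vec d × Vec d → ℂ} (hf : IsAmplitude M m f) (e : Vec d × Vec d) :
    ∫ v, ampIntegral κ S Θx Θy ε x (twist κ Θx Θy ε x (e.1, e.2, 0) f) v = 0 :=
  haveI : (volume : Measure (Vec d × Vec d)).IsAddHaarMeasure :=
    inferInstanceAs ((volume : Measure (Vec d)).prod volume).IsAddHaarMeasure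
  integral_eq_zero_of_hasLineDerivAt (integrable_ampIntegral hp hε x hf)
    (integrable_ampIntegral hp hε x (hf.twist hp.classB Θx Θy ε x _))
    fun v => hasLineDerivAt_ampIntegral hp hε x hf v e

/-! ### Reduction of the operator to integrals of amplitudes -/

theorem isSymbol_schwartz (φ : 𝓢(Vec d, ℂ)) (N : ℝ) :
    IsSymbol 1 (fun y : Vec d => bracket y ^ (-N)) (fun _ => φ) := by
  obtain ⟨n, hn⟩ := exists_nat_ge N
  refine ⟨fun _ _ _ => φ.smooth _, fun k => ?_⟩
  refine ⟨2 ^ n * (Finset.Iic (n, k)).sup (fun m => SchwartzMap.seminorm ℝ m.1 m.2) φ,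
    fun _ _ _ y => ?_⟩
  have h := SchwartzMap.one_add_le_sup_seminorm_apply (𝕜 := ℝ) (m := (n, k)) le_rfl le_rfl φ y
  have hy := bracket_pos y
  beta_reduce
  rw [Real.rpow_neg hy.le, ← div_eq_mul_inv, le_div_iff₀ (Real.rpow_pos_of_pos hy _), mul_comm]
  refine le_trans ?_ h
  gcongr
  calc bracket y ^ N ≤ bracket y ^ (n : ℝ) :=
        Real.rpow_le_rpow_of_exponent_le (one_le_bracket y) hn
    _ = bracket y ^ n := Real.rpow_natCast _ _
    _ ≤ (1 + ‖y‖) ^ n := pow_le_pow_left₀ hy.le (bracket_le_one_add_norm y) n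

theorem isAmplitude_schwartz (φ : 𝓢(Vec d, ℂ)) : IsAmplitude 0 0 (fun z => φ z.2.2) := by
  intro N
  have h := (isSymbol_schwartz φ N).comp_clm ((ContinuousLinearMap.snd ℝ (Vec d) (Vec d)).comp
    (ContinuousLinearMap.snd ℝ (Vec d) (Vec d × Vec d)))
  have e : ampWeight (d := d) 0 0 N = fun z => bracket z.2.2 ^ (-N) := by
    funext z; simp [ampWeight]
  rw [e]
  exact h

theorem sqrt_le_bracket_mul (x y q : Vec d) :
    Real.sqrt (1 + (‖x‖ ^ 2 + ‖y‖ ^ 2 + ‖q‖ ^ 2)) ≤ bracket x * bracket y * bracket q := by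
  have hx := bracket_pos x
  have hy := bracket_pos y
  have hq := bracket_pos q
  refine Real.sqrt_le_iff.mpr ⟨by positivity, ?_⟩
  rw [mul_pow, mul_pow, bracket_sq, bracket_sq, bracket_sq]
  have h1 : 0 ≤ ‖x‖ ^ 2 := by positivity
  have h2 : 0 ≤ ‖y‖ ^ 2 := by positivity
  have h3 : 0 ≤ ‖q‖ ^ 2 := by positivity
  nlinarith [mul_nonneg h1 h2, mul_nonneg h1 h3, mul_nonneg h2 h3,
    mul_nonneg (mul_nonneg h1 h2) h3]

/-- With `x` fixed, the weight in `(x, y, q)` is at most a constant times `⟨y⟩^{|m|} ⟨q⟩^{|m|}`, and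
`φ` absorbs the power of `⟨y⟩`. The absolute value covers negative `m`. -/
theorem IsSymbol3.isAmplitude {ε₀ m mp : ℝ} {u : ℝ → Vec d × Vec d × Vec d × Vec d → ℂ}
    (hu : IsSymbol3 ε₀ m mp u) {ε : ℝ} (h0 : 0 < ε) (h1 : ε ≤ ε₀) (φ : 𝓢(Vec d, ℂ))
    (x : Vec d) :
    IsAmplitude |m| mp (fun z => u ε (x, z.2.2, z.1, z.2.1) * φ z.2.2) := by
  let A : Vec d × Vec d × Vec d →L[ℝ] Vec d × Vec d × Vec d × Vec d :=
    (0 : Vec d × Vec d × Vec d →L[ℝ] Vec d).prod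
      (((ContinuousLinearMap.snd ℝ (Vec d) (Vec d)).comp
        (ContinuousLinearMap.snd ℝ (Vec d) (Vec d × Vec d))).prod (projQP d))
  have h := (hu.fixed h0 h1).comp_affine (x, 0) A
  have e : ∀ z, (x, (0 : Vec d × Vec d × Vec d)) + A z = (x, z.2.2, z.1, z.2.1) := fun z => by
    refine Prod.ext ?_ ?_
    · exact add_zero x
    · exact zero_add _
  simp only [e] at h
  have h' : IsSymbol 1 (ampWeight |m| mp (-|m|)) (fun _ z => u ε (x, z.2.2, z.1, z.2.1)) := by
    refine h.mono (fun z => by have := bracket_pos z.2.1; positivity)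
      (C := bracket x ^ |m|) fun z => ?_
    have hx := bracket_pos x
    have hy := bracket_pos z.2.2
    have hq := bracket_pos z.1
    have hp := bracket_pos z.2.1
    have h2 : Real.sqrt (1 + (‖x‖ ^ 2 + ‖z.2.2‖ ^ 2 + ‖z.1‖ ^ 2)) ^ m ≤
        (bracket x * bracket z.2.2 * bracket z.1) ^ |m| :=
      (Real.rpow_le_rpow_of_exponent_le (Real.one_le_sqrt.mpr (by
        linarith [sq_nonneg ‖x‖, sq_nonneg ‖z.2.2‖, sq_nonneg ‖z.1‖])) (le_abs_self m)).trans
        (Real.rpow_le_rpow (Real.sqrt_nonneg _) (sqrt_le_bracket_mul _ _ _) (abs_nonneg m))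
    rw [Real.mul_rpow (by positivity) hq.le, Real.mul_rpow hx.le hy.le] at h2
    calc _ ≤ bracket x ^ |m| * bracket z.2.2 ^ |m| * bracket z.1 ^ |m| * bracket z.2.1 ^ mp := by
          gcongr
      _ = _ := by simp only [ampWeight, neg_neg]; ring
  simpa using (isAmplitude_schwartz φ).symbol_mul h'

theorem fioIntegrand_eq (hp : IsPhase κ S Θx Θy) (n : ℕ) (ε : ℝ)
    {u : ℝ → Vec d × Vec d × Vec d × Vec d → ℂ} {φ : 𝓢(Vec d, ℂ)} {x : Vec d} {M m : ℝ}
    (hf : IsAmplitude M m (fun z => u ε (x, z.2.2, z.1, z.2.1) * φ z.2.2)) :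
    fioIntegrand κ S Θx Θy n ε u φ x = fun z => expPhase κ S Θx Θy ε x z *
      (jointLT Θy ε)^[n] (fun z => u ε (x, z.2.2, z.1, z.2.1) * φ z.2.2) z := by
  funext z
  have h := iterate_opLT_section hp.classB.differentiable hp.action hp.admX hp.admY x ε hf
    z.1 z.2.1 n
  simp only at h
  simp only [fioIntegrand, h, expPhase]

theorem integrable_fioIntegrand (hp : IsPhase κ S Θx Θy) {ε₀ ε : ℝ} (h0 : 0 < ε)
    (h1 : ε ≤ ε₀) {u : ℝ → Vec d × Vec d × Vec d × Vec d → ℂ} {n : ℕ}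
    (hn : AdmissiblePower ε₀ u n) (φ : 𝓢(Vec d, ℂ)) (x : Vec d) :
    Integrable (fioIntegrand κ S Θx Θy n ε u φ x) := by
  obtain ⟨m, mp, hu, hlt⟩ := hn
  have hf := hu.isAmplitude h0 h1 φ x
  rw [fioIntegrand_eq hp n ε hf]
  exact (hf.iterate_jointLT hp.admY ε n).integrable hp h0 x (by linarith)

/-- The right-hand side does not contain `n`: this is the independence of the operator from the
admissible power. -/
theorem fio_eq_integral_ampIntegral (hp : IsPhase κ S Θx Θy) {ε₀ ε : ℝ} (h0 : 0 < ε)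
    (h1 : ε ≤ ε₀) {u : ℝ → Vec d × Vec d × Vec d × Vec d → ℂ} {n : ℕ}
    (hn : AdmissiblePower ε₀ u n) (φ : 𝓢(Vec d, ℂ)) (x : Vec d) :
    fio κ S Θx Θy n ε u φ x = (((2 * Real.pi * ε) ^ (3 * (d : ℝ) / 2) : ℝ) : ℂ)⁻¹ *
      ∫ v, ampIntegral κ S Θx Θy ε x (fun z => u ε (x, z.2.2, z.1, z.2.1) * φ z.2.2) v := by
  obtain ⟨m, mp, hu, hlt⟩ := hn
  have hf := hu.isAmplitude h0 h1 φ x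
  rw [fio, fioIntegrand_eq hp n ε hf, (integral_ampIntegral_of_lt hp h0 x
    (hf.iterate_jointLT hp.admY ε n) (by linarith)).2, ampIntegral_iterate_jointLT hp h0 x hf]

/-! ### Linearity of the amplitude integral -/

theorem integral_ampIntegral_add (hp : IsPhase κ S Θx Θy) {ε : ℝ} (hε : 0 < ε) (x : Vec d)
    {M m : ℝ} {f g : Vec d × Vec d × Vec d → ℂ} (hf : IsAmplitude M m f)
    (hg : IsAmplitude M m g) :
    ∫ v, ampIntegral κ S Θx Θy ε x (fun z => f z + g z) v =
      (∫ v, ampIntegral κ S Θx Θy ε x f v) + ∫ v, ampIntegral κ S Θx Θy ε x g v := by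
  rw [← integral_add (integrable_ampIntegral hp hε x hf) (integrable_ampIntegral hp hε x hg)]
  congr 1
  funext v
  simp only [ampIntegral, mul_add]
  exact integral_add (hf.integrable_y hp hε x v.1 v.2) (hg.integrable_y hp hε x v.1 v.2)

theorem integral_ampIntegral_const_mul (ε : ℝ) (x : Vec d)
    (f : Vec d × Vec d × Vec d → ℂ) (c : ℂ) :
    ∫ v, ampIntegral κ S Θx Θy ε x (fun z => c * f z) v =
      c * ∫ v, ampIntegral κ S Θx Θy ε x f v := by
  rw [← integral_const_mul]
  congr 1
  funext v
  simp only [ampIntegral]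
  rw [← integral_const_mul]
  congr 1
  funext y
  ring

theorem integral_ampIntegral_sum_eq_zero (hp : IsPhase κ S Θx Θy) {ε : ℝ} (hε : 0 < ε)
    (x : Vec d) {M m : ℝ} {ι : Type*} (s : Finset ι) {f : ι → Vec d × Vec d × Vec d → ℂ}
    (hf : ∀ i ∈ s, IsAmplitude M m (f i))
    (h0 : ∀ i ∈ s, ∫ v, ampIntegral κ S Θx Θy ε x (f i) v = 0) :
    ∫ v, ampIntegral κ S Θx Θy ε x (fun z => ∑ i ∈ s, f i z) v = 0 := by
  classical
  induction s using Finset.induction_on with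
  | empty => simp [ampIntegral]
  | insert a s ha ih =>
    simp only [Finset.sum_insert ha]
    rw [integral_ampIntegral_add hp hε x (hf a (by simp))
      (IsAmplitude.sum fun i hi => hf i (by simp [hi])), h0 a (by simp),
      ih (fun i hi => hf i (by simp [hi])) fun i hi => h0 i (by simp [hi]), add_zero]

/-! ### Integration by parts with the complex derivatives `∂_{z_k}` -/

/-- The conjugated complex derivative `e^{-iΦ/ε} ∂_{z_k} (e^{iΦ/ε} f)`. -/
def twistZ (κ : Vec d × Vec d → Vec d × Vec d) (Θx Θy : Matrix (Fin d) (Fin d) ℂ) (ε : ℝ)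
    (x : Vec d) (k : Fin d) (f : Vec d × Vec d × Vec d → ℂ) (z : Vec d × Vec d × Vec d) : ℂ :=
  (∑ l, Θy⁻¹ k l * twist κ Θx Θy ε x (EuclideanSpace.single l 1, 0, 0) f z) +
    -Complex.I * twist κ Θx Θy ε x (0, EuclideanSpace.single k 1, 0) f z

theorem IsAmplitude.twistZ (hκ : IsClassB κ) (Θx Θy : Matrix (Fin d) (Fin d) ℂ) (ε : ℝ)
    (x : Vec d) (k : Fin d) {M m : ℝ} {f : Vec d × Vec d × Vec d → ℂ}
    (hf : IsAmplitude M m f) : IsAmplitude (1 + M) (1 + m) (twistZ κ Θx Θy ε x k f) :=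
  (IsAmplitude.sum fun _ _ => (hf.twist hκ Θx Θy ε x _).const_mul _).add
    ((hf.twist hκ Θx Θy ε x _).const_mul _)

theorem integral_ampIntegral_twistZ (hp : IsPhase κ S Θx Θy) {ε : ℝ} (hε : 0 < ε) (x : Vec d)
    {M m : ℝ} {f : Vec d × Vec d × Vec d → ℂ} (hf : IsAmplitude M m f) (k : Fin d) :
    ∫ v, ampIntegral κ S Θx Θy ε x (twistZ κ Θx Θy ε x k f) v = 0 := by
  have h1 : ∀ (c : ℂ) (e : Vec d × Vec d), IsAmplitude (1 + M) (1 + m)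
      (fun z => c * twist κ Θx Θy ε x (e.1, e.2, 0) f z) := fun c e =>
    (hf.twist hp.classB Θx Θy ε x _).const_mul c
  have h2 : ∀ (c : ℂ) (e : Vec d × Vec d), ∫ v, ampIntegral κ S Θx Θy ε x
      (fun z => c * twist κ Θx Θy ε x (e.1, e.2, 0) f z) v = 0 := fun c e => by
    rw [integral_ampIntegral_const_mul, integral_ampIntegral_twist hp hε x hf e, mul_zero]
  have h3 := integral_ampIntegral_add hp hε x
    (IsAmplitude.sum (s := Finset.univ) fun l _ =>
      h1 (Θy⁻¹ k l) (EuclideanSpace.single l 1, 0))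
    (h1 (-Complex.I) (0, EuclideanSpace.single k 1))
  refine h3.trans ?_
  rw [h2, integral_ampIntegral_sum_eq_zero hp hε x _ (fun l _ => h1 _ _) (fun l _ => h2 _ _),
    add_zero]

/-- The block product is expanded into exactly the expressions by which `x - X` enters the
derivative of the phase. -/
theorem matZ_mulVec (hκ : Differentiable ℝ κ) (Θx Θy : Matrix (Fin d) (Fin d) ℂ)
    (v : Vec d × Vec d) (ξ : Fin d → ℂ) (k : Fin d) :
    (matZ κ Θx Θy v *ᵥ ξ) k = Complex.I * ∑ l, Θy⁻¹ k l *
        (toC (fderiv ℝ κ v (EuclideanSpace.single l 1, 0)).2 ⬝ᵥ ξ - Complex.I *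
          (toC (fderiv ℝ κ v (EuclideanSpace.single l 1, 0)).1 ⬝ᵥ (Θx *ᵥ ξ))) +
      (toC (fderiv ℝ κ v (0, EuclideanSpace.single k 1)).2 ⬝ᵥ ξ - Complex.I *
        (toC (fderiv ℝ κ v (0, EuclideanSpace.single k 1)).1 ⬝ᵥ (Θx *ᵥ ξ))) := by
  have h1 : ((jacobian κ v).map Complex.ofReal)ᵀ *ᵥ Sum.elim (-(Complex.I • (Θx *ᵥ ξ))) ξ =
      Sum.elim
        (fun l => toC (fderiv ℝ κ v (EuclideanSpace.single l 1, 0)).2 ⬝ᵥ ξ - Complex.I *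
          (toC (fderiv ℝ κ v (EuclideanSpace.single l 1, 0)).1 ⬝ᵥ (Θx *ᵥ ξ)))
        (fun k => toC (fderiv ℝ κ v (0, EuclideanSpace.single k 1)).2 ⬝ᵥ ξ - Complex.I *
          (toC (fderiv ℝ κ v (0, EuclideanSpace.single k 1)).1 ⬝ᵥ (Θx *ᵥ ξ))) := by
    have h2 : ∀ (e : Vec d × Vec d) (i : Fin d ⊕ Fin d),
        (∀ b, jacobian κ v b i = fderiv ℝ (component κ b) v e) →
        (((jacobian κ v).map Complex.ofReal)ᵀ *ᵥ Sum.elim (-(Complex.I • (Θx *ᵥ ξ))) ξ) i =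
          toC (fderiv ℝ κ v e).2 ⬝ᵥ ξ - Complex.I *
          (toC (fderiv ℝ κ v e).1 ⬝ᵥ (Θx *ᵥ ξ)) := by
      intro e i h
      have hl : ∀ m, jacobian κ v (Sum.inl m) i = (fderiv ℝ κ v e).1 m := fun m =>
        (h _).trans (fderiv_component_inl hκ v e m)
      have hr : ∀ m, jacobian κ v (Sum.inr m) i = (fderiv ℝ κ v e).2 m := fun m =>
        (h _).trans (fderiv_component_inr hκ v e m)
      rw [Matrix.mulVec, dotProduct, Fintype.sum_sum_type]
      simp only [Matrix.transpose_apply, Matrix.map_apply, Sum.elim_inl, Sum.elim_inr, hl, hr,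
        Pi.neg_apply, Pi.smul_apply, smul_eq_mul]
      rw [sub_eq_neg_add, dotProduct, dotProduct, Finset.mul_sum, ← Finset.sum_neg_distrib]
      congr 1
      refine Finset.sum_congr rfl fun m _ => ?_
      simp only [toC]
      ring
    funext i
    cases i with
    | inl l => exact h2 _ _ fun b => jacobian_inl v b l
    | inr l => exact h2 _ _ fun b => jacobian_inr v b l
  rw [matZ, ← Matrix.mulVec_mulVec, ← Matrix.mulVec_mulVec, Matrix.fromRows_mulVec,
    Matrix.one_mulVec, Matrix.neg_mulVec, Matrix.smul_mulVec, h1,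
    Matrix.fromCols_mulVec_sumElim, Matrix.one_mulVec, Matrix.smul_mulVec]
  simp only [Pi.add_apply, Pi.smul_apply, smul_eq_mul, Matrix.mulVec, dotProduct]

/-- The identity `i ∂_z Φ = 𝒵 (x - X)`. -/
theorem phaseDeriv_z (hp : IsPhase κ S Θx Θy) (x : Vec d) (z : Vec d × Vec d × Vec d)
    (k : Fin d) :
    Complex.I * ((∑ l, Θy⁻¹ k l *
        phaseDeriv κ Θx Θy x (EuclideanSpace.single l 1, 0, 0) z) +
      -Complex.I * phaseDeriv κ Θx Θy x (0, EuclideanSpace.single k 1, 0) z) =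
    (matZ κ Θx Θy (z.1, z.2.1) *ᵥ toC (x - (κ (z.1, z.2.1)).1)) k := by
  rw [matZ_mulVec hp.classB.differentiable]
  set ξ := toC (x - (κ (z.1, z.2.1)).1) with hξ
  set r := toC (z.2.2 - z.1) with hr
  have hq : ∀ l, phaseDeriv κ Θx Θy x (EuclideanSpace.single l 1, 0, 0) z =
      -Complex.I * (Θy *ᵥ r) l +
      (toC (fderiv ℝ κ (z.1, z.2.1) (EuclideanSpace.single l 1, 0)).2 ⬝ᵥ ξ - Complex.I *
        (toC (fderiv ℝ κ (z.1, z.2.1) (EuclideanSpace.single l 1, 0)).1 ⬝ᵥ (Θx *ᵥ ξ))) := by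
    intro l
    simp only [phaseDeriv, ← hξ, ← hr, zero_sub, toC_neg, toC_zero, toC_single, dotProduct_zero,
      neg_dotProduct, single_one_dotProduct]
    ring
  have hp' : phaseDeriv κ Θx Θy x (0, EuclideanSpace.single k 1, 0) z = -r k +
      (toC (fderiv ℝ κ (z.1, z.2.1) (0, EuclideanSpace.single k 1)).2 ⬝ᵥ ξ - Complex.I *
        (toC (fderiv ℝ κ (z.1, z.2.1) (0, EuclideanSpace.single k 1)).1 ⬝ᵥ (Θx *ᵥ ξ))) := by
    simp only [phaseDeriv, ← hξ, ← hr, sub_zero, toC_zero, toC_single, dotProduct_zero,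
      zero_dotProduct, dotProduct_single_one]
    ring
  have h1 : ∑ l, Θy⁻¹ k l * (Θy *ᵥ r) l = r k := by
    have : (Θy⁻¹ *ᵥ (Θy *ᵥ r)) k = r k := by
      rw [Matrix.mulVec_mulVec, hp.admY.inv_mul, Matrix.one_mulVec]
    simpa only [Matrix.mulVec, dotProduct] using this
  simp only [hq, hp', mul_add, Finset.sum_add_distrib]
  -- The `q`-derivatives contribute `-i r_k`, and `-i` times the `p`-derivative contributes `+i
  -- r_k`; the dependence on `y - q` disappears.
  have h2 : ∑ l, Θy⁻¹ k l * (-Complex.I * (Θy *ᵥ r) l) = -Complex.I * r k := by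
    rw [← h1, Finset.mul_sum]
    exact Finset.sum_congr rfl fun l _ => by ring
  rw [h2]
  linear_combination (-(toC (fderiv ℝ κ (z.1, z.2.1) (0, EuclideanSpace.single k 1)).2 ⬝ᵥ ξ -
    Complex.I * (toC (fderiv ℝ κ (z.1, z.2.1) (0, EuclideanSpace.single k 1)).1 ⬝ᵥ
      (Θx *ᵥ ξ)))) * Complex.I_mul_I

theorem fderiv_mul_section {g : Vec d × Vec d → ℂ} {φ : Vec d → ℂ} {z : Vec d × Vec d × Vec d}
    (hg : DifferentiableAt ℝ g (z.1, z.2.1)) (hφ : DifferentiableAt ℝ φ z.2.2)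
    (e : Vec d × Vec d) :
    fderiv ℝ (fun z : Vec d × Vec d × Vec d => g (z.1, z.2.1) * φ z.2.2) z (e.1, e.2, 0) =
      fderiv ℝ g (z.1, z.2.1) e * φ z.2.2 := by
  have h1 : HasFDerivAt (fun z : Vec d × Vec d × Vec d => g (z.1, z.2.1)) _ z :=
    HasFDerivAt.comp z hg.hasFDerivAt (projQP d).hasFDerivAt
  have h2 : HasFDerivAt (fun z : Vec d × Vec d × Vec d => φ z.2.2) _ z :=
    HasFDerivAt.comp z hφ.hasFDerivAt ((ContinuousLinearMap.snd ℝ (Vec d) (Vec d)).comp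
      (ContinuousLinearMap.snd ℝ (Vec d) (Vec d × Vec d))).hasFDerivAt
  have h3 := (h1.mul h2).fderiv
  refine (congrArg (fun L => L (e.1, e.2, 0)) h3).trans ?_
  simp [projQP, mul_comm]

theorem isAmplitude_mul_schwartz {g : Vec d × Vec d → ℂ} {M m : ℝ}
    (hg : IsSymbol 1 (fun v => bracket v.1 ^ M * bracket v.2 ^ m) (fun _ => g))
    (φ : 𝓢(Vec d, ℂ)) : IsAmplitude M m (fun z => g (z.1, z.2.1) * φ z.2.2) := by
  have e : ampWeight M m 0 = fun z : Vec d × Vec d × Vec d =>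
      bracket (projQP d z).1 ^ M * bracket (projQP d z).2 ^ m := by
    funext z; simp [ampWeight, projQP]
  have h : IsSymbol 1 (ampWeight M m 0) (fun _ (z : Vec d × Vec d × Vec d) =>
      g (z.1, z.2.1)) := by
    rw [e]; exact hg.comp_clm (projQP d)
  simpa using (isAmplitude_schwartz φ).symbol_mul h

/-- Multiplication by `x_j - X_j` amounts to `-ε` times the divergence of `e_j† 𝒵⁻¹ g`. -/
theorem integral_ampIntegral_sub_mul (hp : IsPhase κ S Θx Θy) {ε : ℝ} (hε : 0 < ε) (x : Vec d)
    {g : Vec d × Vec d → ℂ} {M m : ℝ}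
    (hg : IsSymbol 1 (fun v => bracket v.1 ^ M * bracket v.2 ^ m) (fun _ => g))
    (φ : 𝓢(Vec d, ℂ)) (j : Fin d) :
    ∫ v, ampIntegral κ S Θx Θy ε x (fun z =>
        ((x j - (κ (z.1, z.2.1)).1 j : ℝ) : ℂ) * g (z.1, z.2.1) * φ z.2.2) v =
      ∫ v, ampIntegral κ S Θx Θy ε x (fun z => (ε : ℂ) *
        -divZ Θy (fun v k => (matZ κ Θx Θy v)⁻¹ j k * g v) (z.1, z.2.1) * φ z.2.2) v := by
  have hε' : (ε : ℂ) ≠ 0 := by exact_mod_cast hε.ne'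
  set G : Fin d → Vec d × Vec d → ℂ := fun k v => (matZ κ Θx Θy v)⁻¹ j k * g v with hG
  have hGs : ∀ k, IsSymbol 1 (fun v => bracket v.1 ^ M * bracket v.2 ^ m) (fun _ => G k) :=
    fun k => (isSymbol_matZ_inv hp.classB hp.admX hp.admY j k).mul_one hg
  have hF : ∀ k, IsAmplitude M m (fun z => G k (z.1, z.2.1) * φ z.2.2) := fun k =>
    isAmplitude_mul_schwartz (hGs k) φ
  have hL : IsAmplitude (1 + M) (1 + m) (fun z =>
      ((x j - (κ (z.1, z.2.1)).1 j : ℝ) : ℂ) * g (z.1, z.2.1) * φ z.2.2) := by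
    simp only [mul_assoc]
    exact (isAmplitude_mul_schwartz hg φ).symbol_mul
      (isSymbol_sub_component hp.classB (Sum.inl j) (x j))
  have hT : IsAmplitude (1 + M) (1 + m) (fun z => ∑ k,
      twistZ κ Θx Θy ε x k (fun z => G k (z.1, z.2.1) * φ z.2.2) z) :=
    IsAmplitude.sum fun k _ => (hF k).twistZ hp.classB Θx Θy ε x k
  have hd : ∀ z k e, fderiv ℝ (fun z : Vec d × Vec d × Vec d => G k (z.1, z.2.1) * φ z.2.2) z
      (e.1, e.2, 0) = fderiv ℝ (G k) (z.1, z.2.1) e * φ z.2.2 := fun z k e =>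
    fderiv_mul_section (((hGs k).contDiff.differentiable (by simp)).differentiableAt)
      (φ.differentiable.differentiableAt) e
  -- Product rule: `∂_{z_k}` falls either on `e^{iΦ/ε}`, giving `ε⁻¹ (𝒵(x - X))_k`, or on the `k`-th
  -- component of `e_j† 𝒵⁻¹ g`.
  have htw : ∀ k z, twistZ κ Θx Θy ε x k (fun z => G k (z.1, z.2.1) * φ z.2.2) z =
      (ε : ℂ)⁻¹ * (matZ κ Θx Θy (z.1, z.2.1) *ᵥ toC (x - (κ (z.1, z.2.1)).1)) k *
        (G k (z.1, z.2.1) * φ z.2.2) + partialZ Θy k (G k) (z.1, z.2.1) * φ z.2.2 := by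
    intro k z
    have hq := fun l => hd z k (EuclideanSpace.single l 1, 0)
    have hp' := hd z k (0, EuclideanSpace.single k 1)
    simp only at hq hp'
    rw [← phaseDeriv_z hp]
    simp only [twistZ, twist, hq, hp', partialZ, partialQ, partialP, mul_add,
      Finset.sum_add_distrib, add_mul, sub_mul, Finset.sum_mul, Finset.mul_sum]
    have h1 : ∑ l, Θy⁻¹ k l * (Complex.I / ε *
          (phaseDeriv κ Θx Θy x (EuclideanSpace.single l 1, 0, 0) z *
            (G k (z.1, z.2.1) * φ z.2.2))) =
        ∑ l, (ε : ℂ)⁻¹ * (Complex.I * (Θy⁻¹ k l *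
          phaseDeriv κ Θx Θy x (EuclideanSpace.single l 1, 0, 0) z)) *
            (G k (z.1, z.2.1) * φ z.2.2) :=
      Finset.sum_congr rfl fun l _ => by ring
    have h2 : ∑ l, Θy⁻¹ k l *
          (fderiv ℝ (G k) (z.1, z.2.1) (EuclideanSpace.single l 1, 0) * φ z.2.2) =
        ∑ l, Θy⁻¹ k l * fderiv ℝ (G k) (z.1, z.2.1) (EuclideanSpace.single l 1, 0) *
          φ z.2.2 :=
      Finset.sum_congr rfl fun l _ => by ring
    rw [h1, h2]
    ring
  have hinv : ∀ v ξ, ∑ k, (matZ κ Θx Θy v)⁻¹ j k * (matZ κ Θx Θy v *ᵥ ξ) k = ξ j := by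
    intro v ξ
    have h0 : IsUnit (matZ κ Θx Θy v).det := (Matrix.isUnit_iff_isUnit_det _).mp
      (isUnit_matZOf hp.admX hp.admY (hp.classB.symplectic v))
    have h1 : ((matZ κ Θx Θy v)⁻¹ *ᵥ (matZ κ Θx Θy v *ᵥ ξ)) j = ξ j := by
      rw [Matrix.mulVec_mulVec, Matrix.nonsing_inv_mul _ h0, Matrix.one_mulVec]
    exact h1
  -- Summed over `k`, `𝒵⁻¹` undoes `𝒵`, so the two amplitudes differ by `-ε` times conjugated
  -- derivatives, whose integrals vanish.
  have hpt : (fun z : Vec d × Vec d × Vec d => (ε : ℂ) *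
      -divZ Θy (fun v k => (matZ κ Θx Θy v)⁻¹ j k * g v) (z.1, z.2.1) * φ z.2.2) =
      fun z => ((x j - (κ (z.1, z.2.1)).1 j : ℝ) : ℂ) * g (z.1, z.2.1) * φ z.2.2 +
        -(ε : ℂ) * ∑ k, twistZ κ Θx Θy ε x k (fun z => G k (z.1, z.2.1) * φ z.2.2) z := by
    funext z
    have h1 := hinv (z.1, z.2.1) (toC (x - (κ (z.1, z.2.1)).1))
    have h2 : divZ Θy (fun v k => (matZ κ Θx Θy v)⁻¹ j k * g v) (z.1, z.2.1) =
        ∑ k, partialZ Θy k (G k) (z.1, z.2.1) := rfl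
    have h3 : ∑ k, (ε : ℂ)⁻¹ *
        (matZ κ Θx Θy (z.1, z.2.1) *ᵥ toC (x - (κ (z.1, z.2.1)).1)) k *
        (G k (z.1, z.2.1) * φ z.2.2) = (ε : ℂ)⁻¹ *
          ((x j - (κ (z.1, z.2.1)).1 j : ℝ) : ℂ) * (g (z.1, z.2.1) * φ z.2.2) := by
      have h4 : toC (x - (κ (z.1, z.2.1)).1) j = ((x j - (κ (z.1, z.2.1)).1 j : ℝ) : ℂ) := rfl
      rw [← h4, ← h1, Finset.mul_sum, Finset.sum_mul]
      exact Finset.sum_congr rfl fun k _ => by simp only [hG]; ring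
    simp only [htw, Finset.sum_add_distrib, h3, h2, ← Finset.sum_mul]
    field_simp
    ring
  rw [hpt, integral_ampIntegral_add hp hε x hL (hT.const_mul _),
    integral_ampIntegral_const_mul, integral_ampIntegral_sum_eq_zero hp hε x _
      (fun k _ => (hF k).twistZ hp.classB Θx Θy ε x k)
      (fun k _ => integral_ampIntegral_twistZ hp hε x (hF k) k), mul_zero, add_zero]

/-! ### Symbol classes of the two sides -/

theorem rpow_le_rpow_abs {a b : ℝ} (ha : 1 ≤ a) (hab : a ≤ b) (m : ℝ) : a ^ m ≤ b ^ |m| :=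
  (Real.rpow_le_rpow_of_exponent_le ha (le_abs_self m)).trans
    (Real.rpow_le_rpow (zero_le_one.trans ha) hab (abs_nonneg m))

theorem IsSymbolXQP.liftY_isSymbolInfty {ε₀ mx mq mp : ℝ} {u : ℝ → Vec d × Vec d × Vec d → ℂ}
    (hu : IsSymbolXQP ε₀ mx mq mp u) : IsSymbolInfty ε₀ (liftY u) := by
  refine ⟨|mx| + |mq| + |mp|, ?_⟩
  let A : Vec d × Vec d × Vec d × Vec d →L[ℝ] Vec d × Vec d × Vec d :=
    (ContinuousLinearMap.fst ℝ (Vec d) (Vec d × Vec d × Vec d)).prod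
      ((ContinuousLinearMap.snd ℝ (Vec d) (Vec d × Vec d)).comp
        (ContinuousLinearMap.snd ℝ (Vec d) (Vec d × Vec d × Vec d)))
  refine (hu.comp_clm A).mono (fun z => ?_) (C := 1) fun z => ?_
  · have := bracket_pos z.1
    have := bracket_pos z.2.2.1
    have := bracket_pos z.2.2.2
    change 0 ≤ bracket z.1 ^ mx * bracket z.2.2.1 ^ mq * bracket z.2.2.2 ^ mp
    positivity
  · change bracket z.1 ^ mx * bracket z.2.2.1 ^ mq * bracket z.2.2.2 ^ mp ≤ _
    have h0 := sq_nonneg ‖z.1‖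
    have h1 := sq_nonneg ‖z.2.1‖
    have h2 := sq_nonneg ‖z.2.2.1‖
    have h3 := sq_nonneg ‖z.2.2.2‖
    have hx := rpow_le_rpow_abs (one_le_bracket z.1) (Real.sqrt_le_sqrt (by linarith :
      1 + ‖z.1‖ ^ 2 ≤ 1 + (‖z.1‖ ^ 2 + ‖z.2.1‖ ^ 2 + ‖z.2.2.1‖ ^ 2 + ‖z.2.2.2‖ ^ 2))) mx
    have hq := rpow_le_rpow_abs (one_le_bracket z.2.2.1) (Real.sqrt_le_sqrt (by linarith :
      1 + ‖z.2.2.1‖ ^ 2 ≤ 1 + (‖z.1‖ ^ 2 + ‖z.2.1‖ ^ 2 + ‖z.2.2.1‖ ^ 2 + ‖z.2.2.2‖ ^ 2))) mq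
    have hp := rpow_le_rpow_abs (one_le_bracket z.2.2.2) (Real.sqrt_le_sqrt (by linarith :
      1 + ‖z.2.2.2‖ ^ 2 ≤ 1 + (‖z.1‖ ^ 2 + ‖z.2.1‖ ^ 2 + ‖z.2.2.1‖ ^ 2 + ‖z.2.2.2‖ ^ 2))) mp
    have hpos : 0 < Real.sqrt
        (1 + (‖z.1‖ ^ 2 + ‖z.2.1‖ ^ 2 + ‖z.2.2.1‖ ^ 2 + ‖z.2.2.2‖ ^ 2)) :=
      Real.sqrt_pos.mpr (by linarith)
    have b1 := bracket_pos z.2.2.1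
    have b2 := bracket_pos z.2.2.2
    rw [one_mul, Real.rpow_add hpos, Real.rpow_add hpos]
    gcongr

/-- All three orders rise by one because `X_j` may grow linearly in `q` and in `p`. -/
theorem isSymbolXQP_sub_mul (hκ : IsClassB κ) {ε₀ mx mq mp : ℝ}
    {u : ℝ → Vec d × Vec d × Vec d → ℂ} (hu : IsSymbolXQP ε₀ mx mq mp u) (j : Fin d) :
    IsSymbolXQP ε₀ (1 + mx) (1 + mq) (1 + mp)
      (fun ε w => ((w.1 j - (κ w.2).1 j : ℝ) : ℂ) * u ε w) := by
  have hw : ∀ z : Vec d × Vec d × Vec d, bracket z.2.1 * bracket z.2.2 ≤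
      1 * (bracket z.1 * bracket z.2.1 * bracket z.2.2) := fun z => by
    rw [one_mul, mul_assoc]
    exact le_mul_of_one_le_left (zero_le_one.trans (one_le_bracket_mul z.2)) (one_le_bracket z.1)
  have h1 : IsSymbol ε₀ (fun z : Vec d × Vec d × Vec d =>
      bracket z.1 * bracket z.2.1 * bracket z.2.2)
      (fun _ z => z.1 j - component κ (Sum.inl j) z.2) := by
    refine IsSymbol.sub (isSymbol_clm ((coord j).comp
      (ContinuousLinearMap.fst ℝ (Vec d) (Vec d × Vec d))) (C := 1) (fun z => ?_) fun z => ?_) ?_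
    · exact (one_le_bracket_mul z.2).trans (hw z)
    · rw [one_mul, mul_assoc]
      exact ((PiLp.norm_apply_le z.1 j).trans (norm_le_bracket z.1)).trans
        (le_mul_of_one_le_right (bracket_pos z.1).le (one_le_bracket_mul z.2))
    · exact (((isSymbol_component hκ (Sum.inl j)).comp_clm
        (ContinuousLinearMap.snd ℝ (Vec d) (Vec d × Vec d))).of_fixed ε₀).mono
        (fun z => zero_le_one.trans (one_le_bracket_mul z.2)) hw
  have h2 := (h1.clm_comp Complex.ofRealCLM).mul hu
  have e : (fun z : Vec d × Vec d × Vec d => bracket z.1 * bracket z.2.1 * bracket z.2.2 *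
      (bracket z.1 ^ mx * bracket z.2.1 ^ mq * bracket z.2.2 ^ mp)) =
      fun z => bracket z.1 ^ (1 + mx) * bracket z.2.1 ^ (1 + mq) *
        bracket z.2.2 ^ (1 + mp) := by
    funext z
    simp only [Real.rpow_add (bracket_pos _), Real.rpow_one]
    ring
  rw [e] at h2
  exact h2

theorem isSymbol_parameter {V : Type*} [NormedAddCommGroup V] [NormedSpace ℝ V] (ε₀ : ℝ) :
    IsSymbol ε₀ (fun _ : V => 1) (fun ε _ => (ε : ℂ)) := by
  refine ⟨fun _ _ _ => contDiff_const, fun k => ⟨ε₀, fun ε h0 h1 z => ?_⟩⟩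
  rcases Nat.eq_zero_or_pos k with rfl | hk
  · simpa [abs_of_pos h0] using h1
  · rw [iteratedFDeriv_const_of_ne hk.ne']
    simpa using h0.le.trans h1

theorem IsSymbolXQP.fix_x {ε₀ mx mq mp : ℝ} {u : ℝ → Vec d × Vec d × Vec d → ℂ}
    (hu : IsSymbolXQP ε₀ mx mq mp u) {ε : ℝ} (h0 : 0 < ε) (h1 : ε ≤ ε₀) (x : Vec d) :
    IsSymbol 1 (fun v => bracket v.1 ^ mq * bracket v.2 ^ mp) (fun _ v => u ε (x, v)) := by
  have h := (hu.fixed h0 h1).comp_affine (x, 0)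
    (ContinuousLinearMap.inr ℝ (Vec d) (Vec d × Vec d))
  have e : ∀ v : Vec d × Vec d, (x, (0 : Vec d × Vec d)) +
      ContinuousLinearMap.inr ℝ (Vec d) (Vec d × Vec d) v = (x, v) := fun v => by simp
  simp only [e] at h
  refine h.mono (fun v => ?_) (C := bracket x ^ mx) fun v => (mul_assoc _ _ _).le
  have := bracket_pos x
  have := bracket_pos v.1
  have := bracket_pos v.2
  positivity

end HermanKluk

end

/-! ### The lemma. -/

open HermanKluk in
theorem lemma3p5 {d : ℕ} (κ : Vec d × Vec d → Vec d × Vec d) (hκ : IsClassB κ)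
    (S : Vec d × Vec d → ℝ) (hS : IsAction κ S)
    (Θx Θy : Matrix (Fin d) (Fin d) ℂ) (hΘx : IsAdmissible Θx) (hΘy : IsAdmissible Θy)
    (ε₀ : ℝ) (hε₀ : 0 < ε₀) (hε₀' : ε₀ ≤ 1) (mx mq mp : ℝ)
    (u : ℝ → Vec d × Vec d × Vec d → ℂ) (hu : IsSymbolXQP ε₀ mx mq mp u) (j : Fin d) :
    (∀ z, IsUnit (matZ κ Θx Θy z)) ∧
    IsSymbolXQP ε₀ mx mq mp (symbolV κ Θx Θy j u) ∧
    Equivalent κ S Θx Θy ε₀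
      (liftY fun ε w => ((w.1 j - (κ w.2).1 j : ℝ) : ℂ) * u ε w)
      (liftY fun ε w => (ε : ℂ) * symbolV κ Θx Θy j u ε w) := by
  have hp : IsPhase κ S Θx Θy := ⟨hκ, hS, hΘx, hΘy⟩
  have hv : IsSymbolXQP ε₀ mx mq mp (symbolV κ Θx Θy j u) := isSymbol_symbolV hκ hΘx hΘy hu j
  have hεv : IsSymbolXQP ε₀ mx mq mp (fun ε w => (ε : ℂ) * symbolV κ Θx Θy j u ε w) :=
    (isSymbol_parameter ε₀).mul_one hv
  refine ⟨fun z => isUnit_matZOf hΘx hΘy (hκ.symplectic z), hv,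
    (isSymbolXQP_sub_mul hκ hu j).liftY_isSymbolInfty, hεv.liftY_isSymbolInfty,
    fun n hn ε h0 h1 φ x => integrable_fioIntegrand hp h0 h1 hn φ x,
    fun n hn ε h0 h1 φ x => integrable_fioIntegrand hp h0 h1 hn φ x,
    fun n n' hn hn' ε h0 h1 φ x => ?_⟩
  -- Once both operators are integrals over `(q, p)` of inner integrals, the powers `n` and `n'` no
  -- longer matter.
  rw [fio_eq_integral_ampIntegral hp h0 h1 hn, fio_eq_integral_ampIntegral hp h0 h1 hn']
  exact congrArg _ (integral_ampIntegral_sub_mul hp h0 x (hu.fix_x h0 h1 x) φ j)
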